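/- Let $M>0$. The Kruskal extension is the manifold of points $(T,X,\omega)\in\mathbb R^2\times S^2$ with $X^2-T^2>-2M$, with the Lorentzian metric $$ds^2=\frac{16M^2e^{-r/2M}}{r}\,(-dT^2+dX^2)+r^2\,(d\theta^2+\sin^2\theta\,d\phi^2),$$ where $r=r(T,X)>0$ is determined by $(r-2M)e^{r/2M}=X^2-T^2$, and with $\partial_T$ future-directed. For a spacelike hypersurface with future-directed unit normal $\vec n$ the mean curvature is $H=\frac13 g^{ij}\langle\nabla_{e_i}\vec n,e_j\rangle$. A TSS-CMC hypersurface is a spacelike hypersurface of constant mean curvature, closed in the Kruskal extension, which is spherically symmetric (invariant under the rotations of $S^2$) and $T$-axisymmetric (invariant under $X\mapsto -X$), and which is given by $T=F(X)$ with $F$ a smooth function on an open interval. It meets the $T$-axis $X=0$ in one value $T_0$; if $H$ is its mean curvature and $r_0=r(T_0,0)\in(0,2M]$, its parameter is $$c=-Hr_0^3+r_0^{3/2}(2M-r_0)^{1/2}\ \text{ if } T_0\le 0,\qquad c=-Hr_0^3-r_0^{3/2}(2M-r_0)^{1/2}\ \text{ if } T_0\ge 0.$$ Theorem. There are a function $c\mapsto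 H(c)$ on $\mathbb R$ and a family of hypersurfaces $\{\Sigma_{H(c),c}\}$, $c\in\mathbb R$, in the Kruskal extension such that: (a) every $\Sigma_{H(c),c}$ is a TSS-CMC hypersurface with mean curvature $H(c)$ and parameter $c$; (b) any two hypersurfaces of the family (with different $c$) are disjoint; (c) every point of the Kruskal extension belongs to $\Sigma_{H(c'),c'}$ for some $c'\in\mathbb R$; (d) as the family runs from the bottom to the top, $c$ decreases from $\infty$ to $-\infty$ and $H$ increases from $-\infty$ to $\infty$: if $c<c'$, then $\Sigma_{H(c'),c'}$ lies below $\Sigma_{H(c),c}$ (that is, $T'<T$ whenever $(T',X,\omega)\in\Sigma_{H(c'),c'}$ and $(T,X,\omega)\in\Sigma_{H(c),c}$), and $H$ is continuous and strictly decreasing in $c$ with $H(c)\to-\infty$ as $c\to\infty$ and $H(c)\to\infty$ as $c\to-\infty$; (e) the family is invariant under the reflection $T\mapsto -T$ with respect to the $X$-axis, which maps $\Sigma_{H(c),c}$ onto $\Sigma_{H(-c),-c}$. In particular the hypersurfaces $\Sigma_{H(c),c}$ foliate the Kruskal extension. -/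

import Mathlib

open scoped ContDiff Matrix

noncomputable section

/-! ### Hypersurfaces of a four-dimensional Lorentzian manifold, in coordinates -/

namespace LorentzChart

/-- The partial derivative `∂ᵢ f` of a function of `n` real variables. -/
def pderiv {n : ℕ} (i : Fin n) (f : (Fin n → ℝ) → ℝ) (p : Fin n → ℝ) : ℝ :=
  fderiv ℝ f p (Pi.single i 1)

/-- A field of `4 × 4` matrices `g_{ab}`, the components of a metric in a chart. -/
abbrev MetricField := (Fin 4 → ℝ) → Matrix (Fin 4) (Fin 4) ℝ

/-- The scalar product `⟨v, w⟩ = g_{ab} v^a w^b` at the point `p`. -/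
def dot (g : MetricField) (p v w : Fin 4 → ℝ) : ℝ := v ⬝ᵥ (g p *ᵥ w)

/-- Christoffel symbols of the Levi-Civita connection,
`Γ^a_{bc} = ½ g^{ad} (∂_b g_{dc} + ∂_c g_{db} - ∂_d g_{bc})`. -/
def christoffel (g : MetricField) (p : Fin 4 → ℝ) (a b c : Fin 4) : ℝ :=
  (1 / 2) * ∑ d, (g p)⁻¹ a d *
    (pderiv b (fun q => g q d c) p + pderiv c (fun q => g q d b) p
      - pderiv d (fun q => g q b c) p)

/-- The coordinate tangent vector `e_i = ∂_i ψ` of a parametrized hypersurface `ψ`. -/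
def tangent (ψ : (Fin 3 → ℝ) → Fin 4 → ℝ) (u : Fin 3 → ℝ) (i : Fin 3) : Fin 4 → ℝ :=
  fun a => pderiv i (fun v => ψ v a) u

/-- The induced metric `g_{ij} = ⟨e_i, e_j⟩` of a parametrized hypersurface. -/
def inducedMetric (g : MetricField) (ψ : (Fin 3 → ℝ) → Fin 4 → ℝ) (u : Fin 3 → ℝ) :
    Matrix (Fin 3) (Fin 3) ℝ :=
  Matrix.of fun i j => dot g (ψ u) (tangent ψ u i) (tangent ψ u j)

/-- The covariant derivative `∇_{e_i} n` of a vector field `n` along `ψ`: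
`(∇_{e_i} n)^a = ∂_i n^a + Γ^a_{bc} e_i^b n^c`. -/
def covDeriv (g : MetricField) (ψ n : (Fin 3 → ℝ) → Fin 4 → ℝ) (u : Fin 3 → ℝ) (i : Fin 3) :
    Fin 4 → ℝ :=
  fun a => pderiv i (fun v => n v a) u
    + ∑ b, ∑ c, christoffel g (ψ u) a b c * tangent ψ u i b * n u c

/-- The mean curvature `H = (1/3) g^{ij} ⟨∇_{e_i} n, e_j⟩` with respect to the normal `n`. -/
def meanCurvature (g : MetricField) (ψ n : (Fin 3 → ℝ) → Fin 4 → ℝ) (u : Fin 3 → ℝ) : ℝ :=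
  (1 / 3) * ∑ i, ∑ j, (inducedMetric g ψ u)⁻¹ i j * dot g (ψ u) (covDeriv g ψ n u i) (tangent ψ u j)

/-- `n` is the future-directed unit normal field along `ψ : U → ℝ⁴`, where the time
orientation is given by the timelike coordinate field `∂₀ = (1, 0, 0, 0)`. -/
structure IsFutureUnitNormal (g : MetricField) (U : Set (Fin 3 → ℝ))
    (ψ n : (Fin 3 → ℝ) → Fin 4 → ℝ) : Prop where
  smooth : ContDiffOn ℝ ∞ n U
  orthogonal : ∀ u ∈ U, ∀ i, dot g (ψ u) (n u) (tangent ψ u i) = 0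
  unit : ∀ u ∈ U, dot g (ψ u) (n u) (n u) = -1
  future : ∀ u ∈ U, dot g (ψ u) (n u) (Pi.single 0 1) < 0

/-- The parametrized hypersurface `ψ : U → ℝ⁴` is smooth and spacelike, and its mean curvature
with respect to the future-directed unit normal is the constant `H`. -/
structure IsSpacelikeCMC (g : MetricField) (H : ℝ) (U : Set (Fin 3 → ℝ))
    (ψ : (Fin 3 → ℝ) → Fin 4 → ℝ) : Prop where
  smooth : ContDiffOn ℝ ∞ ψ U
  spacelike : ∀ u ∈ U, (inducedMetric g ψ u).PosDef
  cmc : ∃ n, IsFutureUnitNormal g U ψ n ∧ ∀ u ∈ U, meanCurvature g ψ n u = H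

end LorentzChart

/-! ### The Kruskal extension -/

namespace Kruskal

/-- For `X² - T² > -2M` there is exactly one radius `r > 0` with
`(r - 2M) e^{r/2M} = X² - T²`. -/
theorem existsUnique_radius {M T X : ℝ} (hM : 0 < M) (h : -(2 * M) < X ^ 2 - T ^ 2) :
    ∃! r : ℝ, 0 < r ∧ (r - 2 * M) * Real.exp (r / (2 * M)) = X ^ 2 - T ^ 2 := by
  set f : ℝ → ℝ := fun r => (r - 2 * M) * Real.exp (r / (2 * M)) with hf
  have hc : Continuous f := by fun_prop
  have hder : ∀ r, HasDerivAt f (r / (2 * M) * Real.exp (r / (2 * M))) r := by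
    intro r
    have h1 : HasDerivAt (fun r : ℝ => r - 2 * M) 1 r := (hasDerivAt_id r).sub_const _
    have h2 : HasDerivAt (fun r : ℝ => r / (2 * M)) (1 / (2 * M)) r :=
      (hasDerivAt_id r).div_const _
    refine (h1.mul h2.exp).congr_deriv ?_
    have hM' := hM.ne'
    field_simp
    ring
  have hmono : StrictMonoOn f (Set.Ici 0) := by
    apply strictMonoOn_of_deriv_pos (convex_Ici 0) hc.continuousOn
    intro r hr
    rw [interior_Ici] at hr
    have hr' : 0 < r := hr
    rw [(hder r).deriv]
    positivity
  have hf0 : f 0 = -(2 * M) := by simp [hf]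
  obtain ⟨b, hb0, hb⟩ : ∃ b, 0 ≤ b ∧ X ^ 2 - T ^ 2 ≤ f b := by
    refine ⟨2 * M + X ^ 2, by positivity, ?_⟩
    have h1 : 1 ≤ Real.exp ((2 * M + X ^ 2) / (2 * M)) := Real.one_le_exp (by positivity)
    have h2 : f (2 * M + X ^ 2) = X ^ 2 * Real.exp ((2 * M + X ^ 2) / (2 * M)) := by
      simp [hf]
    rw [h2]
    nlinarith [sq_nonneg X, sq_nonneg T]
  obtain ⟨r, hr, hrv⟩ : X ^ 2 - T ^ 2 ∈ f '' Set.Icc 0 b :=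
    intermediate_value_Icc hb0 hc.continuousOn ⟨by rw [hf0]; exact h.le, hb⟩
  have hr0 : 0 < r := by
    rcases hr.1.eq_or_lt with h0 | h0
    · rw [← h0, hf0] at hrv
      linarith
    · exact h0
  refine ⟨r, ⟨hr0, hrv⟩, ?_⟩
  rintro s ⟨hs0, hs⟩
  exact hmono.injOn (Set.mem_Ici.2 hs0.le) (Set.mem_Ici.2 hr0.le) (hs.trans hrv.symm)

/-- The area radius `r(T, X)`: the `r > 0` with `(r - 2M) e^{r/2M} = X² - T²`. -/
def radius (M T X : ℝ) : ℝ :=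
  Classical.epsilon fun r => 0 < r ∧ (r - 2 * M) * Real.exp (r / (2 * M)) = X ^ 2 - T ^ 2

theorem radius_spec {M T X : ℝ} (hM : 0 < M) (h : -(2 * M) < X ^ 2 - T ^ 2) :
    0 < radius M T X ∧
      (radius M T X - 2 * M) * Real.exp (radius M T X / (2 * M)) = X ^ 2 - T ^ 2 :=
  Classical.epsilon_spec (existsUnique_radius hM h).exists

/-- The unit sphere of Euclidean three-space. -/
abbrev S2 := Metric.sphere (0 : EuclideanSpace ℝ (Fin 3)) 1

/-- Points `(T, X, x)` of `ℝ² × S²`. -/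
abbrev Event := ℝ × ℝ × S2

/-- The Kruskal extension: the points `(T, X, x)` with `X² - T² > -2M`, that is, with `r > 0`. -/
def extension (M : ℝ) : Set Event := {p | -(2 * M) < p.2.1 ^ 2 - p.1 ^ 2}

/-- The point of the unit sphere with polar angle `θ` and azimuth `φ`. -/
def sphPoint (θ φ : ℝ) : S2 :=
  ⟨!₂[Real.sin θ * Real.cos φ, Real.sin θ * Real.sin φ, Real.cos θ], by
    rw [mem_sphere_zero_iff_norm, EuclideanSpace.norm_eq, Real.sqrt_eq_one]
    simp only [Fin.sum_univ_three, Real.norm_eq_abs, sq_abs]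
    simp
    nlinarith [Real.sin_sq_add_cos_sq θ, Real.sin_sq_add_cos_sq φ]⟩

/-- The point with coordinates `(T, X, θ, φ)`. -/
def ofCoords (q : Fin 4 → ℝ) : Event := (q 0, q 1, sphPoint (q 2) (q 3))

/-- The Kruskal metric
`(16 M² e^{-r/2M} / r) (-dT² + dX²) + r² dθ² + r² sin² θ dφ²`
in the coordinates `(T, X, θ, φ)`, `0 < θ < π`. -/
def metric (M : ℝ) : LorentzChart.MetricField := fun q =>
  let r := radius M (q 0) (q 1)
  let A := 16 * M ^ 2 * Real.exp (-r / (2 * M)) / r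
  Matrix.diagonal ![-A, A, r ^ 2, r ^ 2 * Real.sin (q 2) ^ 2]

/-- Invariance under the rotations of the sphere factor. -/
def IsSphericallySymmetric (S : Set Event) : Prop :=
  ∀ (A : EuclideanSpace ℝ (Fin 3) ≃ₗᵢ[ℝ] EuclideanSpace ℝ (Fin 3)) (T X : ℝ) (x x' : S2),
    A x = x' → (T, X, x) ∈ S → (T, X, x') ∈ S

/-- Symmetry about the `T`-axis: invariance under `X ↦ -X`. -/
def IsTAxisymmetric (S : Set Event) : Prop :=
  ∀ (T X : ℝ) (x : S2), (T, X, x) ∈ S → (T, -X, x) ∈ S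

/-- The reflection with respect to the `X`-axis, `T ↦ -T`. -/
def reflectXAxis (p : Event) : Event := (-p.1, p.2)

/-- The parametrization `(X, θ, φ) ↦ (F(X), X, θ, φ)` of the hypersurface `T = F(X)`. -/
def graphChart (F : ℝ → ℝ) (u : Fin 3 → ℝ) : Fin 4 → ℝ := ![F (u 0), u 0, u 1, u 2]

/-- The parameter domain `X ∈ I`, `0 < θ < π` of the hypersurface `T = F(X)`. -/
def graphDomain (I : Set ℝ) : Set (Fin 3 → ℝ) := {u | u 0 ∈ I ∧ u 1 ∈ Set.Ioo 0 Real.pi}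

/-- `S` is a `T`-axisymmetric, spacelike, spherically symmetric hypersurface of constant mean
curvature `H` in the Kruskal extension: a relatively closed set given by `T = F(X)` with `F` smooth
on an open interval. The coordinates omit the poles of the spheres, which are no different from the
other points because of the spherical symmetry. -/
structure IsTSSCMC (M H : ℝ) (S : Set Event) : Prop where
  subset : S ⊆ extension M
  closed : closure S ∩ extension M ⊆ S
  spherical : IsSphericallySymmetric S
  axisymmetric : IsTAxisymmetric S
  spacelike_cmc : ∃ (I : Set ℝ) (F : ℝ → ℝ), IsOpen I ∧ I.OrdConnected ∧ I.Nonempty ∧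
    (∀ q : Fin 4 → ℝ, q 2 ∈ Set.Ioo 0 Real.pi → (ofCoords q ∈ S ↔ q 1 ∈ I ∧ q 0 = F (q 1))) ∧
    ContDiffOn ℝ ∞ F I ∧
    LorentzChart.IsSpacelikeCMC (metric M) H (graphDomain I) (graphChart F)

/-- `c` is the parameter of the hypersurface `S` of mean curvature `H`: if `S` meets the `T`-axis
at `T₀`, where the radius is `r`, then `c = -H r³ + r^{3/2} (2M - r)^{1/2}` for `T₀ ≤ 0` and
`c = -H r³ - r^{3/2} (2M - r)^{1/2}` for `T₀ ≥ 0` (at `T₀ = 0` one has `r = 2M`). -/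
def HasParameter (M H c : ℝ) (S : Set Event) : Prop :=
  ∃ T₀ : ℝ, (∀ x, (T₀, 0, x) ∈ S) ∧
    (T₀ ≤ 0 → c = -H * radius M T₀ 0 ^ 3
      + radius M T₀ 0 ^ (3 / 2 : ℝ) * (2 * M - radius M T₀ 0) ^ (1 / 2 : ℝ)) ∧
    (0 ≤ T₀ → c = -H * radius M T₀ 0 ^ 3
      - radius M T₀ 0 ^ (3 / 2 : ℝ) * (2 * M - radius M T₀ 0) ^ (1 / 2 : ℝ))

/-- `S` lies below `S'` in the `T`-direction. -/
def LiesBelow (S S' : Set Event) : Prop :=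
  ∀ (T T' X : ℝ) (x : S2), (T, X, x) ∈ S → (T', X, x) ∈ S' → T < T'

end Kruskal

end

open scoped ContDiff Matrix

noncomputable section

/-! A spherically symmetric spacelike hypersurface is a curve T = F(X), described by its rapidity η,
with F' = tanh η. Having mean curvature H is then the equation η' = `accel`, which is smooth over
the Kruskal extension. So every height τ on the T-axis and every H determine one maximal profile
curve crossing the axis orthogonally. The task is to choose H as a function of τ so that these
curves are ordered and sweep out the extension.

Order. Let a dot be the derivative in arc length. Since the metric is Ricci flat, the normal
component φ of a variation satisfies (r² φ̇)˙ = r² (|A|² φ + 3 δH). This system for φ and r² φ̇ is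
cooperative: if φ starts positive with φ̇ = 0 and δH ≥ 0, then φ stays positive. Curves therefore
rise when τ rises and H does not drop. `exists_height_lt` proves this for nearby curves, with the
linearization error absorbed by `pos_of_cooperative`; a continuity argument in τ and the symmetry T
↦ -T give `Admissible.height_lt`.

Covering. The pair r² ṙ, (r² ṙ)˙ solves a cooperative linear system as well, so r is monotone on
each half of a curve, in a direction decided on the axis by `centralForce`. Moreover a curve
continues as long as X² - T² stays away from -2M, because the rapidity cannot blow up before that.
Together these show in `Admissible.exists_height_ge` that the curves over a given X reach
arbitrarily far up, and the intermediate value theorem fills the rest. Closedness of a leaf follows,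
since any point off it is separated from it by a third leaf.

Choice of H. On the axis, let f = `axisFlux`, which is r^{-3/2} (2M - r)^{1/2} with the sign of τ.
The parameter is c = -r³ (H + f), so H = f ((2M)³/r³ - 1) gives c = -(2M)³ f. Now f is an increasing
bijection from the heights onto ℝ, and H increases with τ as well. -/

/-! ### Ordinary differential equations on an open set -/

namespace ODEOn

open Set Metric Filter Topology NNReal

variable {E : Type*} [NormedAddCommGroup E] [NormedSpace ℝ E]

/-- Near a compact subset of its domain, a `C¹` vector field agrees with a bounded, globally
Lipschitz one. -/
theorem exists_cutoff [FiniteDimensional ℝ E] {v : E → E} {U K : Set E}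
    (hU : IsOpen U) (hv : ContDiffOn ℝ 1 v U) (hK : IsCompact K) (hKU : K ⊆ U) :
    ∃ w : E → E, (∃ L : ℝ≥0, ∀ x, ‖w x‖ ≤ L) ∧ (∃ C, LipschitzWith C w) ∧
      ∃ δ > 0, thickening δ K ⊆ U ∧ ∀ x ∈ thickening δ K, w x = v x := by
  have : ProperSpace E := FiniteDimensional.proper ℝ E
  obtain ⟨K', hK', hKK', hK'U⟩ := exists_compact_between hK hU hKU
  obtain ⟨f, hf0, hf1, -⟩ := exists_contMDiffMap_zero_one_nhds_of_isClosed (n := 1)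
    (modelWithCornersSelf ℝ E) (s := (interior K')ᶜ) (t := K)
    isOpen_interior.isClosed_compl hK.isClosed (disjoint_compl_left_iff_subset.2 hKK')
  have hfc : ContDiff ℝ 1 f := f.contMDiff.contDiff
  have hsupp : ∀ x, x ∉ K' → f x = 0 := fun x hx =>
    (hf0.self_of_nhdsSet) x (fun h => hx (interior_subset h))
  set w : E → E := fun x => f x • v x with hw
  have hwc : ContDiff ℝ 1 w := by
    rw [contDiff_iff_contDiffAt]
    intro x
    -- Outside `U` nothing is known about `v`, but there the cutoff vanishes on a whole
    -- neighbourhood.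
    by_cases hx : x ∈ U
    · exact hfc.contDiffAt.smul (hv.contDiffAt (hU.mem_nhds hx))
    · have hx' : x ∈ (interior K')ᶜ := fun h => hx (hK'U (interior_subset h))
      have h0 : ∀ᶠ y in 𝓝 x, f y = 0 := (eventually_nhdsSet_iff_forall.1 hf0) x hx'
      have : w =ᶠ[𝓝 x] fun _ => 0 := by
        filter_upwards [h0] with y hy
        simp [hw, hy]
      exact contDiffAt_const.congr_of_eventuallyEq this
  have hwcs : HasCompactSupport w := by
    apply HasCompactSupport.intro hK'
    intro x hx
    simp [hw, hsupp x hx]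
  obtain ⟨C, hC⟩ := ContDiff.lipschitzWith_of_hasCompactSupport (𝕂 := ℝ) hwcs hwc one_ne_zero
  obtain ⟨L, hL⟩ := hwc.continuous.bounded_above_of_compact_support hwcs
  have hev : ∀ᶠ x in 𝓝ˢ K, f x = 1 ∧ x ∈ U := hf1.and (hU.mem_nhdsSet.2 hKU)
  obtain ⟨δ, hδ, hδs⟩ := (hasBasis_nhdsSet_thickening hK).mem_iff.1 hev
  refine ⟨w, ⟨⟨max L 0, le_max_right _ _⟩, fun x => (hL x).trans (le_max_left _ _)⟩, ⟨C, hC⟩,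
    δ, hδ, fun x hx => (hδs hx).2, fun x hx => ?_⟩
  simp [hw, (hδs hx).1]

/-- `γ` solves `γ' = v(γ)` on `(-b, b)` inside `U`. -/
def IsSol (v : E → E) (U : Set E) (b : ℝ) (γ : ℝ → E) : Prop :=
  ∀ t ∈ Ioo (-b) b, HasDerivAt γ (v (γ t)) t ∧ γ t ∈ U

theorem IsSol.mono {v : E → E} {U : Set E} {b b' : ℝ} {γ : ℝ → E} (h : IsSol v U b γ)
    (hb : b' ≤ b) : IsSol v U b' γ :=
  fun t ht => h t ⟨by linarith [ht.1], by linarith [ht.2]⟩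

theorem IsSol.isCompact_image {v : E → E} {U : Set E} {b c : ℝ} {γ : ℝ → E} (h : IsSol v U b γ)
    (hc : c < b) : IsCompact (γ '' Icc (-c) c) := by
  apply isCompact_Icc.image_of_continuousOn
  intro t ht
  exact (h t ⟨by linarith [ht.1], by linarith [ht.2]⟩).1.continuousAt.continuousWithinAt

theorem IsSol.image_subset {v : E → E} {U : Set E} {b c : ℝ} {γ : ℝ → E} (h : IsSol v U b γ)
    (hc : c < b) : γ '' Icc (-c) c ⊆ U := by
  rintro _ ⟨t, ht, rfl⟩
  exact (h t ⟨by linarith [ht.1], by linarith [ht.2]⟩).2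

/-- With a bound `L` on the field, a trajectory cannot leave the ball of radius `L * b` in time `b`,
so a single application of Picard–Lindelöf covers the whole interval. -/
theorem exists_isSol_of_lipschitz [FiniteDimensional ℝ E] {w : E → E} {L C : ℝ≥0} (hL : ∀ x, ‖w x‖ ≤ L)
    (hC : LipschitzWith C w) (x : E) {b : ℝ} (hb : 0 < b) :
    ∃ γ, γ 0 = x ∧ IsSol w univ b γ := by
  have : CompleteSpace E := FiniteDimensional.complete ℝ E
  have hp : IsPicardLindelof (fun _ => w) (tmin := -b) (tmax := b) ⟨0, by constructor <;> linarith⟩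
      x (L * ⟨b, hb.le⟩) 0 L C :=
    { lipschitzOnWith := fun t _ => hC.lipschitzOnWith
      continuousOn := fun x _ => continuousOn_const
      norm_le := fun t _ x _ => hL x
      mul_max_le := by simp; rfl }
  obtain ⟨α, hα0, hα⟩ := hp.exists_eq_forall_mem_Icc_hasDerivWithinAt₀
  exact ⟨α, hα0, fun t ht => ⟨(hα t (Ioo_subset_Icc_self ht)).hasDerivAt
    (Icc_mem_nhds ht.1 ht.2), mem_univ _⟩⟩

/-- Solutions of a Lipschitz equation depend on the initial value in a Lipschitz way. -/
theorem dist_le_of_lipschitz {w : E → E} {C : ℝ≥0} (hC : LipschitzWith C w) {b : ℝ}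
    {γ γ' : ℝ → E} (h : IsSol w univ b γ) (h' : IsSol w univ b γ') {t : ℝ} (ht : |t| < b) :
    dist (γ t) (γ' t) ≤ dist (γ 0) (γ' 0) * Real.exp (C * |t|) := by
  have key : ∀ {w : E → E}, LipschitzWith C w → ∀ {γ γ' : ℝ → E}, IsSol w univ b γ →
      IsSol w univ b γ' → ∀ {t}, 0 ≤ t → t < b →
      dist (γ t) (γ' t) ≤ dist (γ 0) (γ' 0) * Real.exp (C * t) := by
    intro w hC γ γ' h h' t ht0 htb
    have hm : ∀ s ∈ Icc 0 t, s ∈ Ioo (-b) b := fun s hs =>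
      ⟨by linarith [hs.1], by linarith [hs.2]⟩
    have := dist_le_of_trajectories_ODE (v := fun _ => w) (fun _ => hC)
      (f := γ) (g := γ') (a := 0) (b := t)
      (fun s hs => (h s (hm s hs)).1.continuousAt.continuousWithinAt)
      (fun s hs => (h s (hm s (Ico_subset_Icc_self hs))).1.hasDerivWithinAt)
      (fun s hs => (h' s (hm s hs)).1.continuousAt.continuousWithinAt)
      (fun s hs => (h' s (hm s (Ico_subset_Icc_self hs))).1.hasDerivWithinAt)
      le_rfl t ⟨ht0, le_rfl⟩
    simpa using this
  rcases le_total 0 t with h0 | h0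
  · rw [abs_of_nonneg h0] at ht ⊢
    exact key hC h h' h0 ht
  · rw [abs_of_nonpos h0] at ht ⊢
    -- Reversing time replaces `w` by `-w`, which has the same Lipschitz constant.
    have hrev : ∀ {γ : ℝ → E}, IsSol w univ b γ →
        IsSol (fun x => -w x) univ b (fun s => γ (-s)) := by
      intro γ h s hs
      have h1 := (h (-s) ⟨by linarith [hs.2], by linarith [hs.1]⟩).1
      refine ⟨?_, mem_univ _⟩
      have h2 := h1.scomp s (hasDerivAt_neg s)
      simp only [neg_smul, one_smul] at h2
      exact h2
    have := key (w := fun x => -w x) hC.neg (hrev h) (hrev h') (t := -t) (by linarith) ht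
    simpa using this

theorem IsSol.congr_field {v w : E → E} {U V : Set E} {b : ℝ} {γ : ℝ → E} (h : IsSol v U b γ)
    (hw : ∀ t ∈ Ioo (-b) b, w (γ t) = v (γ t) ∧ γ t ∈ V) : IsSol w V b γ :=
  fun t ht => ⟨by rw [(hw t ht).1]; exact (h t ht).1, (hw t ht).2⟩

/-- On a slightly shorter interval both trajectories have compact image, so one cutoff field serves
both and the Lipschitz estimate applies with initial distance zero. -/
theorem IsSol.eq [FiniteDimensional ℝ E] {v : E → E} {U : Set E} (hU : IsOpen U)
    (hv : ContDiffOn ℝ 1 v U) {b : ℝ} {γ γ' : ℝ → E} (h : IsSol v U b γ) (h' : IsSol v U b γ') (h0 : γ 0 = γ' 0) {t : ℝ}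
    (ht : |t| < b) : γ t = γ' t := by
  obtain ⟨c, htc, hcb⟩ := exists_between ht
  obtain ⟨w, -, ⟨C, hC⟩, δ, hδ, -, hw⟩ := exists_cutoff hU hv
    ((h.isCompact_image hcb).union (h'.isCompact_image hcb))
    (union_subset (h.image_subset hcb) (h'.image_subset hcb))
  have h1 : IsSol w univ c γ := (h.mono hcb.le).congr_field fun s hs =>
    ⟨hw _ (self_subset_thickening hδ _ (Or.inl ⟨s, Ioo_subset_Icc_self hs, rfl⟩)), mem_univ _⟩
  have h2 : IsSol w univ c γ' := (h'.mono hcb.le).congr_field fun s hs =>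
    ⟨hw _ (self_subset_thickening hδ _ (Or.inr ⟨s, Ioo_subset_Icc_self hs, rfl⟩)), mem_univ _⟩
  have := dist_le_of_lipschitz hC h1 h2 htc
  rw [h0, dist_self, zero_mul] at this
  exact dist_le_zero.1 this

/-- Existence of solutions with nearby initial values, with Lipschitz dependence. -/
theorem IsSol.exists_near [FiniteDimensional ℝ E] {v : E → E} {U : Set E} (hU : IsOpen U) (hv : ContDiffOn ℝ 1 v U)
    {b c : ℝ} {γ : ℝ → E} (h : IsSol v U b γ) (hc : 0 < c) (hcb : c < b) :
    ∃ C > 0, ∃ ε > 0, ∀ x, dist x (γ 0) < ε → ∃ γ', γ' 0 = x ∧ IsSol v U c γ' ∧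
      ∀ t, |t| < c → dist (γ' t) (γ t) ≤ C * dist x (γ 0) := by
  obtain ⟨w, ⟨L, hL⟩, ⟨C, hC⟩, δ, hδ, hδU, hw⟩ := exists_cutoff hU hv
    (h.isCompact_image hcb) (h.image_subset hcb)
  have h1 : IsSol w univ c γ := (h.mono hcb.le).congr_field fun s hs =>
    ⟨hw _ (self_subset_thickening hδ _ ⟨s, Ioo_subset_Icc_self hs, rfl⟩), mem_univ _⟩
  -- The radius `δ / exp (C * c)` keeps the deviation below `δ`, hence inside the region where the
  -- cutoff field agrees with `v`.
  refine ⟨Real.exp (C * c), Real.exp_pos _, δ / Real.exp (C * c), by positivity, fun x hx => ?_⟩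
  obtain ⟨γ', hγ0, hγ'⟩ := exists_isSol_of_lipschitz hL hC x hc
  have hd : ∀ t, |t| < c → dist (γ' t) (γ t) ≤ Real.exp (C * c) * dist x (γ 0) := by
    intro t ht
    have h2 := dist_le_of_lipschitz hC hγ' h1 ht
    rw [hγ0, mul_comm] at h2
    refine h2.trans ?_
    gcongr
  refine ⟨γ', hγ0, ?_, hd⟩
  apply hγ'.congr_field
  intro t ht
  have htc : |t| < c := abs_lt.2 ht
  have hmem : γ' t ∈ thickening δ (γ '' Icc (-c) c) := by
    rw [mem_thickening_iff]
    refine ⟨γ t, ⟨t, Ioo_subset_Icc_self ht, rfl⟩, (hd t htc).trans_lt ?_⟩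
    rw [lt_div_iff₀ (Real.exp_pos _)] at hx
    linarith
  exact ⟨(hw _ hmem).symm, hδU hmem⟩

/-- A solution that stays in a compact subset of the domain extends beyond its interval. -/
theorem IsSol.extend [FiniteDimensional ℝ E] {v : E → E} {U K : Set E} (hU : IsOpen U) (hv : ContDiffOn ℝ 1 v U)
    {b : ℝ} {γ : ℝ → E} (hb : 0 < b) (h : IsSol v U b γ) (hK : IsCompact K) (hKU : K ⊆ U)
    (hγK : ∀ t ∈ Ioo (-b) b, γ t ∈ K) :
    ∃ b' > b, ∃ γ', γ' 0 = γ 0 ∧ IsSol v U b' γ' := by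
  obtain ⟨w, ⟨L, hL⟩, ⟨C, hC⟩, δ, hδ, hδU, hw⟩ := exists_cutoff hU hv hK hKU
  obtain ⟨γ', hγ0, hγ'⟩ := exists_isSol_of_lipschitz hL hC (γ 0) (b := b + 1) (by linarith)
  have h1 : IsSol w univ b γ := h.congr_field fun s hs =>
    ⟨hw _ (self_subset_thickening hδ _ (hγK s hs)), mem_univ _⟩
  have heq : ∀ t ∈ Ioo (-b) b, γ' t = γ t := by
    intro t ht
    have := dist_le_of_lipschitz hC (hγ'.mono (by linarith)) h1 (abs_lt.2 ht)
    rw [hγ0, dist_self, zero_mul] at this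
    exact dist_le_zero.1 this
  have hcont : ContinuousOn γ' (Icc (-b) b) := fun t ht =>
    (hγ' t ⟨by linarith [ht.1], by linarith [ht.2]⟩).1.continuousAt.continuousWithinAt
  -- By continuity the endpoints `±b` are still mapped into `K`, which leaves room to go on inside
  -- the thickening.
  have hmem : ∀ t ∈ Icc (-b) b, γ' t ∈ K := by
    have hcl : closure (Ioo (-b) b) = Icc (-b) b := closure_Ioo (by linarith)
    intro t ht
    rw [← hcl] at ht hcont
    exact hK.isClosed.closure_subset_iff.2 (by
      rintro _ ⟨s, hs, rfl⟩
      rw [heq s hs]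
      exact hγK s hs) (hcont.image_closure ⟨t, ht, rfl⟩)
  have hnear : ∀ t, |t| ≤ b → ∀ᶠ s in 𝓝 t, γ' s ∈ thickening δ K := fun t ht =>
    (hγ' t ⟨by linarith [neg_le_of_abs_le ht], by linarith [le_of_abs_le ht]⟩).1.continuousAt
      (isOpen_thickening.mem_nhds (self_subset_thickening hδ _ (hmem t (abs_le.1 ht))))
  obtain ⟨ε₁, hε₁, he₁⟩ := Metric.eventually_nhds_iff.1 (hnear b (abs_of_pos hb).le)
  obtain ⟨ε₂, hε₂, he₂⟩ := Metric.eventually_nhds_iff.1 (hnear (-b) (by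
    rw [abs_neg]; exact (abs_of_pos hb).le))
  refine ⟨b + min 1 (min ε₁ ε₂), lt_add_of_pos_right _ (by positivity), γ', hγ0, ?_⟩
  have hm1 := min_le_left 1 (min ε₁ ε₂)
  have hm2 := (min_le_right 1 (min ε₁ ε₂)).trans (min_le_left ε₁ ε₂)
  have hm3 := (min_le_right 1 (min ε₁ ε₂)).trans (min_le_right ε₁ ε₂)
  apply (hγ'.mono (by linarith)).congr_field
  intro t ht
  have hmem' : γ' t ∈ thickening δ K := by
    rcases le_or_gt |t| b with h3 | h3
    · exact self_subset_thickening hδ _ (hmem t (abs_le.1 h3))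
    · rcases lt_abs.1 h3 with h4 | h4
      · exact he₁ (by rw [Real.dist_eq, abs_lt]; constructor <;> linarith [ht.2])
      · exact he₂ (by rw [Real.dist_eq, abs_lt]; constructor <;> linarith [ht.1])
  exact ⟨(hw _ hmem').symm, hδU hmem'⟩

/-- A `C¹` map is uniformly strictly differentiable along a compact subset of its domain. -/
theorem exists_uniform_taylor {v : E → E} {U K : Set E} (hU : IsOpen U)
    (hv : ContDiffOn ℝ 1 v U) (hK : IsCompact K) (hKU : K ⊆ U) {ε : ℝ} (hε : 0 < ε) :
    ∃ δ > 0, ∀ x ∈ K, ∀ y, dist y x < δ → ‖v y - v x - fderiv ℝ v x (y - x)‖ ≤ ε * ‖y - x‖ := by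
  -- Strict differentiability at `x` compares increments with the derivative at `x`; continuity of
  -- the derivative moves it to the nearby point `z`. Each costs `ε / 2`.
  have hloc : ∀ x ∈ K, ∃ δ > 0, ∀ z, dist z x < δ → ∀ y, dist y x < δ →
      ‖v y - v z - fderiv ℝ v z (y - z)‖ ≤ ε * ‖y - z‖ := by
    intro x hx
    have hx' : ContDiffAt ℝ 1 v x := hv.contDiffAt (hU.mem_nhds (hKU hx))
    have hs := (hx'.hasStrictFDerivAt one_ne_zero).isLittleO
    have h1 := hs.def (half_pos hε)
    have h2 : ∀ᶠ z in 𝓝 x, ‖fderiv ℝ v z - fderiv ℝ v x‖ < ε / 2 := by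
      have := (hx'.fderiv_right (m := 0) (by norm_num)).continuousAt
      simpa [dist_eq_norm] using Metric.tendsto_nhds.1 this (ε / 2) (half_pos hε)
    rw [nhds_prod_eq, Metric.nhds_basis_ball.prod_self.eventually_iff] at h1
    obtain ⟨δ₁, hδ₁, h1⟩ := h1
    obtain ⟨δ₂, hδ₂, h2⟩ := Metric.eventually_nhds_iff.1 h2
    refine ⟨min δ₁ δ₂, lt_min hδ₁ hδ₂, fun z hz y hy => ?_⟩
    have h3 := h1 (x := (y, z)) ⟨hy.trans_le (min_le_left _ _), hz.trans_le (min_le_left _ _)⟩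
    have h4 := h2 (hz.trans_le (min_le_right _ _))
    have h5 : ‖(fderiv ℝ v z - fderiv ℝ v x) (y - z)‖ ≤ ε / 2 * ‖y - z‖ :=
      (ContinuousLinearMap.le_opNorm _ _).trans (by gcongr)
    calc ‖v y - v z - fderiv ℝ v z (y - z)‖
        = ‖(v y - v z - fderiv ℝ v x (y - z)) - (fderiv ℝ v z - fderiv ℝ v x) (y - z)‖ := by
          congr 1
          simp only [sub_apply]
          abel
      _ ≤ ε / 2 * ‖y - z‖ + ε / 2 * ‖y - z‖ := (norm_sub_le _ _).trans (add_le_add h3 h5)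
      _ = ε * ‖y - z‖ := by ring
  refine hK.induction_on (p := fun S => ∃ δ > 0, ∀ x ∈ S, ∀ y, dist y x < δ →
    ‖v y - v x - fderiv ℝ v x (y - x)‖ ≤ ε * ‖y - x‖) ⟨1, one_pos, by simp⟩ ?_ ?_ ?_
  · rintro s t hst ⟨δ, hδ, h⟩
    exact ⟨δ, hδ, fun x hx => h x (hst hx)⟩
  · rintro s t ⟨δ, hδ, h⟩ ⟨δ', hδ', h'⟩
    refine ⟨min δ δ', lt_min hδ hδ', fun x hx y hy => ?_⟩
    rcases hx with hx | hx
    · exact h x hx y (hy.trans_le (min_le_left _ _))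
    · exact h' x hx y (hy.trans_le (min_le_right _ _))
  · intro x hx
    obtain ⟨δ, hδ, h⟩ := hloc x hx
    refine ⟨ball x (δ / 2), mem_nhdsWithin_of_mem_nhds (ball_mem_nhds x (half_pos hδ)), δ / 2,
      half_pos hδ, fun z hz y hy => ?_⟩
    rw [mem_ball] at hz
    exact h z (by linarith) y (by linarith [dist_triangle y z x])

end ODEOn

/-! ### The radius as a function of `X² - T²` -/

namespace Kruskal

open Set Filter Topology

/-- The function `r ↦ (r - 2M) e^{r/2M}`. -/
def profile (M r : ℝ) : ℝ := (r - 2 * M) * Real.exp (r / (2 * M))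

/-- The radius as a function of `w = X² - T²`. -/
def rho (M w : ℝ) : ℝ :=
  Classical.epsilon fun r => 0 < r ∧ (r - 2 * M) * Real.exp (r / (2 * M)) = w

theorem radius_eq_rho (M T X : ℝ) : radius M T X = rho M (X ^ 2 - T ^ 2) := rfl

section

variable {M : ℝ}

theorem hasDerivAt_profile (hM : 0 < M) (r : ℝ) :
    HasDerivAt (profile M) (r / (2 * M) * Real.exp (r / (2 * M))) r := by
  have h1 : HasDerivAt (fun r : ℝ => r - 2 * M) 1 r := (hasDerivAt_id r).sub_const _
  have h2 : HasDerivAt (fun r : ℝ => r / (2 * M)) (1 / (2 * M)) r :=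
    (hasDerivAt_id r).div_const _
  refine (h1.mul h2.exp).congr_deriv ?_
  have hM' := hM.ne'
  field_simp
  ring

theorem contDiff_profile (M : ℝ) : ContDiff ℝ ∞ (profile M) := by
  unfold profile
  exact (contDiff_id.sub contDiff_const).mul (contDiff_id.div_const _).exp

theorem strictMonoOn_profile (hM : 0 < M) : StrictMonoOn (profile M) (Ici 0) := by
  apply strictMonoOn_of_deriv_pos (convex_Ici 0) (contDiff_profile M).continuous.continuousOn
  intro r hr
  rw [interior_Ici] at hr
  have hr' : 0 < r := hr
  rw [(hasDerivAt_profile hM r).deriv]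
  positivity

theorem profile_zero (M : ℝ) : profile M 0 = -(2 * M) := by simp [profile]

theorem neg_lt_profile (hM : 0 < M) {r : ℝ} (hr : 0 < r) : -(2 * M) < profile M r := by
  rw [← profile_zero]
  exact strictMonoOn_profile hM self_mem_Ici hr.le hr

theorem rho_spec (hM : 0 < M) {w : ℝ} (hw : -(2 * M) < w) :
    0 < rho M w ∧ profile M (rho M w) = w := by
  rcases le_total 0 w with h | h
  · have h1 : Real.sqrt w ^ 2 - 0 ^ 2 = w := by rw [Real.sq_sqrt h]; ring
    have h2 := radius_spec (T := 0) (X := Real.sqrt w) hM (by rw [h1]; exact hw)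
    rw [radius_eq_rho, h1] at h2
    exact h2
  · have h1 : 0 ^ 2 - Real.sqrt (-w) ^ 2 = w := by rw [Real.sq_sqrt (by linarith)]; ring
    have h2 := radius_spec (T := Real.sqrt (-w)) (X := 0) hM (by rw [h1]; exact hw)
    rw [radius_eq_rho, h1] at h2
    exact h2

theorem rho_pos (hM : 0 < M) {w : ℝ} (hw : -(2 * M) < w) : 0 < rho M w := (rho_spec hM hw).1

theorem profile_rho (hM : 0 < M) {w : ℝ} (hw : -(2 * M) < w) : profile M (rho M w) = w :=
  (rho_spec hM hw).2

theorem rho_profile (hM : 0 < M) {r : ℝ} (hr : 0 < r) : rho M (profile M r) = r :=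
  (strictMonoOn_profile hM).injOn (rho_pos hM (neg_lt_profile hM hr)).le hr.le
    (profile_rho hM (neg_lt_profile hM hr))

theorem rho_lt_rho (hM : 0 < M) {w w' : ℝ} (hw : -(2 * M) < w) (h : w < w') :
    rho M w < rho M w' := by
  rw [← (strictMonoOn_profile hM).lt_iff_lt (rho_pos hM hw).le (rho_pos hM (hw.trans h)).le,
    profile_rho hM hw, profile_rho hM (hw.trans h)]
  exact h

theorem rho_le_rho (hM : 0 < M) {w w' : ℝ} (hw : -(2 * M) < w) (h : w ≤ w') :
    rho M w ≤ rho M w' := by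
  rcases h.eq_or_lt with h | h
  · rw [h]
  · exact (rho_lt_rho hM hw h).le

theorem rho_zero (hM : 0 < M) : rho M 0 = 2 * M := by
  have := rho_profile hM (r := 2 * M) (by linarith)
  simpa [profile] using this

/-- For r > 0 the derivative of `profile` is nonzero, so the inverse function theorem applies. The
local inverse is positive near `w`, and a positive root is unique, so it is `rho`. -/
theorem contDiffAt_rho (hM : 0 < M) {w : ℝ} (hw : -(2 * M) < w) : ContDiffAt ℝ ∞ (rho M) w := by
  obtain ⟨hr, hrw⟩ := rho_spec hM hw
  set r := rho M w with hrdef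
  have hd : r / (2 * M) * Real.exp (r / (2 * M)) ≠ 0 := by positivity
  have hF : HasFDerivAt (profile M)
      ((ContinuousLinearEquiv.unitsEquivAut ℝ (Units.mk0 _ hd) : ℝ ≃L[ℝ] ℝ) : ℝ →L[ℝ] ℝ) r := by
    convert! (hasDerivAt_profile hM r).hasFDerivAt using 1
  have hc : ContDiffAt ℝ ∞ (profile M) r := (contDiff_profile M).contDiffAt
  have hn : (∞ : WithTop ℕ∞) ≠ 0 := by simp
  have hg := hc.to_localInverse hF hn
  have hright := (hc.hasStrictFDerivAt' hF hn).eventually_right_inverse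
  have hg0 : hc.localInverse hF hn (profile M r) = r := hc.localInverse_apply_image hF hn
  rw [hrw] at hg hright hg0
  refine hg.congr_of_eventuallyEq ?_
  have hpos : ∀ᶠ y in 𝓝 w, 0 < hc.localInverse hF hn y :=
    hg.continuousAt.eventually (lt_mem_nhds (by rw [hg0]; exact hr))
  filter_upwards [hright, hpos] with y h1 h2
  have h3 : profile M (hc.localInverse hF hn y) = y := h1
  conv_lhs => rw [← h3]
  exact rho_profile hM h2

theorem hasDerivAt_rho (hM : 0 < M) {w : ℝ} (hw : -(2 * M) < w) :
    HasDerivAt (rho M) (2 * M * Real.exp (-rho M w / (2 * M)) / rho M w) w := by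
  have hd : HasDerivAt (rho M) (deriv (rho M) w) w :=
    ((contDiffAt_rho hM hw).differentiableAt (by simp)).hasDerivAt
  have h1 := (hasDerivAt_profile hM (rho M w)).comp w hd
  have h2 : HasDerivAt (profile M ∘ rho M) 1 w := by
    refine (hasDerivAt_id w).congr_of_eventuallyEq ?_
    filter_upwards [lt_mem_nhds hw] with y hy
    exact profile_rho hM hy
  have h3 := h1.unique h2
  refine hd.congr_deriv ?_
  have hr := rho_pos hM hw
  have he : Real.exp (rho M w / (2 * M)) * Real.exp (-rho M w / (2 * M)) = 1 := by
    rw [← Real.exp_add]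
    simp [neg_div]
  have hM' := hM.ne'
  field_simp
  field_simp at h3
  rw [neg_div] at he
  linear_combination Real.exp (-(rho M w / (2 * M))) * h3
    - (deriv (rho M) w * rho M w) * he

/-- `e^{-r/2M}` as a function of `w = X² - T²`. -/
def redshift (M w : ℝ) : ℝ := Real.exp (-rho M w / (2 * M))

/-- The factor `16 M² e^{-r/2M} / r` of the Kruskal metric as a function of `w = X² - T²`. -/
def conf (M w : ℝ) : ℝ := 16 * M ^ 2 * Real.exp (-rho M w / (2 * M)) / rho M w

/-- The square root of `conf`. -/
def scale (M w : ℝ) : ℝ := Real.sqrt (conf M w)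

/-- The coefficient `e^{-r/2M} (6M - r) / r²` as a function of `w = X² - T²`. -/
def tidal (M w : ℝ) : ℝ := redshift M w * (6 * M - rho M w) / rho M w ^ 2

theorem conf_pos (hM : 0 < M) {w : ℝ} (hw : -(2 * M) < w) : 0 < conf M w := by
  have := rho_pos hM hw
  unfold conf
  positivity

theorem scale_pos (hM : 0 < M) {w : ℝ} (hw : -(2 * M) < w) : 0 < scale M w :=
  Real.sqrt_pos.2 (conf_pos hM hw)

theorem scale_sq (hM : 0 < M) {w : ℝ} (hw : -(2 * M) < w) : scale M w ^ 2 = conf M w :=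
  Real.sq_sqrt (conf_pos hM hw).le

/-- Together with `mul_redshift` this carries the algebra along a curve: `scale`, `rho` and
`redshift` are later treated as independent variables subject to these two relations. -/
theorem scale_sq_mul (hM : 0 < M) {w : ℝ} (hw : -(2 * M) < w) :
    scale M w ^ 2 * rho M w = 16 * M ^ 2 * redshift M w := by
  rw [scale_sq hM hw, conf, redshift]
  have := (rho_pos hM hw).ne'
  field_simp

theorem mul_redshift (hM : 0 < M) {w : ℝ} (hw : -(2 * M) < w) :
    w * redshift M w = rho M w - 2 * M := by
  have h := profile_rho hM hw
  have he : Real.exp (rho M w / (2 * M)) * Real.exp (-rho M w / (2 * M)) = 1 := by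
    rw [← Real.exp_add]
    simp [neg_div]
  unfold profile at h
  unfold redshift
  linear_combination (-Real.exp (-rho M w / (2 * M))) * h + (rho M w - 2 * M) * he

theorem hasDerivAt_rho' (hM : 0 < M) {w : ℝ} (hw : -(2 * M) < w) :
    HasDerivAt (rho M) (2 * M * redshift M w / rho M w) w := hasDerivAt_rho hM hw

theorem hasDerivAt_redshift (hM : 0 < M) {w : ℝ} (hw : -(2 * M) < w) :
    HasDerivAt (redshift M) (-redshift M w ^ 2 / rho M w) w := by
  have h := ((hasDerivAt_rho' hM hw).neg.div_const (2 * M)).exp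
  refine h.congr_deriv ?_
  have h1 : Real.exp ((-rho M) w / (2 * M)) = redshift M w := rfl
  rw [h1]
  field_simp

theorem hasDerivAt_conf (hM : 0 < M) {w : ℝ} (hw : -(2 * M) < w) :
    HasDerivAt (conf M)
      (-(rho M w + 2 * M) * redshift M w / rho M w ^ 2 * conf M w) w := by
  have hr := (rho_pos hM hw).ne'
  have h := ((hasDerivAt_redshift hM hw).const_mul (16 * M ^ 2)).div (hasDerivAt_rho' hM hw) hr
  refine h.congr_deriv ?_
  have h1 : conf M w = 16 * M ^ 2 * redshift M w / rho M w := rfl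
  rw [h1]
  field_simp
  ring

theorem hasDerivAt_scale (hM : 0 < M) {w : ℝ} (hw : -(2 * M) < w) :
    HasDerivAt (scale M)
      (-(rho M w + 2 * M) * redshift M w / (2 * rho M w ^ 2) * scale M w) w := by
  have hr := (rho_pos hM hw).ne'
  have hc := conf_pos hM hw
  have h := (hasDerivAt_conf hM hw).sqrt hc.ne'
  refine h.congr_deriv ?_
  have h1 := scale_sq hM hw
  have h2 := (scale_pos hM hw).ne'
  change _ / (2 * scale M w) = _
  rw [← h1]
  field_simp

theorem hasDerivAt_tidal (hM : 0 < M) {w : ℝ} (hw : -(2 * M) < w) :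
    HasDerivAt (tidal M)
      (redshift M w ^ 2 * (-(6 * M - rho M w) * (rho M w + 4 * M) - 2 * M * rho M w)
        / rho M w ^ 4) w := by
  have hr := (rho_pos hM hw).ne'
  have h := ((hasDerivAt_redshift hM hw).mul ((hasDerivAt_rho' hM hw).const_sub (6 * M))).div
    ((hasDerivAt_rho' hM hw).pow 2) (pow_ne_zero 2 hr)
  refine h.congr_deriv ?_
  simp only [Pi.mul_apply, Pi.pow_apply]
  field_simp
  ring

theorem contDiffAt_redshift (hM : 0 < M) {w : ℝ} (hw : -(2 * M) < w) :
    ContDiffAt ℝ ∞ (redshift M) w :=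
  ((contDiffAt_rho hM hw).neg.div_const _).exp

theorem contDiffAt_conf (hM : 0 < M) {w : ℝ} (hw : -(2 * M) < w) :
    ContDiffAt ℝ ∞ (conf M) w :=
  (contDiffAt_const.mul (contDiffAt_redshift hM hw)).div (contDiffAt_rho hM hw)
    (rho_pos hM hw).ne'

theorem contDiffAt_scale (hM : 0 < M) {w : ℝ} (hw : -(2 * M) < w) :
    ContDiffAt ℝ ∞ (scale M) w :=
  (contDiffAt_conf hM hw).sqrt (conf_pos hM hw).ne'

theorem contDiffAt_tidal (hM : 0 < M) {w : ℝ} (hw : -(2 * M) < w) :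
    ContDiffAt ℝ ∞ (tidal M) w :=
  ((contDiffAt_redshift hM hw).mul (contDiffAt_const.sub (contDiffAt_rho hM hw))).div
    ((contDiffAt_rho hM hw).pow 2) (pow_ne_zero 2 (rho_pos hM hw).ne')

end

end Kruskal

/-! ### Identities along a profile curve of constant mean curvature -/

namespace Kruskal

open Set Filter Topology Real

/-- The derivative of the rapidity of the curve `T = F(X)` generating a spherically symmetric
hypersurface of mean curvature `H`. -/
def accel (M H X T η : ℝ) : ℝ :=
  3 * H * scale M (X ^ 2 - T ^ 2) / cosh η + (T - X * (sinh η / cosh η)) * tidal M (X ^ 2 - T ^ 2)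

/-- At `X`, the curve `T = F(X)` lies in the Kruskal extension, has rapidity `η` and satisfies the
equation of constant mean curvature `H`. -/
structure LeafAt (M H : ℝ) (F η : ℝ → ℝ) (X : ℝ) : Prop where
  mem : -(2 * M) < X ^ 2 - F X ^ 2
  deriv_height : HasDerivAt F (sinh (η X) / cosh (η X)) X
  deriv_rapidity : HasDerivAt η (accel M H X (F X) (η X)) X

/-- The component of `(X, T)` along the unit tangent of rapidity `η`. -/
def tang (F η : ℝ → ℝ) (X : ℝ) : ℝ := X * cosh (η X) - F X * sinh (η X)

/-- The component of `(X, T)` along the unit normal of rapidity `η`. -/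
def nrml (F η : ℝ → ℝ) (X : ℝ) : ℝ := X * sinh (η X) - F X * cosh (η X)

/-- The value of `X² - T²` along the curve. -/
def sep (F : ℝ → ℝ) (X : ℝ) : ℝ := X ^ 2 - F X ^ 2

theorem tang_sq_sub (F η : ℝ → ℝ) (X : ℝ) : tang F η X ^ 2 - nrml F η X ^ 2 = sep F X := by
  unfold tang nrml sep
  linear_combination (X ^ 2 - F X ^ 2) * Real.cosh_sq_sub_sinh_sq (η X)

/-- In the frame adapted to the curve, T - X tanh η is `-nrml / cosh`, so apart from functions of X²
- T² the position enters only through its normal component. -/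
theorem accel_eq (M H : ℝ) (F η : ℝ → ℝ) (X : ℝ) :
    accel M H X (F X) (η X) =
      (3 * H * scale M (sep F X) - nrml F η X * tidal M (sep F X)) / cosh (η X) := by
  have := (cosh_pos (η X)).ne'
  unfold accel nrml sep
  field_simp
  ring

/-! ### The radius along a profile curve and the Jacobi equation of its normal variations -/

section

variable {M H : ℝ} {F η : ℝ → ℝ} {X : ℝ}

/-- `r² ṙ` along the curve, `ṙ` being the derivative with respect to arc length. -/
def radialFlux (M : ℝ) (F η : ℝ → ℝ) (X : ℝ) : ℝ :=
  rho M (sep F X) ^ 2 * scale M (sep F X) * tang F η X / (4 * M)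

/-- The derivative of `radialFlux` with respect to arc length. -/
def radialForce (M H : ℝ) (F η : ℝ → ℝ) (X : ℝ) : ℝ :=
  3 * H * rho M (sep F X) ^ 2 * scale M (sep F X) * nrml F η X / (4 * M) - 3 * M
    + 2 * rho M (sep F X)

theorem LeafAt.hasDerivAt_sep (h : LeafAt M H F η X) :
    HasDerivAt (sep F) (2 * tang F η X / cosh (η X)) X := by
  have h1 := ((hasDerivAt_id X).pow 2).sub (h.deriv_height.pow 2)
  refine h1.congr_deriv ?_
  have := (cosh_pos (η X)).ne'
  unfold tang
  simp
  field_simp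

theorem LeafAt.hasDerivAt_tang (h : LeafAt M H F η X) :
    HasDerivAt (tang F η)
      (1 / cosh (η X) + nrml F η X * accel M H X (F X) (η X)) X := by
  have h1 := ((hasDerivAt_id X).mul h.deriv_rapidity.cosh).sub
    (h.deriv_height.mul h.deriv_rapidity.sinh)
  refine h1.congr_deriv ?_
  have := (cosh_pos (η X)).ne'
  unfold nrml
  simp
  field_simp
  linear_combination Real.cosh_sq_sub_sinh_sq (η X)

theorem LeafAt.hasDerivAt_nrml (h : LeafAt M H F η X) :
    HasDerivAt (nrml F η) (tang F η X * accel M H X (F X) (η X)) X := by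
  have h1 := ((hasDerivAt_id X).mul h.deriv_rapidity.sinh).sub
    (h.deriv_height.mul h.deriv_rapidity.cosh)
  refine h1.congr_deriv ?_
  have := (cosh_pos (η X)).ne'
  unfold tang
  simp
  field_simp
  ring

theorem LeafAt.hasDerivAt_rho (h : LeafAt M H F η X) (hM : 0 < M) :
    HasDerivAt (fun X => rho M (sep F X)) (2 * M * redshift M (sep F X) / rho M (sep F X) *
      (2 * tang F η X / cosh (η X))) X :=
  (hasDerivAt_rho' hM (w := sep F X) h.mem).comp X h.hasDerivAt_sep

theorem LeafAt.hasDerivAt_scale (h : LeafAt M H F η X) (hM : 0 < M) :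
    HasDerivAt (fun X => scale M (sep F X))
      (-(rho M (sep F X) + 2 * M) * redshift M (sep F X) / (2 * rho M (sep F X) ^ 2) *
        scale M (sep F X) * (2 * tang F η X / cosh (η X))) X :=
  (Kruskal.hasDerivAt_scale hM (w := sep F X) h.mem).comp X h.hasDerivAt_sep

theorem LeafAt.hasDerivAt_tidal (h : LeafAt M H F η X) (hM : 0 < M) :
    HasDerivAt (fun X => tidal M (sep F X))
      (redshift M (sep F X) ^ 2 * (-(6 * M - rho M (sep F X)) * (rho M (sep F X) + 4 * M)
        - 2 * M * rho M (sep F X)) / rho M (sep F X) ^ 4 * (2 * tang F η X / cosh (η X))) X :=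
  (Kruskal.hasDerivAt_tidal hM (w := sep F X) h.mem).comp X h.hasDerivAt_sep

/-- Since ds/dX = `scale / cosh`, this is (r² ṙ)˙ = 3H r² n(r) + 2r - 3M, where n(r) = `scale * nrml
/ (4 * M)` is the derivative of r along the unit normal. The square of `tang` is eliminated by
`tang_sq_sub` and `mul_redshift`. -/
theorem LeafAt.hasDerivAt_radialFlux (h : LeafAt M H F η X) (hM : 0 < M) :
    HasDerivAt (radialFlux M F η)
      (scale M (sep F X) / cosh (η X) * radialForce M H F η X) X := by
  have h1 := (((h.hasDerivAt_rho hM).pow 2).mul (h.hasDerivAt_scale hM)).mul h.hasDerivAt_tang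
  have h2 := h1.div_const (4 * M)
  refine h2.congr_deriv ?_
  have hc := (cosh_pos (η X)).ne'
  have hr := (rho_pos hM (w := sep F X) h.mem).ne'
  have h3 := mul_redshift hM (w := sep F X) h.mem
  have h4 := tang_sq_sub F η X
  rw [accel_eq]
  unfold radialForce
  simp only [Pi.mul_apply, Pi.pow_apply, tidal]
  generalize scale M (sep F X) = s at *
  generalize rho M (sep F X) = r at *
  generalize redshift M (sep F X) = E at *
  generalize tang F η X = Q at *
  generalize nrml F η X = P at *
  generalize cosh (η X) = c at *
  rw [← h4] at h3
  have hM' := hM.ne'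
  field_simp
  norm_num
  linear_combination (s * r * (6 * M - r)) * h3

/-- Closes the radial system: flux and force drive each other linearly with nonnegative
coefficients, so the sign of ṙ can be read off from the axis. -/
theorem LeafAt.hasDerivAt_radialForce (h : LeafAt M H F η X) (hM : 0 < M) :
    HasDerivAt (radialForce M H F η)
      (scale M (sep F X) / cosh (η X) * (9 * H ^ 2 + 2 / rho M (sep F X) ^ 2)
        * radialFlux M F η X) X := by
  have h1 := ((((h.hasDerivAt_rho hM).pow 2).const_mul (3 * H)).mul
    (h.hasDerivAt_scale hM)).mul h.hasDerivAt_nrml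
  have h2 := ((h1.div_const (4 * M)).sub_const (3 * M)).add
    ((h.hasDerivAt_rho hM).const_mul 2)
  refine h2.congr_deriv ?_
  have hc := (cosh_pos (η X)).ne'
  have hr := (rho_pos hM (w := sep F X) h.mem).ne'
  have h3 := scale_sq_mul hM (w := sep F X) h.mem
  rw [accel_eq]
  unfold radialFlux
  simp only [Pi.mul_apply, Pi.pow_apply, tidal]
  generalize scale M (sep F X) = s at *
  generalize rho M (sep F X) = r at *
  generalize redshift M (sep F X) = E at *
  generalize tang F η X = Q at *
  generalize nrml F η X = P at *
  generalize cosh (η X) = c at *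
  have hM' := hM.ne'
  field_simp
  norm_num
  linear_combination (-2 * Q) * h3

/-- The coefficient `θ` of the derivative of a normal variation. -/
def tilt (M H : ℝ) (F η : ℝ → ℝ) (X : ℝ) : ℝ :=
  -(rho M (sep F X) + 2 * M) * redshift M (sep F X) / rho M (sep F X) ^ 2
      * cosh (η X) * tang F η X
    + 3 * H * scale M (sep F X) * sinh (η X) - tidal M (sep F X) * sinh (η X) * nrml F η X

/-- The squared norm of the second fundamental form. -/
def secondFormSq (M H : ℝ) (F η : ℝ → ℝ) (X : ℝ) : ℝ :=
  (3 * H - 2 * (scale M (sep F X) * nrml F η X / (4 * M)) / rho M (sep F X)) ^ 2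
    + 2 * (scale M (sep F X) * nrml F η X / (4 * M) / rho M (sep F X)) ^ 2

/-- The derivative of `accel` with respect to `T`. -/
def accelT (M H : ℝ) (F η : ℝ → ℝ) (X : ℝ) : ℝ :=
  3 * H * (-(rho M (sep F X) + 2 * M) * redshift M (sep F X) / (2 * rho M (sep F X) ^ 2)
      * scale M (sep F X) * (-2 * F X)) / cosh (η X) + tidal M (sep F X)
    - nrml F η X / cosh (η X) * (redshift M (sep F X) ^ 2 * (-(6 * M - rho M (sep F X)) *
      (rho M (sep F X) + 4 * M) - 2 * M * rho M (sep F X)) / rho M (sep F X) ^ 4 * (-2 * F X))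

/-- The derivative of `accel` with respect to the rapidity. -/
def accelη (M H : ℝ) (F η : ℝ → ℝ) (X : ℝ) : ℝ :=
  -3 * H * scale M (sep F X) * sinh (η X) / cosh (η X) ^ 2
    - X * tidal M (sep F X) / cosh (η X) ^ 2

/-- The normal component of a variation `u` of the height. -/
def normalVar (M : ℝ) (F η u : ℝ → ℝ) (X : ℝ) : ℝ := scale M (sep F X) * cosh (η X) * u X

/-- `r²` times the derivative of the normal component of a variation with respect to arc
length. -/
def normalFlux (M H : ℝ) (F η u v : ℝ → ℝ) (X : ℝ) : ℝ :=
  rho M (sep F X) ^ 2 * (tilt M H F η X * u X + v X)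

/-- `tilt` is the coefficient that makes this true. The term `ε` is there because the difference of
two curves solves the linearized equation only up to an error. -/
theorem LeafAt.hasDerivAt_normalVar (h : LeafAt M H F η X) (hM : 0 < M) {u v : ℝ → ℝ} {ε : ℝ}
    (hu : HasDerivAt u (v X / cosh (η X) ^ 2 + ε) X) :
    HasDerivAt (normalVar M F η u)
      (scale M (sep F X) / cosh (η X) / rho M (sep F X) ^ 2 * normalFlux M H F η u v X
        + scale M (sep F X) * cosh (η X) * ε) X := by
  have h1 := ((h.hasDerivAt_scale hM).mul h.deriv_rapidity.cosh).mul hu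
  refine h1.congr_deriv ?_
  have hc := (cosh_pos (η X)).ne'
  have hr := (rho_pos hM (w := sep F X) h.mem).ne'
  rw [accel_eq]
  unfold normalFlux tilt
  simp only [Pi.mul_apply]
  field_simp
  ring

/-- The coefficient of the height variation in the Jacobi equation collapses to the squared norm of
the second fundamental form. The difference of the two sides is an explicit combination of the two
hypotheses relating s, r, E, P and Q. -/
theorem secondForm_identity {M r : ℝ} (hM : M ≠ 0) (hr : r ≠ 0) (H s E P Q : ℝ)
    (h3 : s ^ 2 * r = 16 * M ^ 2 * E) (h4 : (Q ^ 2 - P ^ 2) * E = r - 2 * M) :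
    2 * (E ^ 2 * (r ^ 2 + 4 * M * r + 8 * M ^ 2) / r ^ 4) * Q ^ 2
      + 8 * M * E / r ^ 2 * (-(r + 2 * M) * E / r ^ 2) * Q ^ 2 + -(r + 2 * M) * E / r ^ 2
      + -(r + 2 * M) * E / r ^ 2 * P * (6 * H * s - E * (6 * M - r) / r ^ 2 * P)
      + (3 * H * s - E * (6 * M - r) / r ^ 2 * P) ^ 2 + E * (6 * M - r) / r ^ 2
      - 2 * P ^ 2 * (E ^ 2 * (-(6 * M - r) * (r + 4 * M) - 2 * M * r) / r ^ 4)
    = s ^ 2 * ((3 * H - 2 * (s * P / (4 * M)) / r) ^ 2 + 2 * (s * P / (4 * M) / r) ^ 2) := by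
  rw [← sub_eq_zero]
  have h : 2 * (E ^ 2 * (r ^ 2 + 4 * M * r + 8 * M ^ 2) / r ^ 4) * Q ^ 2
      + 8 * M * E / r ^ 2 * (-(r + 2 * M) * E / r ^ 2) * Q ^ 2 + -(r + 2 * M) * E / r ^ 2
      + -(r + 2 * M) * E / r ^ 2 * P * (6 * H * s - E * (6 * M - r) / r ^ 2 * P)
      + (3 * H * s - E * (6 * M - r) / r ^ 2 * P) ^ 2 + E * (6 * M - r) / r ^ 2
      - 2 * P ^ 2 * (E ^ 2 * (-(6 * M - r) * (r + 4 * M) - 2 * M * r) / r ^ 4)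
      - s ^ 2 * ((3 * H - 2 * (s * P / (4 * M)) / r) ^ 2 + 2 * (s * P / (4 * M) / r) ^ 2)
      = 2 * E / r ^ 2 * ((Q ^ 2 - P ^ 2) * E - (r - 2 * M))
      + (3 * H * P * s / (M * r ^ 2) - 3 * P ^ 2 / (8 * M ^ 2 * r ^ 4)
        * (s ^ 2 * r + 16 * M ^ 2 * E)) * (s ^ 2 * r - 16 * M ^ 2 * E) := by
    field_simp
    ring
  rw [h, h3, h4]
  ring

/-- This is the Jacobi equation (r² φ̇)˙ = r² (|A|² φ + 3δ) with error terms. There is no Ricci term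
because the metric is a vacuum metric, which makes the coefficient of φ nonnegative. -/
theorem LeafAt.hasDerivAt_normalFlux (h : LeafAt M H F η X) (hM : 0 < M) {u v : ℝ → ℝ}
    {ε ε' δ : ℝ} (hu : HasDerivAt u (v X / cosh (η X) ^ 2 + ε) X)
    (hv : HasDerivAt v (accelT M H F η X * u X + accelη M H F η X * v X
      + 3 * scale M (sep F X) / cosh (η X) * δ + ε') X) :
    HasDerivAt (normalFlux M H F η u v)
      (rho M (sep F X) ^ 2 * scale M (sep F X) / cosh (η X) *
          (secondFormSq M H F η X * normalVar M F η u X + 3 * δ)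
        + rho M (sep F X) ^ 2 * (tilt M H F η X * ε + ε')) X := by
  have hr := (rho_pos hM (w := sep F X) h.mem).ne'
  have hθ1 := ((((h.hasDerivAt_rho hM).add_const (2 * M)).neg.mul
    ((hasDerivAt_redshift hM (w := sep F X) h.mem).comp X h.hasDerivAt_sep)).div
    ((h.hasDerivAt_rho hM).pow 2) (pow_ne_zero 2 hr)).mul h.deriv_rapidity.cosh |>.mul
    h.hasDerivAt_tang
  have hθ2 := ((h.hasDerivAt_scale hM).const_mul (3 * H)).mul h.deriv_rapidity.sinh
  have hθ3 := ((h.hasDerivAt_tidal hM).mul h.deriv_rapidity.sinh).mul h.hasDerivAt_nrml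
  have hθ := (hθ1.add hθ2).sub hθ3
  have h1 := ((h.hasDerivAt_rho hM).pow 2).mul ((hθ.mul hu).add hv)
  refine h1.congr_deriv ?_
  have hc := (cosh_pos (η X)).ne'
  have h3 := scale_sq_mul hM (w := sep F X) h.mem
  have h4 := mul_redshift hM (w := sep F X) h.mem
  have h5 := tang_sq_sub F η X
  have h6 := Real.cosh_sq_sub_sinh_sq (η X)
  -- Expressing X and T in the adapted frame leaves only quantities tied by the relations already
  -- listed, so that the goal becomes an identity of rational functions.
  have h7 : X = cosh (η X) * tang F η X - sinh (η X) * nrml F η X := by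
    unfold tang nrml
    linear_combination (-X) * h6
  have h8 : F X = sinh (η X) * tang F η X - cosh (η X) * nrml F η X := by
    unfold tang nrml
    linear_combination (-F X) * h6
  rw [accel_eq]
  unfold accelT accelη tilt secondFormSq normalVar
  simp only [Pi.mul_apply, Pi.pow_apply, Pi.add_apply, Pi.sub_apply, Pi.neg_apply, Pi.div_apply,
    Function.comp_apply, tidal]
  clear hθ hθ1 hθ2 hθ3 h1
  have key := secondForm_identity hM.ne' hr H (scale M (sep F X)) (redshift M (sep F X))
    (nrml F η X) (tang F η X) h3 (by rw [h5]; exact h4)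
  generalize scale M (sep F X) = s at *
  generalize rho M (sep F X) = r at *
  generalize redshift M (sep F X) = E at *
  generalize tang F η X = Q at *
  generalize nrml F η X = P at *
  generalize cosh (η X) = c at *
  generalize sinh (η X) = sh at *
  generalize F X = T at *
  generalize u X = u₀ at *
  generalize v X = v₀ at *
  rw [h7, h8]
  rw [← sub_eq_zero] at key ⊢
  refine Eq.trans ?_ ((congrArg (fun x => r ^ 2 * u₀ * x) key).trans (mul_zero _))
  have hM' := hM.ne'
  field_simp
  ring

end

end Kruskal

/-! ### Maximal profile curves -/

namespace Kruskal

open Set Filter Topology Real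

/-- The vector field on the space of `(X, T, η, H)` whose integral curves are the profile curves. -/
def phaseField (M : ℝ) (y : ℝ × ℝ × ℝ × ℝ) : ℝ × ℝ × ℝ × ℝ :=
  (1, sinh y.2.2.1 / cosh y.2.2.1, accel M y.2.2.2 y.1 y.2.1 y.2.2.1, 0)

/-- The part of phase space over the Kruskal extension. -/
def phaseSpace (M : ℝ) : Set (ℝ × ℝ × ℝ × ℝ) := {y | -(2 * M) < y.1 ^ 2 - y.2.1 ^ 2}

/-- `F` and its rapidity `η` form a profile curve on `(-b, b)` that crosses the `T`-axis
orthogonally at `T₀`. -/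
structure IsLeaf (M H T₀ b : ℝ) (F η : ℝ → ℝ) : Prop where
  height_zero : F 0 = T₀
  rapidity_zero : η 0 = 0
  leafAt : ∀ t ∈ Ioo (-b) b, LeafAt M H F η t

/-- The maximal interval of definition of the profile curve through `(T₀, 0)`. -/
def leafDom (M H T₀ : ℝ) : Set ℝ := {X | ∃ b F η, |X| < b ∧ IsLeaf M H T₀ b F η}

/-- The profile curve through `(T₀, 0)`. -/
def height (M H T₀ X : ℝ) : ℝ :=
  Classical.epsilon fun y => ∃ b F η, |X| < b ∧ IsLeaf M H T₀ b F η ∧ y = F X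

/-- The rapidity of the profile curve through `(T₀, 0)`. -/
def rapidity (M H T₀ X : ℝ) : ℝ :=
  Classical.epsilon fun y => ∃ b F η, |X| < b ∧ IsLeaf M H T₀ b F η ∧ y = η X

theorem isOpen_phaseSpace (M : ℝ) : IsOpen (phaseSpace M) :=
  isOpen_lt continuous_const (by fun_prop)

theorem contDiffAt_accel {M : ℝ} (hM : 0 < M) {y : ℝ × ℝ × ℝ × ℝ} (hy : y ∈ phaseSpace M) :
    ContDiffAt ℝ ∞ (fun y : ℝ × ℝ × ℝ × ℝ => accel M y.2.2.2 y.1 y.2.1 y.2.2.1) y := by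
  have hw : ContDiffAt ℝ ∞ (fun y : ℝ × ℝ × ℝ × ℝ => y.1 ^ 2 - y.2.1 ^ 2) y := by fun_prop
  have h1 := (contDiffAt_scale hM hy).comp y hw
  have h2 := (contDiffAt_tidal hM hy).comp y hw
  have hη : ContDiffAt ℝ ∞ (fun y : ℝ × ℝ × ℝ × ℝ => y.2.2.1) y := by fun_prop
  have hH : ContDiffAt ℝ ∞ (fun y : ℝ × ℝ × ℝ × ℝ => y.2.2.2) y := by fun_prop
  have hT : ContDiffAt ℝ ∞ (fun y : ℝ × ℝ × ℝ × ℝ => y.2.1) y := by fun_prop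
  have hX : ContDiffAt ℝ ∞ (fun y : ℝ × ℝ × ℝ × ℝ => y.1) y := by fun_prop
  unfold accel
  exact (((contDiffAt_const.mul hH).mul h1).div hη.cosh (cosh_pos _).ne').add
    ((hT.sub (hX.mul (hη.sinh.div hη.cosh (cosh_pos _).ne'))).mul h2)

theorem contDiffOn_phaseField {M : ℝ} (hM : 0 < M) :
    ContDiffOn ℝ ∞ (phaseField M) (phaseSpace M) := by
  intro y hy
  have hη : ContDiffAt ℝ ∞ (fun y : ℝ × ℝ × ℝ × ℝ => y.2.2.1) y := by fun_prop
  exact (contDiffAt_const.prodMk ((hη.sinh.div hη.cosh (cosh_pos _).ne').prodMk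
    ((contDiffAt_accel hM hy).prodMk contDiffAt_const))).contDiffWithinAt

section

variable {M H T₀ b : ℝ} {F η : ℝ → ℝ}

theorem IsLeaf.isSol (h : IsLeaf M H T₀ b F η) :
    ODEOn.IsSol (phaseField M) (phaseSpace M) b (fun t => (t, F t, η t, H)) := fun t ht =>
  ⟨(hasDerivAt_id t).prodMk ((h.leafAt t ht).deriv_height.prodMk
    ((h.leafAt t ht).deriv_rapidity.prodMk (hasDerivAt_const t H))), (h.leafAt t ht).mem⟩

/-- The first component of a trajectory is the time itself and the last is constant. Carrying H as a
state variable turns dependence on H into dependence on the initial value. -/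
theorem exists_isLeaf_of_isSol {γ : ℝ → ℝ × ℝ × ℝ × ℝ} (hb : 0 < b)
    (h : ODEOn.IsSol (phaseField M) (phaseSpace M) b γ) (h0 : γ 0 = (0, T₀, 0, H)) :
    IsLeaf M H T₀ b (fun t => (γ t).2.1) (fun t => (γ t).2.2.1) := by
  have hmem : (0 : ℝ) ∈ Ioo (-b) b := ⟨by linarith, hb⟩
  have hfst : ∀ t ∈ Ioo (-b) b, HasDerivAt (fun t => (γ t).1) 1 t := fun t ht =>
    (h t ht).1.fst
  have hsnd : ∀ t ∈ Ioo (-b) b, HasDerivAt (fun t => (γ t).2) (phaseField M (γ t)).2 t :=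
    fun t ht => (h t ht).1.snd
  have hsnd2 : ∀ t ∈ Ioo (-b) b, HasDerivAt (fun t => (γ t).2.2) (phaseField M (γ t)).2.2 t :=
    fun t ht => (hsnd t ht).snd
  have hlast : ∀ t ∈ Ioo (-b) b, HasDerivAt (fun t => (γ t).2.2.2) 0 t := fun t ht =>
    (hsnd2 t ht).snd
  have hX : ∀ t ∈ Ioo (-b) b, (γ t).1 = t := by
    intro t ht
    have hd : ∀ s ∈ Ioo (-b) b, HasDerivAt (fun t => (γ t).1 - t) 0 s := fun s hs =>
      ((hfst s hs).sub (hasDerivAt_id s)).congr_deriv (sub_self 1)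
    have := isOpen_Ioo.is_const_of_deriv_eq_zero (f := fun t => (γ t).1 - t)
      isPreconnected_Ioo (fun s hs => (hd s hs).differentiableAt.differentiableWithinAt)
      (fun s hs => (hd s hs).deriv) ht hmem
    simp only [h0] at this
    linarith
  have hH : ∀ t ∈ Ioo (-b) b, (γ t).2.2.2 = H := by
    intro t ht
    have := isOpen_Ioo.is_const_of_deriv_eq_zero (f := fun t => (γ t).2.2.2)
      isPreconnected_Ioo
      (fun s hs => (hlast s hs).differentiableAt.differentiableWithinAt)
      (fun s hs => (hlast s hs).deriv) ht hmem
    simpa [h0] using this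
  refine ⟨by simp [h0], by simp [h0], fun t ht => ⟨?_, ?_, ?_⟩⟩
  · have := (h t ht).2
    simp only [phaseSpace, mem_ofPred_eq, hX t ht] at this
    exact this
  · exact (hsnd t ht).fst
  · have := (hsnd2 t ht).fst
    simp only [phaseField, hX t ht, hH t ht] at this
    exact this

theorem IsLeaf.eq (hM : 0 < M) {b' : ℝ} {F' η' : ℝ → ℝ} (h : IsLeaf M H T₀ b F η)
    (h' : IsLeaf M H T₀ b' F' η') {X : ℝ} (hb : |X| < b) (hb' : |X| < b') :
    F X = F' X ∧ η X = η' X := by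
  have := ((h.isSol).mono (min_le_left b b')).eq (isOpen_phaseSpace M)
    ((contDiffOn_phaseField hM).of_le (by simp)) ((h'.isSol).mono (min_le_right b b'))
    (by simp [h.height_zero, h.rapidity_zero, h'.height_zero, h'.rapidity_zero])
    (lt_min hb hb')
  simp only [Prod.mk.injEq] at this
  exact ⟨this.2.1, this.2.2.1⟩

/-- By uniqueness all local solutions agree, so the arbitrary choice in `height` does no harm on
`leafDom`; elsewhere its value has no meaning. -/
theorem IsLeaf.height_eq (hM : 0 < M) (h : IsLeaf M H T₀ b F η) {X : ℝ} (hb : |X| < b) :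
    height M H T₀ X = F X := by
  obtain ⟨b', F', η', hb', h', he⟩ := Classical.epsilon_spec
    (p := fun y => ∃ b F η, |X| < b ∧ IsLeaf M H T₀ b F η ∧ y = F X) ⟨F X, b, F, η, hb, h, rfl⟩
  exact he.trans (h'.eq hM h hb' hb).1

theorem IsLeaf.rapidity_eq (hM : 0 < M) (h : IsLeaf M H T₀ b F η) {X : ℝ} (hb : |X| < b) :
    rapidity M H T₀ X = η X := by
  obtain ⟨b', F', η', hb', h', he⟩ := Classical.epsilon_spec
    (p := fun y => ∃ b F η, |X| < b ∧ IsLeaf M H T₀ b F η ∧ y = η X) ⟨η X, b, F, η, hb, h, rfl⟩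
  exact he.trans (h'.eq hM h hb' hb).2

theorem mem_leafDom_of_abs_le {X Y : ℝ} (h : X ∈ leafDom M H T₀) (hY : |Y| ≤ |X|) :
    Y ∈ leafDom M H T₀ := by
  obtain ⟨b, F, η, hb, h⟩ := h
  exact ⟨b, F, η, hY.trans_lt hb, h⟩

theorem isOpen_leafDom (M H T₀ : ℝ) : IsOpen (leafDom M H T₀) := by
  rw [isOpen_iff_mem_nhds]
  rintro X ⟨b, F, η, hb, h⟩
  filter_upwards [continuous_abs.continuousAt.eventually (gt_mem_nhds hb)] with Y hY
  exact ⟨b, F, η, hY, h⟩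

theorem ordConnected_leafDom (M H T₀ : ℝ) : (leafDom M H T₀).OrdConnected := by
  refine ⟨fun x hx y hy z hz => ?_⟩
  rcases le_total 0 z with h | h
  · exact mem_leafDom_of_abs_le hy (by rw [abs_of_nonneg h]; exact hz.2.trans (le_abs_self y))
  · exact mem_leafDom_of_abs_le hx (by
      rw [abs_of_nonpos h]; exact (neg_le_neg hz.1).trans (neg_le_abs x))

theorem leafAt_of_mem (hM : 0 < M) {X : ℝ} (hX : X ∈ leafDom M H T₀) :
    LeafAt M H (height M H T₀) (rapidity M H T₀) X := by
  obtain ⟨b, F, η, hb, h⟩ := hX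
  have h1 : height M H T₀ =ᶠ[𝓝 X] F := by
    filter_upwards [continuous_abs.continuousAt.eventually (gt_mem_nhds hb)] with Y hY
    exact h.height_eq hM hY
  have h2 : rapidity M H T₀ =ᶠ[𝓝 X] η := by
    filter_upwards [continuous_abs.continuousAt.eventually (gt_mem_nhds hb)] with Y hY
    exact h.rapidity_eq hM hY
  have h3 := h.leafAt X (abs_lt.1 hb)
  refine ⟨?_, ?_, ?_⟩
  · rw [h1.self_of_nhds]; exact h3.mem
  · rw [h2.self_of_nhds]; exact h3.deriv_height.congr_of_eventuallyEq h1
  · rw [h2.self_of_nhds, h1.self_of_nhds]; exact h3.deriv_rapidity.congr_of_eventuallyEq h2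

theorem zero_mem_leafDom (hM : 0 < M) (H : ℝ) (hT : T₀ ^ 2 < 2 * M) : 0 ∈ leafDom M H T₀ := by
  have hy : ((0 : ℝ), T₀, (0 : ℝ), H) ∈ phaseSpace M := by
    simp only [phaseSpace, mem_ofPred_eq]
    linarith
  have hc := (contDiffOn_phaseField hM).contDiffAt ((isOpen_phaseSpace M).mem_nhds hy)
  obtain ⟨α, hα0, ε, hε, hα⟩ :=
    (hc.of_le (m := 1) (by simp)).exists_forall_mem_closedBall_exists_eq_forall_mem_Ioo_hasDerivAt₀ 0
  simp only [zero_sub, zero_add] at hα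
  have hcont : ContinuousAt α 0 := (hα 0 ⟨by linarith, hε⟩).continuousAt
  have hev := hcont.eventually ((isOpen_phaseSpace M).mem_nhds (by rw [hα0]; exact hy))
  obtain ⟨δ, hδ, hδs⟩ := Metric.eventually_nhds_iff.1 hev
  have hsol : ODEOn.IsSol (phaseField M) (phaseSpace M) (min ε δ) α := by
    intro t ht
    refine ⟨hα t ⟨?_, ht.2.trans_le (min_le_left _ _)⟩, hδs ?_⟩
    · linarith [ht.1, min_le_left ε δ]
    · rw [Real.dist_eq, sub_zero, abs_lt]
      exact ⟨by linarith [ht.1, min_le_right ε δ], ht.2.trans_le (min_le_right _ _)⟩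
  exact ⟨min ε δ, _, _, by simpa using ⟨hε, hδ⟩, exists_isLeaf_of_isSol (lt_min hε hδ) hsol hα0⟩

theorem height_zero_eq (hM : 0 < M) (H : ℝ) (hT : T₀ ^ 2 < 2 * M) : height M H T₀ 0 = T₀ := by
  obtain ⟨b, F, η, hb, h⟩ := zero_mem_leafDom hM H hT
  rw [h.height_eq hM hb, h.height_zero]

theorem rapidity_zero_eq (hM : 0 < M) (H : ℝ) (hT : T₀ ^ 2 < 2 * M) : rapidity M H T₀ 0 = 0 := by
  obtain ⟨b, F, η, hb, h⟩ := zero_mem_leafDom hM H hT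
  rw [h.rapidity_eq hM hb, h.rapidity_zero]

theorem IsLeaf.reflect (h : IsLeaf M H T₀ b F η) :
    IsLeaf M H T₀ b (fun X => F (-X)) (fun X => -η (-X)) := by
  refine ⟨by simpa using h.height_zero, by simpa using h.rapidity_zero, fun t ht => ?_⟩
  have h1 := h.leafAt (-t) ⟨by linarith [ht.2], by linarith [ht.1]⟩
  refine ⟨?_, ?_, ?_⟩
  · simpa using h1.mem
  · refine (h1.deriv_height.comp t (hasDerivAt_neg t)).congr_deriv ?_
    simp [neg_div]
  · refine (h1.deriv_rapidity.comp t (hasDerivAt_neg t)).neg.congr_deriv ?_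
    simp [accel, neg_div]

theorem IsLeaf.neg (h : IsLeaf M H T₀ b F η) :
    IsLeaf M (-H) (-T₀) b (fun X => -F X) (fun X => -η X) := by
  refine ⟨by simpa using h.height_zero, by simpa using h.rapidity_zero, fun t ht => ?_⟩
  have h1 := h.leafAt t ht
  refine ⟨?_, ?_, ?_⟩
  · simpa using h1.mem
  · refine h1.deriv_height.neg.congr_deriv ?_
    simp [neg_div]
  · refine h1.deriv_rapidity.neg.congr_deriv ?_
    simp [accel, neg_div]
    ring

theorem height_neg (hM : 0 < M) {X : ℝ} (hX : X ∈ leafDom M H T₀) :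
    height M H T₀ (-X) = height M H T₀ X := by
  obtain ⟨b, F, η, hb, h⟩ := hX
  rw [h.height_eq hM hb, h.reflect.height_eq hM (by rwa [abs_neg]), neg_neg]

theorem leafDom_neg (M H T₀ : ℝ) : leafDom M (-H) (-T₀) = leafDom M H T₀ := by
  have key : ∀ {H T₀ : ℝ}, leafDom M H T₀ ⊆ leafDom M (-H) (-T₀) := by
    rintro H T₀ X ⟨b, F, η, hb, h⟩
    exact ⟨b, _, _, hb, h.neg⟩
  refine Subset.antisymm ?_ key
  have := key (H := -H) (T₀ := -T₀)
  rwa [neg_neg, neg_neg] at this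

theorem height_neg_neg (hM : 0 < M) {X : ℝ} (hX : X ∈ leafDom M H T₀) :
    height M (-H) (-T₀) X = -height M H T₀ X := by
  obtain ⟨b, F, η, hb, h⟩ := hX
  rw [h.height_eq hM hb, h.neg.height_eq hM hb]

/-- The totally geodesic slice T = 0: the leaf of height zero, below which no curve of nonnegative
height passes. -/
theorem isLeaf_zero (hM : 0 < M) (b : ℝ) : IsLeaf M 0 0 b (fun _ => 0) (fun _ => 0) := by
  refine ⟨rfl, rfl, fun t _ => ⟨?_, ?_, ?_⟩⟩
  · nlinarith [sq_nonneg t]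
  · simpa using hasDerivAt_const t (0 : ℝ)
  · simpa [accel] using hasDerivAt_const t (0 : ℝ)

theorem leafDom_zero (hM : 0 < M) : leafDom M 0 0 = univ :=
  eq_univ_of_forall fun X => ⟨|X| + 1, _, _, by linarith, isLeaf_zero hM _⟩

theorem height_zero_zero (hM : 0 < M) (X : ℝ) : height M 0 0 X = 0 :=
  (isLeaf_zero hM (|X| + 1)).height_eq hM (by linarith)

theorem isLeaf_height (hM : 0 < M) (hT : T₀ ^ 2 < 2 * M)
    (hb : ∀ t ∈ Ioo (-b) b, t ∈ leafDom M H T₀) :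
    IsLeaf M H T₀ b (height M H T₀) (rapidity M H T₀) :=
  ⟨height_zero_eq hM H hT, rapidity_zero_eq hM H hT, fun t ht => leafAt_of_mem hM (hb t ht)⟩

theorem sq_lt_of_mem_leafDom {X : ℝ} (hX : X ∈ leafDom M H T₀) : T₀ ^ 2 < 2 * M := by
  obtain ⟨b, F, η, hb, h⟩ := hX
  have h1 := (h.leafAt 0 ⟨by linarith [abs_nonneg X], (abs_nonneg X).trans_lt hb⟩).mem
  rw [h.height_zero] at h1
  linarith

/-- Profile curves depend in a Lipschitz way on their initial height and mean curvature. -/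
theorem exists_leaf_near (hM : 0 < M) {X : ℝ} (hX : X ∈ leafDom M H T₀) :
    ∃ C > 0, ∃ ε > 0, ∀ T' H', |T' - T₀| < ε → |H' - H| < ε → X ∈ leafDom M H' T' ∧
      ∀ t, |t| ≤ |X| →
        |height M H' T' t - height M H T₀ t| ≤ C * max |T' - T₀| |H' - H| ∧
        |rapidity M H' T' t - rapidity M H T₀ t| ≤ C * max |T' - T₀| |H' - H| := by
  obtain ⟨b, F, η, hb, h⟩ := hX
  obtain ⟨c, hXc, hcb⟩ := exists_between hb
  have hc : 0 < c := (abs_nonneg X).trans_lt hXc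
  obtain ⟨C, hC, ε, hε, hn⟩ := h.isSol.exists_near (isOpen_phaseSpace M)
    ((contDiffOn_phaseField hM).of_le (by simp)) hc hcb
  refine ⟨C, hC, ε, hε, fun T' H' hT' hH' => ?_⟩
  have hdist : dist ((0 : ℝ), T', (0 : ℝ), H') (0, F 0, η 0, H) = max |T' - T₀| |H' - H| := by
    simp [Prod.dist_eq, h.height_zero, h.rapidity_zero, Real.dist_eq]
  obtain ⟨γ, hγ0, hγ, hd⟩ := hn (0, T', 0, H') (by rw [hdist]; exact max_lt hT' hH')
  have hl := exists_isLeaf_of_isSol hc hγ hγ0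
  refine ⟨⟨c, _, _, hXc, hl⟩, fun t ht => ?_⟩
  have htc := ht.trans_lt hXc
  have hdt := hd t htc
  rw [hdist, Prod.dist_eq, max_le_iff, Prod.dist_eq, max_le_iff, Prod.dist_eq, max_le_iff] at hdt
  rw [hl.height_eq hM htc, hl.rapidity_eq hM htc, h.height_eq hM (htc.trans hcb),
    h.rapidity_eq hM (htc.trans hcb)]
  exact ⟨hdt.2.1, hdt.2.2.1⟩

/-- A profile curve can only end where it leaves the Kruskal extension. -/
theorem mem_leafDom_of_forall_lt (hM : 0 < M) (hT : T₀ ^ 2 < 2 * M) {X δ : ℝ} (hX : 0 < X)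
    (hδ : 0 < δ) (hdom : ∀ t ∈ Ico 0 X, t ∈ leafDom M H T₀)
    (hsep : ∀ t ∈ Ico 0 X, -(2 * M) + δ ≤ sep (height M H T₀) t) : X ∈ leafDom M H T₀ := by
  have habs : ∀ {t}, t ∈ Ioo (-X) X → |t| ∈ Ico 0 X := fun ht => ⟨abs_nonneg _, abs_lt.2 ht⟩
  have hdom' : ∀ t ∈ Ioo (-X) X, t ∈ leafDom M H T₀ := fun t ht =>
    mem_leafDom_of_abs_le (hdom _ (habs ht)) (by rw [abs_abs])
  have hsep' : ∀ t ∈ Ioo (-X) X, -(2 * M) + δ ≤ sep (height M H T₀) t := by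
    intro t ht
    have := hsep _ (habs ht)
    rcases abs_choice t with h | h
    · rwa [h] at this
    · rw [h] at this
      simpa [sep, height_neg hM (hdom' t ht)] using this
  -- With X bounded, a lower bound on X² - T² bounds T as well, so the curve stays over a compact
  -- part of the extension.
  set K₀ : Set (ℝ × ℝ) := {p | |p.1| ≤ X ∧ -(2 * M) + δ ≤ p.1 ^ 2 - p.2 ^ 2} with hK₀
  have hK₀c : IsCompact K₀ := by
    apply Metric.isCompact_of_isClosed_isBounded
    · have h1 : IsClosed {p : ℝ × ℝ | |p.1| ≤ X} := isClosed_le (by fun_prop) continuous_const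
      have h2 : IsClosed {p : ℝ × ℝ | -(2 * M) + δ ≤ p.1 ^ 2 - p.2 ^ 2} :=
        isClosed_le continuous_const (by fun_prop)
      exact h1.inter h2
    · refine (Metric.isBounded_closedBall (x := ((0 : ℝ), (0 : ℝ))) (r := X + X ^ 2 + 2 * M + 1)).subset ?_
      rintro ⟨p, q⟩ ⟨h1, h2⟩
      simp only at h1 h2
      have h3 : p ^ 2 ≤ X ^ 2 := sq_le_sq' (by linarith [(abs_le.1 h1).1]) (abs_le.1 h1).2
      have h4 : |q| ≤ X ^ 2 + 2 * M + 1 := by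
        rw [abs_le]; constructor <;> nlinarith [sq_nonneg (q - 1), sq_nonneg (q + 1)]
      simp only [Metric.mem_closedBall, Prod.dist_eq, Real.dist_eq, sub_zero, max_le_iff]
      constructor <;> nlinarith [sq_nonneg X]
  have hK₀d : ∀ p ∈ K₀, -(2 * M) < p.1 ^ 2 - p.2 ^ 2 := fun p hp => by linarith [hp.2]
  have hcont : ContinuousOn (fun p : ℝ × ℝ => 3 * |H| * scale M (p.1 ^ 2 - p.2 ^ 2)
      + (|p.2| + |p.1|) * |tidal M (p.1 ^ 2 - p.2 ^ 2)|) K₀ := by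
    intro p hp
    have hw : ContinuousAt (fun p : ℝ × ℝ => p.1 ^ 2 - p.2 ^ 2) p := by fun_prop
    have h1 : ContinuousAt (fun p : ℝ × ℝ => scale M (p.1 ^ 2 - p.2 ^ 2)) p :=
      ContinuousAt.comp (f := fun p : ℝ × ℝ => p.1 ^ 2 - p.2 ^ 2)
        (contDiffAt_scale hM (hK₀d p hp)).continuousAt hw
    have h2 : ContinuousAt (fun p : ℝ × ℝ => tidal M (p.1 ^ 2 - p.2 ^ 2)) p :=
      ContinuousAt.comp (f := fun p : ℝ × ℝ => p.1 ^ 2 - p.2 ^ 2)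
        (contDiffAt_tidal hM (hK₀d p hp)).continuousAt hw
    exact ((continuousAt_const.mul h1).add
      ((by fun_prop : ContinuousAt (fun p : ℝ × ℝ => |p.2| + |p.1|) p).mul
        h2.abs)).continuousWithinAt
  obtain ⟨C, hC⟩ := hK₀c.bddAbove_image hcont
  have hmemK : ∀ t ∈ Ioo (-X) X, (t, height M H T₀ t) ∈ K₀ := fun t ht =>
    ⟨(abs_lt.2 ht).le, hsep' t ht⟩
  -- The rapidity enters `accel` only through 1/cosh and tanh, both at most 1 in absolute value. The
  -- bound is therefore independent of the rapidity, which cannot blow up.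
  have hbd : ∀ t ∈ Ioo (-X) X,
      |accel M H t (height M H T₀ t) (rapidity M H T₀ t)| ≤ C := by
    intro t ht
    refine le_trans ?_ (hC ⟨_, hmemK t ht, rfl⟩)
    have hs := scale_pos hM (hK₀d _ (hmemK t ht))
    simp only at hs ⊢
    set η := rapidity M H T₀ t
    set T := height M H T₀ t
    have hth : |sinh η / cosh η| ≤ 1 := by
      rw [← Real.tanh_eq_sinh_div_cosh]
      exact (Real.abs_tanh_lt_one η).le
    unfold accel
    refine (abs_add_le _ _).trans (add_le_add ?_ ?_)
    · rw [abs_div, abs_of_pos (cosh_pos η), abs_mul, abs_mul, abs_of_pos hs,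
        abs_of_pos (by norm_num : (0 : ℝ) < 3)]
      exact div_le_self (by positivity) (one_le_cosh η)
    · rw [abs_mul]
      refine mul_le_mul_of_nonneg_right ?_ (abs_nonneg _)
      refine (abs_sub _ _).trans (add_le_add le_rfl ?_)
      rw [abs_mul]
      exact mul_le_of_le_one_right (abs_nonneg _) hth
  have hC0 : 0 ≤ C := (abs_nonneg _).trans (hbd 0 ⟨by linarith, hX⟩)
  have hη : ∀ t ∈ Ioo (-X) X, |rapidity M H T₀ t| ≤ C * X := by
    intro t ht
    have := (convex_Ioo (-X) X).norm_image_sub_le_of_norm_hasDerivWithin_le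
      (f := rapidity M H T₀) (fun s hs => (leafAt_of_mem hM (hdom' s hs)).deriv_rapidity.hasDerivWithinAt)
      (fun s hs => hbd s hs) (x := 0) (y := t) ⟨by linarith, hX⟩ ht
    rw [rapidity_zero_eq hM H hT, sub_zero, sub_zero, Real.norm_eq_abs, Real.norm_eq_abs] at this
    exact this.trans (mul_le_mul_of_nonneg_left (abs_lt.2 ht).le hC0)
  have hleaf := isLeaf_height hM hT hdom'
  set K : Set (ℝ × ℝ × ℝ × ℝ) :=
    (fun q : (ℝ × ℝ) × ℝ => (q.1.1, q.1.2, q.2, H)) '' (K₀ ×ˢ Icc (-(C * X)) (C * X)) with hK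
  have hKc : IsCompact K := (hK₀c.prod isCompact_Icc).image (by fun_prop)
  obtain ⟨b', hb', γ, hγ0, hγ⟩ := hleaf.isSol.extend (K := K) (isOpen_phaseSpace M)
    ((contDiffOn_phaseField hM).of_le (by simp)) hX hKc
    (by
      rintro _ ⟨q, hq, rfl⟩
      exact hK₀d _ hq.1)
    (fun t ht => ⟨((t, height M H T₀ t), rapidity M H T₀ t), ⟨hmemK t ht, abs_le.1 (hη t ht)⟩, rfl⟩)
  have hl := exists_isLeaf_of_isSol (hX.trans hb') hγ
    (by rw [hγ0, height_zero_eq hM H hT, rapidity_zero_eq hM H hT])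
  exact ⟨b', _, _, by rw [abs_of_pos hX]; exact hb', hl⟩

/-- Profile curves are smooth. -/
theorem contDiffOn_height_rapidity (hM : 0 < M) :
    ContDiffOn ℝ ∞ (height M H T₀) (leafDom M H T₀) ∧
      ContDiffOn ℝ ∞ (rapidity M H T₀) (leafDom M H T₀) := by
  have hO := isOpen_leafDom M H T₀
  -- Bootstrapping: the derivatives of height and rapidity are smooth functions of the pair, so each
  -- order of regularity yields the next.
  have key : ∀ n : ℕ, ContDiffOn ℝ n (height M H T₀) (leafDom M H T₀) ∧
      ContDiffOn ℝ n (rapidity M H T₀) (leafDom M H T₀) := by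
    intro n
    induction n with
    | zero =>
      simp only [CharP.cast_eq_zero, contDiffOn_zero]
      exact ⟨fun t ht => (leafAt_of_mem hM ht).deriv_height.continuousAt.continuousWithinAt,
        fun t ht => (leafAt_of_mem hM ht).deriv_rapidity.continuousAt.continuousWithinAt⟩
    | succ n ih =>
      have hd1 : ContDiffOn ℝ n (deriv (height M H T₀)) (leafDom M H T₀) := by
        have : ContDiffOn ℝ n (fun t => sinh (rapidity M H T₀ t) / cosh (rapidity M H T₀ t))
            (leafDom M H T₀) := ih.2.sinh.div ih.2.cosh fun t _ => (cosh_pos _).ne'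
        exact this.congr fun t ht => (leafAt_of_mem hM ht).deriv_height.deriv
      have hd2 : ContDiffOn ℝ n (deriv (rapidity M H T₀)) (leafDom M H T₀) := by
        have : ContDiffOn ℝ n (fun t => accel M H t (height M H T₀ t) (rapidity M H T₀ t))
            (leafDom M H T₀) := by
          intro t ht
          have h1 : ContDiffWithinAt ℝ n
              (fun t => (t, height M H T₀ t, rapidity M H T₀ t, H)) (leafDom M H T₀) t :=
            contDiffWithinAt_id.prodMk ((ih.1 t ht).prodMk ((ih.2 t ht).prodMk
              contDiffWithinAt_const))
          have h2 := contDiffAt_accel hM (y := (t, height M H T₀ t, rapidity M H T₀ t, H))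
            (leafAt_of_mem hM ht).mem
          exact (h2.of_le (by exact_mod_cast le_top)).comp_contDiffWithinAt t h1
        exact this.congr fun t ht => (leafAt_of_mem hM ht).deriv_rapidity.deriv
      refine ⟨?_, ?_⟩
      · push_cast
        rw [contDiffOn_succ_iff_deriv_of_isOpen hO]
        exact ⟨fun t ht => (leafAt_of_mem hM ht).deriv_height.differentiableAt.differentiableWithinAt,
          by simp, hd1⟩
      · push_cast
        rw [contDiffOn_succ_iff_deriv_of_isOpen hO]
        exact ⟨fun t ht => (leafAt_of_mem hM ht).deriv_rapidity.differentiableAt.differentiableWithinAt,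
          by simp, hd2⟩
  exact ⟨contDiffOn_infty.2 fun n => (key n).1, contDiffOn_infty.2 fun n => (key n).2⟩

end

end Kruskal

/-! ### Comparison of neighbouring profile curves -/

namespace Kruskal

open Set Filter Topology Real

/-- A perturbed cooperative linear system keeps its first component positive. -/
theorem pos_of_cooperative {b K e : ℝ} (hK : 0 ≤ K) (he : 0 ≤ e)
    {φ ζ k κ g e₁ e₂ : ℝ → ℝ}
    (hφ : ∀ t ∈ Icc 0 b, HasDerivAt φ (k t * ζ t + e₁ t) t)
    (hζ : ∀ t ∈ Icc 0 b, HasDerivAt ζ (κ t * φ t + g t + e₂ t) t)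
    (hk : ∀ t ∈ Icc 0 b, 0 ≤ k t ∧ k t ≤ K) (hκ : ∀ t ∈ Icc 0 b, 0 ≤ κ t)
    (hg : ∀ t ∈ Icc 0 b, 0 ≤ g t) (he₁ : ∀ t ∈ Icc 0 b, |e₁ t| ≤ e)
    (he₂ : ∀ t ∈ Icc 0 b, |e₂ t| ≤ e) (hζ0 : 0 ≤ ζ 0) (hφ0 : e * (1 + K * b) * b < φ 0) :
    ∀ t ∈ Icc 0 b, 0 < φ t := by
  by_contra! hcon
  obtain ⟨t₁, ht₁, hφt₁⟩ := hcon
  set S : Set ℝ := {t | t ∈ Icc 0 b ∧ φ t ≤ 0} with hS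
  have hSc : IsCompact S := by
    have hc : ContinuousOn φ (Icc 0 b) := fun t ht =>
      (hφ t ht).continuousAt.continuousWithinAt
    exact isCompact_Icc.of_isClosed_subset
      (hc.preimage_isClosed_of_isClosed isClosed_Icc isClosed_Iic) fun t ht => ht.1
  obtain ⟨t₀, ⟨ht₀, hφt₀⟩, hleast⟩ := hSc.exists_isLeast ⟨t₁, ht₁, hφt₁⟩
  have hb : ∀ t ∈ Icc 0 t₀, t ∈ Icc 0 b := fun t ht => ⟨ht.1, ht.2.trans ht₀.2⟩
  have hpos : ∀ t ∈ Ico 0 t₀, 0 < φ t := by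
    intro t ht
    by_contra! hle
    exact absurd (hleast ⟨hb t (Ico_subset_Icc_self ht), hle⟩) (not_le.2 ht.2)
  -- Before the first zero `t₀` of `φ`, the terms `κ φ` and `g` can only raise `ζ`, so `ζ` falls at
  -- rate at most `e`.
  have hζ' : ∀ t ∈ Icc 0 t₀, -(e * t) ≤ ζ t := by
    have hd : ∀ t ∈ Icc 0 t₀, HasDerivAt (fun t => ζ t + e * t)
        (κ t * φ t + g t + e₂ t + e * 1) t := fun t ht =>
      (hζ t (hb t ht)).add ((hasDerivAt_id t).const_mul e)
    have hm : MonotoneOn (fun t => ζ t + e * t) (Icc 0 t₀) := by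
      apply monotoneOn_of_deriv_nonneg (convex_Icc 0 t₀)
        (fun t ht => (hd t ht).continuousAt.continuousWithinAt)
        (fun t ht => (hd t (interior_subset ht)).differentiableAt.differentiableWithinAt)
      intro t ht
      rw [interior_Icc] at ht
      rw [(hd t (Ioo_subset_Icc_self ht)).deriv]
      have htb := hb t (Ioo_subset_Icc_self ht)
      have h1 := mul_nonneg (hκ t htb) (hpos t (Ioo_subset_Ico_self ht)).le
      have h2 := (abs_le.1 (he₂ t htb)).1
      linarith [hg t htb]
    intro t ht
    have := hm ⟨le_rfl, ht.1.trans ht.2⟩ ht ht.1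
    simp only [mul_zero, add_zero] at this
    linarith
  -- From `ζ ≥ -e b` and `|e₁| ≤ e`, the rate of decrease of `φ` is at most `e (1 + K b)`; the
  -- assumption on `φ 0` then excludes a zero.
  have hd : ∀ t ∈ Icc 0 t₀, HasDerivAt (fun t => φ t + e * (1 + K * b) * t)
      (k t * ζ t + e₁ t + e * (1 + K * b) * 1) t := fun t ht =>
    (hφ t (hb t ht)).add ((hasDerivAt_id t).const_mul _)
  have hm : MonotoneOn (fun t => φ t + e * (1 + K * b) * t) (Icc 0 t₀) := by
    apply monotoneOn_of_deriv_nonneg (convex_Icc 0 t₀)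
      (fun t ht => (hd t ht).continuousAt.continuousWithinAt)
      (fun t ht => (hd t (interior_subset ht)).differentiableAt.differentiableWithinAt)
    intro t ht
    have ht' := interior_subset ht
    rw [(hd t ht').deriv]
    have htb := hb t ht'
    have h1 := (abs_le.1 (he₁ t htb)).1
    have h2 := hk t htb
    have h3 : -(K * (e * b)) ≤ k t * ζ t := by
      have h4 : k t * (-(e * t)) ≤ k t * ζ t := mul_le_mul_of_nonneg_left (hζ' t ht') h2.1
      have h5 : k t * (e * t) ≤ K * (e * b) :=
        mul_le_mul h2.2 (mul_le_mul_of_nonneg_left htb.2 he) (mul_nonneg he htb.1) hK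
      linarith
    linarith
  have h1 := hm ⟨le_rfl, ht₀.1⟩ ⟨ht₀.1, le_rfl⟩ ht₀.1
  simp only [mul_zero, add_zero] at h1
  have h2 : e * (1 + K * b) * t₀ ≤ e * (1 + K * b) * b := by
    have hb0 : 0 ≤ b := ht₀.1.trans ht₀.2
    exact mul_le_mul_of_nonneg_left ht₀.2 (by positivity)
  linarith

section

variable {M H T₀ : ℝ} {F η : ℝ → ℝ}

/-- The derivative of the phase field in the directions preserving `X`. -/
theorem LeafAt.fderiv_phaseField (hM : 0 < M) {X : ℝ} (h : LeafAt M H F η X) (u v δ : ℝ) :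
    fderiv ℝ (phaseField M) (X, F X, η X, H) (0, u, v, δ) =
      (0, v / cosh (η X) ^ 2, accelT M H F η X * u + accelη M H F η X * v
        + 3 * scale M (sep F X) / cosh (η X) * δ, 0) := by
  have hy : (X, F X, η X, H) ∈ phaseSpace M := h.mem
  have hd := (((contDiffOn_phaseField hM).contDiffAt
    ((isOpen_phaseSpace M).mem_nhds hy)).differentiableAt (by simp)).hasFDerivAt
  have hline : HasDerivAt (fun s : ℝ => (X, F X + s * u, η X + s * v, H + s * δ))
      ((0 : ℝ), u, v, δ) 0 := by
    have hl : ∀ a b : ℝ, HasDerivAt (fun s : ℝ => a + s * b) b 0 := fun a b =>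
      (((hasDerivAt_id (0 : ℝ)).mul_const b).const_add a).congr_deriv (one_mul b)
    exact (hasDerivAt_const _ _).prodMk ((hl _ _).prodMk ((hl _ _).prodMk (hl _ _)))
  have h0 : (X, F X, η X, H) = (fun s : ℝ => (X, F X + s * u, η X + s * v, H + s * δ)) 0 := by
    simp
  rw [h0] at hd
  have h1 := hd.comp_hasDerivAt (0 : ℝ) hline
  rw [← h0] at h1
  refine h1.unique ?_
  have hl : ∀ a b : ℝ, HasDerivAt (fun s : ℝ => a + s * b) b 0 := fun a b =>
    (((hasDerivAt_id (0 : ℝ)).mul_const b).const_add a).congr_deriv (one_mul b)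
  have hc := (cosh_pos (η X)).ne'
  have hc0 : cosh (η X + 0 * v) ≠ 0 := by simpa using hc
  have h6 := Real.cosh_sq_sub_sinh_sq (η X)
  have hth : HasDerivAt (fun s : ℝ => sinh (η X + s * v) / cosh (η X + s * v))
      (v / cosh (η X) ^ 2) 0 := by
    refine (((hl (η X) v).sinh).div ((hl (η X) v).cosh) hc0).congr_deriv ?_
    simp only [zero_mul, add_zero]
    field_simp
    linear_combination v * h6
  have hw : HasDerivAt (fun s : ℝ => X ^ 2 - (F X + s * u) ^ 2) (-2 * F X * u) 0 :=
    (((hl (F X) u).pow 2).const_sub (X ^ 2)).congr_deriv (by simp)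
  have hw0 : X ^ 2 - (F X + 0 * u) ^ 2 = sep F X := by simp [sep]
  have hmem : -(2 * M) < sep F X := h.mem
  have hs : HasDerivAt (fun s : ℝ => scale M (X ^ 2 - (F X + s * u) ^ 2)) _ 0 :=
    (Kruskal.hasDerivAt_scale hM (by rw [hw0]; exact hmem)).comp (0 : ℝ) hw
  have ht : HasDerivAt (fun s : ℝ => tidal M (X ^ 2 - (F X + s * u) ^ 2)) _ 0 :=
    (Kruskal.hasDerivAt_tidal hM (by rw [hw0]; exact hmem)).comp (0 : ℝ) hw
  have hacc := ((((hl H δ).const_mul 3).mul hs).div ((hl (η X) v).cosh) hc0).add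
    (((hl (F X) u).sub (hth.const_mul X)).mul ht)
  have hall := (hasDerivAt_const (0 : ℝ) (1 : ℝ)).prodMk (hth.prodMk (hacc.prodMk
    (hasDerivAt_const (0 : ℝ) (0 : ℝ))))
  refine hall.congr_deriv ?_
  simp only [Prod.mk.injEq, true_and, and_true, zero_mul, add_zero, Pi.mul_apply,
    Pi.sub_apply]
  have hw1 : X ^ 2 - F X ^ 2 = sep F X := rfl
  rw [hw1]
  unfold accelT accelη nrml
  field_simp
  ring

theorem LeafAt.continuousAt_coeffs (hM : 0 < M) {X : ℝ} (h : LeafAt M H F η X) :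
    ContinuousAt (fun X => scale M (sep F X)) X ∧ ContinuousAt (fun X => cosh (η X)) X ∧
      ContinuousAt (fun X => rho M (sep F X)) X ∧ ContinuousAt (tilt M H F η) X := by
  have h1 := (h.hasDerivAt_scale hM).continuousAt
  have h2 := h.deriv_rapidity.cosh.continuousAt
  have h3 := (h.hasDerivAt_rho hM).continuousAt
  have h4 : ContinuousAt (fun X => redshift M (sep F X)) X :=
    ((hasDerivAt_redshift hM (w := sep F X) h.mem).comp X h.hasDerivAt_sep).continuousAt
  have h5 := h.hasDerivAt_tang.continuousAt
  have h6 := h.hasDerivAt_nrml.continuousAt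
  have h7 := h.deriv_rapidity.sinh.continuousAt
  have h8 := (h.hasDerivAt_tidal hM).continuousAt
  have hr := (rho_pos hM (w := sep F X) h.mem).ne'
  exact ⟨h1, h2, h3, (((((h3.add continuousAt_const).neg.mul h4).div (h3.pow 2)
    (pow_ne_zero 2 hr)).mul h2).mul h5).add ((continuousAt_const.mul h1).mul h7) |>.sub
    ((h8.mul h7).mul h6)⟩

theorem uIcc_subset_leafDom {X t : ℝ} (hX : X ∈ leafDom M H T₀) (hX0 : 0 ≤ X)
    (ht : t ∈ Icc 0 X) : t ∈ leafDom M H T₀ :=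
  mem_leafDom_of_abs_le hX (by rw [abs_of_nonneg ht.1, abs_of_nonneg hX0]; exact ht.2)

/-- Raising the initial height, and not decreasing the mean curvature, raises the profile curve. -/
theorem exists_height_lt (hM : 0 < M) {X L : ℝ} (hX : X ∈ leafDom M H T₀) (hX0 : 0 ≤ X)
    (hL : 0 ≤ L) : ∃ ε > 0, ∀ T' H', T₀ < T' → T' < T₀ + ε → H ≤ H' → H' - H ≤ L * (T' - T₀) →
      X ∈ leafDom M H' T' ∧ height M H T₀ X < height M H' T' X := by
  have hT := sq_lt_of_mem_leafDom hX
  have hsub : ∀ t ∈ Icc 0 X, t ∈ leafDom M H T₀ := fun t ht => uIcc_subset_leafDom hX hX0 ht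
  have hleaf : ∀ t ∈ Icc 0 X, LeafAt M H (height M H T₀) (rapidity M H T₀) t := fun t ht =>
    leafAt_of_mem hM (hsub t ht)
  set F := height M H T₀ with hF
  set η := rapidity M H T₀ with hη
  have hs : ∀ t ∈ Icc 0 X, 0 < scale M (sep F t) := fun t ht => scale_pos hM (hleaf t ht).mem
  have hr : ∀ t ∈ Icc 0 X, 0 < rho M (sep F t) := fun t ht => rho_pos hM (hleaf t ht).mem
  obtain ⟨C, hC, ε₀, hε₀, hnear⟩ := exists_leaf_near hM hX
  -- uniform bounds for the coefficients
  have hcont : ContinuousOn (fun t => scale M (sep F t) * cosh (η t)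
      + scale M (sep F t) / cosh (η t) / rho M (sep F t) ^ 2
      + rho M (sep F t) ^ 2 * (|tilt M H F η t| + 1)) (Icc 0 X) := by
    intro t ht
    obtain ⟨h1, h2, h3, h4⟩ := (hleaf t ht).continuousAt_coeffs hM
    exact (((h1.mul h2).add ((h1.div h2 (cosh_pos _).ne').div (h3.pow 2)
      (pow_ne_zero 2 (hr t ht).ne'))).add
      ((h3.pow 2).mul (h4.abs.add continuousAt_const))).continuousWithinAt
  obtain ⟨B, hB⟩ := isCompact_Icc.bddAbove_image hcont
  have hB' : ∀ t ∈ Icc 0 X, scale M (sep F t) * cosh (η t) ≤ B ∧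
      scale M (sep F t) / cosh (η t) / rho M (sep F t) ^ 2 ≤ B ∧
      rho M (sep F t) ^ 2 * (|tilt M H F η t| + 1) ≤ B := by
    intro t ht
    have h1 : _ ≤ B := hB ⟨t, ht, rfl⟩
    have h2 := hs t ht
    have h3 := hr t ht
    have h4 := cosh_pos (η t)
    have h5 : 0 < scale M (sep F t) * cosh (η t) := by positivity
    have h6 : 0 < scale M (sep F t) / cosh (η t) / rho M (sep F t) ^ 2 := by positivity
    have h7 : 0 < rho M (sep F t) ^ 2 * (|tilt M H F η t| + 1) := by positivity
    simp only at h1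
    exact ⟨by linarith, by linarith, by linarith⟩
  have h0X : (0 : ℝ) ∈ Icc 0 X := ⟨le_rfl, hX0⟩
  have hB0 : 0 < B := (mul_pos (hs 0 h0X) (cosh_pos (η 0))).trans_le (hB' 0 h0X).1
  set a := scale M (sep F 0) with ha
  have ha0 : 0 < a := hs 0 h0X
  -- `C₁ * Δ` bounds the distance of the two phase curves: the factor 1 + L accounts for the change
  -- of H, and C + 1 also covers the H component itself.
  set C₁ := (C + 1) * (1 + L) with hC₁
  have hC₁0 : 0 < C₁ := by positivity
  -- With residuals of size `ε * C₁ * Δ`, the threshold of `pos_of_cooperative` is `ε * W * Δ`,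
  -- while the initial normal variation is `a * Δ`. Hence the choice of `ε` below with `ε * W < a`.
  set W := B * C₁ * (1 + B * X) * X with hW
  have hW0 : 0 ≤ W := by positivity
  set ε := a / (2 * (W + 1)) with hε
  have hε0 : 0 < ε := by positivity
  have hεW : ε * W < a := by
    rw [hε, div_mul_eq_mul_div, div_lt_iff₀ (by positivity)]
    nlinarith
  have hKc : IsCompact ((fun t => (t, F t, η t, H)) '' Icc 0 X) := by
    apply isCompact_Icc.image_of_continuousOn
    intro t ht
    exact (continuousAt_id.prodMk ((hleaf t ht).deriv_height.continuousAt.prodMk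
      ((hleaf t ht).deriv_rapidity.continuousAt.prodMk continuousAt_const))).continuousWithinAt
  obtain ⟨δ, hδ, htaylor⟩ := ODEOn.exists_uniform_taylor (isOpen_phaseSpace M)
    ((contDiffOn_phaseField hM).of_le (by simp)) hKc
    (by rintro _ ⟨t, ht, rfl⟩; exact (hleaf t ht).mem) hε0
  refine ⟨min (ε₀ / (1 + L)) (δ / C₁), by positivity, fun T' H' hT' hTε hH' hHL => ?_⟩
  set Δ := T' - T₀ with hΔ
  have hΔ0 : 0 < Δ := sub_pos.2 hT'
  have hΔ1 : Δ * (1 + L) < ε₀ := by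
    rw [← lt_div_iff₀ (by positivity)]
    linarith [min_le_left (ε₀ / (1 + L)) (δ / C₁)]
  have hΔ2 : C₁ * Δ < δ := by
    rw [mul_comm, ← lt_div_iff₀ (by positivity)]
    linarith [min_le_right (ε₀ / (1 + L)) (δ / C₁)]
  have hLΔ : 0 ≤ L * Δ := by positivity
  have habsT : |T' - T₀| = Δ := abs_of_pos hΔ0
  have habsH : |H' - H| = H' - H := abs_of_nonneg (sub_nonneg.2 hH')
  obtain ⟨hXd, hclose⟩ := hnear T' H' (by rw [habsT]; linarith) (by rw [habsH]; linarith)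
  refine ⟨hXd, ?_⟩
  have hleaf' : ∀ t ∈ Icc 0 X, LeafAt M H' (height M H' T') (rapidity M H' T') t := fun t ht =>
    leafAt_of_mem hM (uIcc_subset_leafDom hXd hX0 ht)
  have hmax : C * max |T' - T₀| |H' - H| ≤ C₁ * Δ := by
    have h1 : max |T' - T₀| |H' - H| ≤ (1 + L) * Δ := by
      rw [habsT, habsH]
      exact max_le (by linarith) (by linarith)
    calc C * max |T' - T₀| |H' - H| ≤ C * ((1 + L) * Δ) := by gcongr
      _ ≤ C₁ * Δ := by rw [hC₁]; nlinarith [mul_nonneg (by positivity : 0 ≤ 1 + L) hΔ0.le]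
  set F' := height M H' T' with hF'
  set η' := rapidity M H' T' with hη'
  set u : ℝ → ℝ := fun t => F' t - F t with hu
  set v : ℝ → ℝ := fun t => η' t - η t with hv
  -- `ε₁` and `ε₂` are the residuals of the differences in the linearized system, controlled by the
  -- uniform Taylor estimate.
  set ε₁ : ℝ → ℝ := fun t =>
    sinh (η' t) / cosh (η' t) - sinh (η t) / cosh (η t) - v t / cosh (η t) ^ 2 with hε₁
  set ε₂ : ℝ → ℝ := fun t =>
    accel M H' t (F' t) (η' t) - accel M H t (F t) (η t) - (accelT M H F η t * u t
      + accelη M H F η t * v t + 3 * scale M (sep F t) / cosh (η t) * (H' - H)) with hε₂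
  have hres : ∀ t ∈ Icc 0 X, |ε₁ t| ≤ ε * (C₁ * Δ) ∧ |ε₂ t| ≤ ε * (C₁ * Δ) := by
    intro t ht
    have hcl := hclose t (by rw [abs_of_nonneg ht.1, abs_of_nonneg hX0]; exact ht.2)
    have hd : dist (t, F' t, η' t, H') (t, F t, η t, H) ≤ C₁ * Δ := by
      simp only [Prod.dist_eq, Real.dist_eq, sub_self, abs_zero]
      refine max_le (by positivity) (max_le (hcl.1.trans hmax) (max_le (hcl.2.trans hmax) ?_))
      rw [habsH, hC₁]
      nlinarith [mul_nonneg hC.le hΔ0.le, mul_nonneg hC.le hLΔ]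
    have h1 := htaylor _ ⟨t, ht, rfl⟩ (t, F' t, η' t, H') (hd.trans_lt hΔ2)
    have h2 : ((t, F' t, η' t, H') : ℝ × ℝ × ℝ × ℝ) - (t, F t, η t, H)
        = (0, u t, v t, H' - H) := by simp [hu, hv]
    rw [dist_eq_norm] at hd
    have h3 := h1.trans (mul_le_mul_of_nonneg_left hd hε0.le)
    simp only [h2, (hleaf t ht).fderiv_phaseField hM, phaseField] at h3
    simp only [Prod.mk_sub_mk, Prod.norm_def, Real.norm_eq_abs, max_le_iff] at h3
    exact ⟨h3.2.1, h3.2.2.1⟩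
  have hdu : ∀ t ∈ Icc 0 X, HasDerivAt u (v t / cosh (η t) ^ 2 + ε₁ t) t := fun t ht =>
    ((hleaf' t ht).deriv_height.sub (hleaf t ht).deriv_height).congr_deriv (by
      simp only [hε₁]; ring)
  have hdv : ∀ t ∈ Icc 0 X, HasDerivAt v (accelT M H F η t * u t + accelη M H F η t * v t
      + 3 * scale M (sep F t) / cosh (η t) * (H' - H) + ε₂ t) t := fun t ht =>
    ((hleaf' t ht).deriv_rapidity.sub (hleaf t ht).deriv_rapidity).congr_deriv (by
      simp only [hε₂]; ring)
  have hT'2 := sq_lt_of_mem_leafDom hXd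
  -- Both curves cross the axis orthogonally, so the normal flux starts at zero, and the source 3(H'
  -- - H) is nonnegative.
  have hpos := pos_of_cooperative (b := X) (K := B) (e := B * (ε * (C₁ * Δ)))
    (φ := normalVar M F η u) (ζ := normalFlux M H F η u v)
    (k := fun t => scale M (sep F t) / cosh (η t) / rho M (sep F t) ^ 2)
    (κ := fun t => rho M (sep F t) ^ 2 * scale M (sep F t) / cosh (η t) * secondFormSq M H F η t)
    (g := fun t => rho M (sep F t) ^ 2 * scale M (sep F t) / cosh (η t) * (3 * (H' - H)))
    (e₁ := fun t => scale M (sep F t) * cosh (η t) * ε₁ t)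
    (e₂ := fun t => rho M (sep F t) ^ 2 * (tilt M H F η t * ε₁ t + ε₂ t))
    hB0.le (by positivity)
    (fun t ht => (hleaf t ht).hasDerivAt_normalVar hM (hdu t ht))
    (fun t ht => ((hleaf t ht).hasDerivAt_normalFlux hM (hdu t ht) (hdv t ht)).congr_deriv
      (by ring))
    (fun t ht => ⟨by have := hs t ht; have := cosh_pos (η t); positivity, (hB' t ht).2.1⟩)
    (fun t ht => by
      have := hs t ht
      have := cosh_pos (η t)
      unfold secondFormSq
      positivity)
    (fun t ht => by
      have := hs t ht
      have := cosh_pos (η t)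
      have : 0 ≤ H' - H := sub_nonneg.2 hH'
      positivity)
    (fun t ht => by
      have h1 := hs t ht
      have h2 := cosh_pos (η t)
      rw [abs_mul, abs_of_pos (mul_pos h1 h2)]
      exact mul_le_mul (hB' t ht).1 (hres t ht).1 (abs_nonneg _) hB0.le)
    (fun t ht => by
      have h1 : |tilt M H F η t * ε₁ t + ε₂ t| ≤ (|tilt M H F η t| + 1) * (ε * (C₁ * Δ)) := by
        refine (abs_add_le _ _).trans ?_
        rw [abs_mul, add_mul, one_mul]
        exact add_le_add (mul_le_mul_of_nonneg_left (hres t ht).1 (abs_nonneg _)) (hres t ht).2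
      rw [abs_mul, abs_of_nonneg (sq_nonneg (rho M (sep F t)))]
      calc _ ≤ rho M (sep F t) ^ 2 * ((|tilt M H F η t| + 1) * (ε * (C₁ * Δ))) := by gcongr
        _ = rho M (sep F t) ^ 2 * (|tilt M H F η t| + 1) * (ε * (C₁ * Δ)) := by ring
        _ ≤ B * (ε * (C₁ * Δ)) := mul_le_mul_of_nonneg_right (hB' t ht).2.2 (by positivity))
    (by
      simp [normalFlux, tilt, hu, hv, hF, hF', hη, hη', height_zero_eq hM _ hT,
        height_zero_eq hM _ hT'2, rapidity_zero_eq hM _ hT, rapidity_zero_eq hM _ hT'2, tang])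
    (by
      have h1 : normalVar M F η u 0 = a * Δ := by
        simp only [normalVar, hu, hF, hF', hη, height_zero_eq hM _ hT, height_zero_eq hM _ hT'2,
          rapidity_zero_eq hM _ hT, cosh_zero, ha, hΔ, mul_one]
      rw [h1]
      have h2 : B * (ε * (C₁ * Δ)) * (1 + B * X) * X = ε * W * Δ := by rw [hW]; ring
      rw [h2]
      exact mul_lt_mul_of_pos_right hεW hΔ0)
    X ⟨hX0, le_rfl⟩
  unfold normalVar at hpos
  have h1 := mul_pos (hs X ⟨hX0, le_rfl⟩) (cosh_pos (η X))
  have h2 := pos_of_mul_pos_right hpos h1.le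
  exact sub_pos.1 h2

end

end Kruskal

/-! ### Foliation by profile curves -/

namespace Kruskal

open Set Filter Topology Real

/-- A continuous function that is locally increasing to the right of every point is increasing. -/
theorem lt_of_forall_eventually_lt {f : ℝ → ℝ} {a b : ℝ} (hab : a < b)
    (hf : ContinuousOn f (Icc a b)) (h : ∀ x ∈ Ico a b, ∀ᶠ y in 𝓝[>] x, f x < f y) :
    f a < f b := by
  -- One step to the right secures the strict inequality; from `c` onwards only the closed condition
  -- `f c ≤ f t` is propagated.
  obtain ⟨c, hfc, hc⟩ := ((h a ⟨le_rfl, hab⟩).and (Ioc_mem_nhdsGT hab)).exists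
  refine hfc.trans_le ?_
  have hsub : Icc c b ⊆ {t | f c ≤ f t} := by
    refine IsClosed.Icc_subset_of_forall_mem_nhdsWithin ?_ (le_refl (f c)) ?_
    · rw [inter_comm]
      exact (hf.mono (Icc_subset_Icc_left hc.1.le)).preimage_isClosed_of_isClosed isClosed_Icc
        isClosed_Ici
    · rintro x ⟨hx, hxc⟩
      filter_upwards [h x ⟨hc.1.le.trans hxc.1, hxc.2⟩] with y hy
      exact le_trans hx hy.le
  exact hsub ⟨hc.2, le_rfl⟩

/-- The growth of the radius along a profile curve is decided on the axis. -/
theorem nonneg_of_cooperative {b C : ℝ} {z e k κ : ℝ → ℝ}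
    (hz : ∀ t ∈ Icc 0 b, HasDerivAt z (k t * e t) t)
    (he : ∀ t ∈ Icc 0 b, HasDerivAt e (κ t * z t) t)
    (hk : ∀ t ∈ Icc 0 b, 0 ≤ k t ∧ k t ≤ C) (hκ : ∀ t ∈ Icc 0 b, 0 ≤ κ t ∧ κ t ≤ C)
    (hz0 : z 0 = 0) (he0 : 0 ≤ e 0) : ∀ t ∈ Icc 0 b, 0 ≤ z t := by
  intro t₁ ht₁
  have h0 : (0 : ℝ) ∈ Icc 0 b := ⟨le_rfl, ht₁.1.trans ht₁.2⟩
  have hC : 0 ≤ C := (hk 0 h0).1.trans (hk 0 h0).2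
  rcases he0.eq_or_lt with h | h
  -- If both components vanish at 0, Gronwall's argument for `z ^ 2 + e ^ 2` shows that they vanish
  -- identically.
  · set y : ℝ → ℝ := fun t => (z t ^ 2 + e t ^ 2) * exp (-(2 * C) * t) with hy
    have hd : ∀ t ∈ Icc 0 b, HasDerivAt y
        ((2 * (k t + κ t) * (z t * e t) - 2 * C * (z t ^ 2 + e t ^ 2)) * exp (-(2 * C) * t)) t := by
      intro t ht
      have h1 := (((hz t ht).pow 2).add ((he t ht).pow 2)).mul
        (((hasDerivAt_id t).const_mul (-(2 * C))).exp)
      refine h1.congr_deriv ?_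
      simp
      ring
    have hm : AntitoneOn y (Icc 0 b) := by
      apply antitoneOn_of_deriv_nonpos (convex_Icc 0 b)
        (fun t ht => (hd t ht).continuousAt.continuousWithinAt)
        (fun t ht => (hd t (interior_subset ht)).differentiableAt.differentiableWithinAt)
      intro t ht
      have ht' := interior_subset ht
      rw [(hd t ht').deriv]
      refine mul_nonpos_of_nonpos_of_nonneg ?_ (exp_pos _).le
      have h1 : 2 * |z t * e t| ≤ z t ^ 2 + e t ^ 2 := by
        rw [abs_mul]
        nlinarith [sq_nonneg (|z t| - |e t|), sq_abs (z t), sq_abs (e t)]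
      have h2 := (hk t ht')
      have h3 := (hκ t ht')
      have h4 : (k t + κ t) * (z t * e t) ≤ (k t + κ t) * |z t * e t| :=
        mul_le_mul_of_nonneg_left (le_abs_self _) (by linarith)
      have h5 : (k t + κ t) * |z t * e t| ≤ (2 * C) * |z t * e t| :=
        mul_le_mul_of_nonneg_right (by linarith) (abs_nonneg _)
      nlinarith
    have h1 := hm h0 ht₁ ht₁.1
    have h2 : y 0 = 0 := by simp [hy, hz0, ← h]
    rw [h2] at h1
    have h3 : z t₁ ^ 2 + e t₁ ^ 2 ≤ 0 := by
      by_contra! hcon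
      exact absurd h1 (not_le.2 (mul_pos hcon (exp_pos _)))
    have h4 : z t₁ = 0 := by nlinarith [sq_nonneg (z t₁), sq_nonneg (e t₁)]
    exact h4.ge
  -- If `e 0 > 0` the roles are exchanged: `e` is the component kept positive, and then `z` is
  -- nondecreasing.
  · have hpos := pos_of_cooperative (b := b) (K := C) (e := 0) (φ := e) (ζ := z) (k := κ) (κ := k)
      (g := fun _ => 0) (e₁ := fun _ => 0) (e₂ := fun _ => 0) hC le_rfl
      (fun t ht => by simpa using he t ht) (fun t ht => by simpa using hz t ht) hκ
      (fun t ht => (hk t ht).1) (fun _ _ => le_rfl) (by simp) (by simp) hz0.ge (by simpa using h)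
    have hm : MonotoneOn z (Icc 0 b) := by
      apply monotoneOn_of_deriv_nonneg (convex_Icc 0 b)
        (fun t ht => (hz t ht).continuousAt.continuousWithinAt)
        (fun t ht => (hz t (interior_subset ht)).differentiableAt.differentiableWithinAt)
      intro t ht
      rw [(hz t (interior_subset ht)).deriv]
      exact mul_nonneg (hk t (interior_subset ht)).1 (hpos t (interior_subset ht)).le
    rw [← hz0]
    exact hm h0 ht₁ ht₁.1

/-! ### Monotonicity of the radius along a profile curve -/

section

variable {M H T₀ : ℝ}

/-- The value of `radialForce` on the axis. -/
def centralForce (M H T₀ : ℝ) : ℝ :=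
  -(3 * H * rho M (-T₀ ^ 2) ^ 2 * scale M (-T₀ ^ 2) * T₀ / (4 * M)) - 3 * M
    + 2 * rho M (-T₀ ^ 2)

theorem radialForce_zero (hM : 0 < M) (hT : T₀ ^ 2 < 2 * M) :
    radialForce M H (height M H T₀) (rapidity M H T₀) 0 = centralForce M H T₀ := by
  simp only [radialForce, sep, nrml, height_zero_eq hM H hT, rapidity_zero_eq hM H hT,
    centralForce, sinh_zero, cosh_zero]
  ring_nf

theorem radialFlux_zero (hM : 0 < M) (hT : T₀ ^ 2 < 2 * M) :
    radialFlux M (height M H T₀) (rapidity M H T₀) 0 = 0 := by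
  simp [radialFlux, tang, rapidity_zero_eq hM H hT]

theorem sep_zero (hM : 0 < M) (hT : T₀ ^ 2 < 2 * M) : sep (height M H T₀) 0 = -T₀ ^ 2 := by
  simp [sep, height_zero_eq hM H hT]

theorem exists_flux_bounds (hM : 0 < M) {X : ℝ} (hX : X ∈ leafDom M H T₀) (hX0 : 0 ≤ X) :
    ∃ C, ∀ t ∈ Icc 0 X,
      (0 ≤ scale M (sep (height M H T₀) t) / cosh (rapidity M H T₀ t) ∧
        scale M (sep (height M H T₀) t) / cosh (rapidity M H T₀ t) ≤ C) ∧
      (0 ≤ scale M (sep (height M H T₀) t) / cosh (rapidity M H T₀ t) *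
          (9 * H ^ 2 + 2 / rho M (sep (height M H T₀) t) ^ 2) ∧
        scale M (sep (height M H T₀) t) / cosh (rapidity M H T₀ t) *
          (9 * H ^ 2 + 2 / rho M (sep (height M H T₀) t) ^ 2) ≤ C) := by
  have hleaf : ∀ t ∈ Icc 0 X, LeafAt M H (height M H T₀) (rapidity M H T₀) t := fun t ht =>
    leafAt_of_mem hM (uIcc_subset_leafDom hX hX0 ht)
  set F := height M H T₀
  set η := rapidity M H T₀
  have hcont : ContinuousOn (fun t => scale M (sep F t) / cosh (η t) +
      scale M (sep F t) / cosh (η t) * (9 * H ^ 2 + 2 / rho M (sep F t) ^ 2)) (Icc 0 X) := by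
    intro t ht
    obtain ⟨h1, h2, h3, -⟩ := (hleaf t ht).continuousAt_coeffs hM
    have h4 := h1.div h2 (cosh_pos _).ne'
    have hr := (rho_pos hM (w := sep F t) (hleaf t ht).mem).ne'
    exact (h4.add (h4.mul (continuousAt_const.add (continuousAt_const.div (h3.pow 2)
      (pow_ne_zero 2 hr))))).continuousWithinAt
  obtain ⟨C, hC⟩ := isCompact_Icc.bddAbove_image hcont
  refine ⟨C, fun t ht => ?_⟩
  have h1 := hC ⟨t, ht, rfl⟩
  have h2 := scale_pos hM (w := sep F t) (hleaf t ht).mem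
  have h3 := rho_pos hM (w := sep F t) (hleaf t ht).mem
  have h4 := cosh_pos (η t)
  have h5 : 0 ≤ scale M (sep F t) / cosh (η t) := by positivity
  have h6 : 0 ≤ scale M (sep F t) / cosh (η t) * (9 * H ^ 2 + 2 / rho M (sep F t) ^ 2) := by
    positivity
  simp only at h1
  exact ⟨⟨h5, by linarith⟩, h6, by linarith⟩

theorem tang_nonneg_of_radialFlux (hM : 0 < M) {F η : ℝ → ℝ} {t : ℝ} (h : LeafAt M H F η t)
    (hf : 0 ≤ radialFlux M F η t) : 0 ≤ tang F η t := by
  have h2 := scale_pos hM (w := sep F t) h.mem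
  have h3 := rho_pos hM (w := sep F t) h.mem
  have h4 : radialFlux M F η t = rho M (sep F t) ^ 2 * scale M (sep F t) / (4 * M) * tang F η t := by
    unfold radialFlux
    ring
  rw [h4] at hf
  exact nonneg_of_mul_nonneg_right hf (by positivity)

theorem tang_nonpos_of_radialFlux (hM : 0 < M) {F η : ℝ → ℝ} {t : ℝ} (h : LeafAt M H F η t)
    (hf : radialFlux M F η t ≤ 0) : tang F η t ≤ 0 := by
  have h2 := scale_pos hM (w := sep F t) h.mem
  have h3 := rho_pos hM (w := sep F t) h.mem
  have h4 : radialFlux M F η t = rho M (sep F t) ^ 2 * scale M (sep F t) / (4 * M) * tang F η t := by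
    unfold radialFlux
    ring
  rw [h4] at hf
  exact nonpos_of_mul_nonpos_right hf (by positivity)

/-- The flux r² ṙ vanishes on the axis, so the force there decides its sign for X ≥ 0, and X² - T²
is increasing as a function of r. -/
theorem monotoneOn_sep (hM : 0 < M) {X : ℝ} (hX : X ∈ leafDom M H T₀) (hX0 : 0 ≤ X)
    (hf : 0 ≤ centralForce M H T₀) : MonotoneOn (sep (height M H T₀)) (Icc 0 X) := by
  have hT := sq_lt_of_mem_leafDom hX
  have hleaf : ∀ t ∈ Icc 0 X, LeafAt M H (height M H T₀) (rapidity M H T₀) t := fun t ht =>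
    leafAt_of_mem hM (uIcc_subset_leafDom hX hX0 ht)
  obtain ⟨C, hC⟩ := exists_flux_bounds hM hX hX0
  have hz := nonneg_of_cooperative (fun t ht => (hleaf t ht).hasDerivAt_radialFlux hM)
    (fun t ht => (hleaf t ht).hasDerivAt_radialForce hM) (fun t ht => (hC t ht).1)
    (fun t ht => (hC t ht).2) (radialFlux_zero hM hT) (by rw [radialForce_zero hM hT]; exact hf)
  apply monotoneOn_of_deriv_nonneg (convex_Icc 0 X)
    (fun t ht => (hleaf t ht).hasDerivAt_sep.continuousAt.continuousWithinAt)
    (fun t ht => (hleaf t (interior_subset ht)).hasDerivAt_sep.differentiableAt.differentiableWithinAt)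
  intro t ht
  have ht' := interior_subset ht
  rw [(hleaf t ht').hasDerivAt_sep.deriv]
  have := tang_nonneg_of_radialFlux hM (hleaf t ht') (hz t ht')
  have := cosh_pos (rapidity M H T₀ t)
  positivity

theorem antitoneOn_sep (hM : 0 < M) {X : ℝ} (hX : X ∈ leafDom M H T₀) (hX0 : 0 ≤ X)
    (hf : centralForce M H T₀ ≤ 0) : AntitoneOn (sep (height M H T₀)) (Icc 0 X) := by
  have hT := sq_lt_of_mem_leafDom hX
  have hleaf : ∀ t ∈ Icc 0 X, LeafAt M H (height M H T₀) (rapidity M H T₀) t := fun t ht =>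
    leafAt_of_mem hM (uIcc_subset_leafDom hX hX0 ht)
  obtain ⟨C, hC⟩ := exists_flux_bounds hM hX hX0
  have hz := nonneg_of_cooperative (z := fun t => -radialFlux M (height M H T₀) (rapidity M H T₀) t)
    (e := fun t => -radialForce M H (height M H T₀) (rapidity M H T₀) t)
    (fun t ht => ((hleaf t ht).hasDerivAt_radialFlux hM).neg.congr_deriv (by ring))
    (fun t ht => ((hleaf t ht).hasDerivAt_radialForce hM).neg.congr_deriv (by ring))
    (fun t ht => (hC t ht).1)
    (fun t ht => (hC t ht).2) (by rw [radialFlux_zero hM hT, neg_zero])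
    (by rw [radialForce_zero hM hT]; linarith)
  apply antitoneOn_of_deriv_nonpos (convex_Icc 0 X)
    (fun t ht => (hleaf t ht).hasDerivAt_sep.continuousAt.continuousWithinAt)
    (fun t ht => (hleaf t (interior_subset ht)).hasDerivAt_sep.differentiableAt.differentiableWithinAt)
  intro t ht
  have ht' := interior_subset ht
  rw [(hleaf t ht').hasDerivAt_sep.deriv]
  have h1 := tang_nonpos_of_radialFlux hM (hleaf t ht') (by linarith [hz t ht'])
  exact div_nonpos_of_nonpos_of_nonneg (by linarith) (cosh_pos _).le

/-- The least abscissa missing from the domain would satisfy the hypotheses of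
`mem_leafDom_of_forall_lt`; so the bound is needed only where the curve exists. -/
theorem mem_leafDom_of_sep_bound (hM : 0 < M) (hT : T₀ ^ 2 < 2 * M) {X δ : ℝ} (hX : 0 ≤ X)
    (hδ : 0 < δ) (hsep : ∀ t ∈ Ico 0 X, t ∈ leafDom M H T₀ →
      -(2 * M) + δ ≤ sep (height M H T₀) t) : X ∈ leafDom M H T₀ := by
  by_contra hcon
  have hc : IsCompact (Icc 0 X ∩ (leafDom M H T₀)ᶜ) :=
    isCompact_Icc.inter_right (isOpen_leafDom M H T₀).isClosed_compl
  obtain ⟨t, ⟨ht, htd⟩, hleast⟩ := hc.exists_isLeast ⟨X, ⟨hX, le_rfl⟩, hcon⟩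
  have ht0 : 0 < t := by
    rcases ht.1.eq_or_lt with h | h
    · exact absurd (h ▸ zero_mem_leafDom hM H hT) htd
    · exact h
  have hdom : ∀ s ∈ Ico 0 t, s ∈ leafDom M H T₀ := by
    intro s hs
    by_contra hsd
    exact absurd (hleast ⟨⟨hs.1, hs.2.le.trans ht.2⟩, hsd⟩) (not_le.2 hs.2)
  exact htd (mem_leafDom_of_forall_lt hM hT ht0 hδ hdom fun s hs =>
    hsep s ⟨hs.1, hs.2.trans_le ht.2⟩ (hdom s hs))

/-- Close to the singularity r ≤ 3M/2, hence 2r - 3M ≤ 0, and above the X-axis the curvature term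
has the same sign. -/
theorem centralForce_nonpos (hM : 0 < M) (hT : T₀ ^ 2 < 2 * M) (hT0 : 0 ≤ T₀) (hH : 0 ≤ H)
    (hr : -T₀ ^ 2 ≤ profile M (3 * M / 2)) : centralForce M H T₀ ≤ 0 := by
  have hw : -(2 * M) < -T₀ ^ 2 := by linarith
  have h1 := rho_le_rho hM hw hr
  rw [rho_profile hM (by linarith)] at h1
  have h2 := scale_pos hM hw
  have h3 := rho_pos hM hw
  have h4 : 0 ≤ 3 * H * rho M (-T₀ ^ 2) ^ 2 * scale M (-T₀ ^ 2) * T₀ / (4 * M) := by positivity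
  unfold centralForce
  linarith

end

/-! ### Order and covering for an admissible choice of mean curvatures -/

/-- Mean curvatures, as a function of the initial height, whose profile curves foliate. -/
structure Admissible (M : ℝ) (h : ℝ → ℝ) : Prop where
  odd : ∀ τ, h (-τ) = -h τ
  mono : ∀ τ τ', 0 ≤ τ → τ ≤ τ' → τ' ^ 2 < 2 * M → h τ ≤ h τ'
  differentiableAt : ∀ τ, τ ^ 2 < 2 * M → DifferentiableAt ℝ h τ

section

variable {M : ℝ} {h : ℝ → ℝ}

theorem Admissible.zero (hh : Admissible M h) : h 0 = 0 := by
  have := hh.odd 0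
  rw [neg_zero] at this
  linarith

theorem Admissible.nonneg (hh : Admissible M h) {τ : ℝ} (hτ0 : 0 ≤ τ) (hτ : τ ^ 2 < 2 * M) :
    0 ≤ h τ := by
  rw [← hh.zero]
  exact hh.mono 0 τ le_rfl hτ0 hτ

theorem Admissible.tendsto_aux (hh : Admissible M h) {τ ε : ℝ} (hτ : τ ^ 2 < 2 * M) (hε : 0 < ε) :
    ∀ᶠ τ' in 𝓝 τ, |τ' - τ| < ε ∧ |h τ' - h τ| < ε := by
  have h1 : ∀ᶠ τ' in 𝓝 τ, |τ' - τ| < ε := by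
    simpa [Real.dist_eq] using Metric.tendsto_nhds.1 (tendsto_id (x := 𝓝 τ)) ε hε
  exact h1.and (by simpa [Real.dist_eq] using
    Metric.tendsto_nhds.1 (hh.differentiableAt τ hτ).continuousAt ε hε)

theorem Admissible.eventually_mem (hh : Admissible M h) (hM : 0 < M) {τ X : ℝ}
    (hX : X ∈ leafDom M (h τ) τ) : ∀ᶠ τ' in 𝓝 τ, X ∈ leafDom M (h τ') τ' := by
  obtain ⟨C, hC, ε, hε, hn⟩ := exists_leaf_near hM hX
  filter_upwards [hh.tendsto_aux (sq_lt_of_mem_leafDom hX) hε] with τ' hτ'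
  exact (hn τ' (h τ') hτ'.1 hτ'.2).1

theorem Admissible.continuousAt_height (hh : Admissible M h) (hM : 0 < M) {τ X : ℝ}
    (hX : X ∈ leafDom M (h τ) τ) : ContinuousAt (fun τ => height M (h τ) τ X) τ := by
  obtain ⟨C, hC, ε, hε, hn⟩ := exists_leaf_near hM hX
  rw [ContinuousAt, Metric.tendsto_nhds]
  intro ε' hε'
  have hτ2 := sq_lt_of_mem_leafDom hX
  filter_upwards [hh.tendsto_aux hτ2 hε, hh.tendsto_aux hτ2 (div_pos hε' hC)] with τ' h1 h2
  refine ((hn τ' (h τ') h1.1 h1.2).2 X le_rfl).1.trans_lt ?_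
  rw [mul_comm, ← lt_div_iff₀ hC]
  exact max_lt h2.1 h2.2

/-- Differentiability of `h` supplies the constant `L` of `exists_height_lt`, and monotonicity
supplies H ≤ H'. -/
theorem Admissible.eventually_lt (hh : Admissible M h) (hM : 0 < M) {τ X : ℝ} (hτ0 : 0 ≤ τ)
    (hX : X ∈ leafDom M (h τ) τ) (hX0 : 0 ≤ X) :
    ∀ᶠ τ' in 𝓝[>] τ, height M (h τ) τ X < height M (h τ') τ' X := by
  have hτ := sq_lt_of_mem_leafDom hX
  obtain ⟨L, hL0, hL⟩ := ((hh.differentiableAt τ hτ).isBigO_sub).exists_nonneg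
  obtain ⟨ε, hε, he⟩ := exists_height_lt hM hX hX0 hL0
  have h1 : ∀ᶠ τ' in 𝓝 τ, τ' ^ 2 < 2 * M :=
    (continuous_pow 2).continuousAt.eventually (gt_mem_nhds hτ)
  filter_upwards [self_mem_nhdsWithin, mem_nhdsWithin_of_mem_nhds hL.bound,
    mem_nhdsWithin_of_mem_nhds h1, mem_nhdsWithin_of_mem_nhds (gt_mem_nhds (lt_add_of_pos_right τ hε))]
    with τ' h2 h3 h4 h5
  have h6 : 0 < τ' - τ := sub_pos.2 h2
  rw [Real.norm_eq_abs, Real.norm_eq_abs, abs_of_pos h6] at h3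
  exact (he τ' (h τ') h2 h5 (hh.mono τ τ' hτ0 (le_of_lt h2) h4) ((le_abs_self _).trans h3)).2

theorem Admissible.height_lt_of_forall (hh : Admissible M h) (hM : 0 < M) {τ₁ τ₂ X : ℝ}
    (hτ0 : 0 ≤ τ₁) (hτ : τ₁ < τ₂) (hX0 : 0 ≤ X)
    (hX : ∀ τ ∈ Icc τ₁ τ₂, X ∈ leafDom M (h τ) τ) :
    height M (h τ₁) τ₁ X < height M (h τ₂) τ₂ X :=
  lt_of_forall_eventually_lt (f := fun τ => height M (h τ) τ X) hτ
    (fun τ ht => (hh.continuousAt_height hM (hX τ ht)).continuousWithinAt)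
    (fun τ ht => hh.eventually_lt hM (hτ0.trans ht.1) (hX τ (Ico_subset_Icc_self ht)) hX0)

theorem Admissible.height_le_of_forall (hh : Admissible M h) (hM : 0 < M) {τ₁ τ₂ X : ℝ}
    (hτ0 : 0 ≤ τ₁) (hτ : τ₁ ≤ τ₂) (hX0 : 0 ≤ X)
    (hX : ∀ τ ∈ Icc τ₁ τ₂, X ∈ leafDom M (h τ) τ) :
    height M (h τ₁) τ₁ X ≤ height M (h τ₂) τ₂ X := by
  rcases hτ.eq_or_lt with rfl | h1
  · exact le_rfl
  · exact (hh.height_lt_of_forall hM hτ0 h1 hX0 hX).le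

/-- Existence up to a slightly larger abscissa persists for nearby τ, and domains are symmetric
intervals. This joint openness permits a compactness argument in τ. -/
theorem Admissible.eventually_mem_prod (hh : Admissible M h) (hM : 0 < M) {τ X : ℝ}
    (hX : X ∈ leafDom M (h τ) τ) : ∀ᶠ p : ℝ × ℝ in 𝓝 (X, τ), p.1 ∈ leafDom M (h p.2) p.2 := by
  obtain ⟨b, F, η, hb, hl⟩ := hX
  obtain ⟨c, hXc, hcb⟩ := exists_between hb
  have hc : |c| = c := abs_of_pos ((abs_nonneg X).trans_lt hXc)
  have h1 := hh.eventually_mem hM (X := c) ⟨b, F, η, by rwa [hc], hl⟩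
  rw [nhds_prod_eq]
  filter_upwards [(continuous_abs.continuousAt.eventually (gt_mem_nhds hXc)).prod_mk h1] with p hp
  exact mem_leafDom_of_abs_le hp.2 (by rw [hc]; exact le_of_lt hp.1)

/-- The domains of the upper profile curves shrink. -/
theorem Admissible.mem_of_le (hh : Admissible M h) (hM : 0 < M) {τ₂ X : ℝ}
    (hX : X ∈ leafDom M (h τ₂) τ₂) (hX0 : 0 ≤ X) {τ : ℝ} (hτ : τ ∈ Icc 0 τ₂) :
    X ∈ leafDom M (h τ) τ := by
  set s : Set ℝ := {t | ∀ τ ∈ Icc 0 τ₂, t ∈ leafDom M (h τ) τ} with hs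
  have hτ₂ := sq_lt_of_mem_leafDom hX
  have hsq : ∀ τ ∈ Icc 0 τ₂, τ ^ 2 < 2 * M := fun τ hτ =>
    (pow_le_pow_left₀ hτ.1 hτ.2 2).trans_lt hτ₂
  have hso : IsOpen s := by
    rw [isOpen_iff_eventually]
    intro t ht
    exact isCompact_Icc.eventually_forall_of_forall_eventually fun τ hτ =>
      hh.eventually_mem_prod hM (ht τ hτ)
  suffices hXs : X ∈ s from hXs τ hτ
  by_contra hcon
  -- `t` is the first abscissa at which some curve of height between 0 and `τ₂` is missing.
  obtain ⟨t, ⟨ht, hts⟩, hleast⟩ := (isCompact_Icc.inter_right hso.isClosed_compl).exists_isLeast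
    (⟨X, ⟨hX0, le_rfl⟩, hcon⟩ : (Icc 0 X ∩ sᶜ).Nonempty)
  have ht0 : 0 < t := by
    rcases ht.1.eq_or_lt with h0 | h0
    · exact absurd (fun τ hτ => h0 ▸ zero_mem_leafDom hM _ (hsq τ hτ)) hts
    · exact h0
  have hlt : ∀ t' ∈ Ico 0 t, t' ∈ s := by
    intro t' ht'
    by_contra h'
    exact absurd (hleast ⟨⟨ht'.1, ht'.2.le.trans ht.2⟩, h'⟩) (not_le.2 ht'.2)
  have hdom : ∀ t' ∈ Icc 0 t, t' ∈ leafDom M (h τ₂) τ₂ := fun t' ht' =>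
    uIcc_subset_leafDom hX hX0 ⟨ht'.1, ht'.2.trans ht.2⟩
  obtain ⟨t₀, ht₀, hmin⟩ := isCompact_Icc.exists_isMinOn ⟨0, le_rfl, ht0.le⟩
    (f := sep (height M (h τ₂) τ₂)) (fun t' ht' =>
      (leafAt_of_mem hM (hdom t' ht')).hasDerivAt_sep.continuousAt.continuousWithinAt)
  have hδ : 0 < sep (height M (h τ₂) τ₂) t₀ + 2 * M := by
    have h1 : -(2 * M) < sep (height M (h τ₂) τ₂) t₀ := (leafAt_of_mem hM (hdom t₀ ht₀)).mem
    linarith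
  refine hts fun τ hτ => mem_leafDom_of_forall_lt hM (hsq τ hτ) ht0 hδ
    (fun t' ht' => hlt t' ht' τ hτ) fun t' ht' => ?_
  have h1 := hmin (Ico_subset_Icc_self ht')
  -- Left of `t` all curves exist and are ordered, so the curve of height `τ` lies between the
  -- X-axis and the top curve. Its X² - T² is thus at least that of the top curve, which is bounded
  -- away from -2M.
  have h2 := hh.height_le_of_forall hM le_rfl hτ.1 ht'.1
    fun τ' hτ' => hlt t' ht' τ' ⟨hτ'.1, hτ'.2.trans hτ.2⟩
  have h3 := hh.height_le_of_forall hM hτ.1 hτ.2 ht'.1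
    fun τ' hτ' => hlt t' ht' τ' ⟨hτ.1.trans hτ'.1, hτ'.2⟩
  rw [hh.zero, height_zero_zero hM] at h2
  have h4 : sep (height M (h τ₂) τ₂) t' ≤ sep (height M (h τ) τ) t' := by
    unfold sep
    linarith [pow_le_pow_left₀ h2 h3 2]
  have h5 : sep (height M (h τ₂) τ₂) t₀ ≤ sep (height M (h τ₂) τ₂) t' := h1
  linarith

theorem Admissible.height_lt_of_nonneg (hh : Admissible M h) (hM : 0 < M) {τ₁ τ₂ X : ℝ}
    (hτ0 : 0 ≤ τ₁) (hτ : τ₁ < τ₂) (hX0 : 0 ≤ X) (hX : X ∈ leafDom M (h τ₂) τ₂) :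
    height M (h τ₁) τ₁ X < height M (h τ₂) τ₂ X :=
  hh.height_lt_of_forall hM hτ0 hτ hX0 fun _ ht => hh.mem_of_le hM hX hX0 ⟨hτ0.trans ht.1, ht.2⟩

theorem Admissible.height_nonneg (hh : Admissible M h) (hM : 0 < M) {τ X : ℝ}
    (hτ0 : 0 ≤ τ) (hX0 : 0 ≤ X) (hX : X ∈ leafDom M (h τ) τ) : 0 ≤ height M (h τ) τ X := by
  have := hh.height_le_of_forall hM le_rfl hτ0 hX0 fun _ ht => hh.mem_of_le hM hX hX0 ht
  rwa [hh.zero, height_zero_zero hM] at this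

theorem Admissible.height_neg_param (hh : Admissible M h) (hM : 0 < M) {τ X : ℝ}
    (hX : X ∈ leafDom M (h τ) τ) : X ∈ leafDom M (h (-τ)) (-τ) ∧
      height M (h (-τ)) (-τ) X = -height M (h τ) τ X := by
  rw [hh.odd, leafDom_neg]
  exact ⟨hX, height_neg_neg hM hX⟩

/-- Different profile curves of the family are disjoint and ordered. -/
theorem Admissible.height_lt (hh : Admissible M h) (hM : 0 < M) {τ₁ τ₂ X : ℝ}
    (hτ : τ₁ < τ₂) (hX₁ : X ∈ leafDom M (h τ₁) τ₁) (hX₂ : X ∈ leafDom M (h τ₂) τ₂) :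
    height M (h τ₁) τ₁ X < height M (h τ₂) τ₂ X := by
  wlog hX0 : 0 ≤ X generalizing X
  · have h1 := this (X := -X) (mem_leafDom_of_abs_le hX₁ (by rw [abs_neg]))
      (mem_leafDom_of_abs_le hX₂ (by rw [abs_neg])) (by linarith)
    rwa [height_neg hM hX₁, height_neg hM hX₂] at h1
  rcases le_or_gt 0 τ₁ with h1 | h1
  · exact hh.height_lt_of_nonneg hM h1 hτ hX0 hX₂
  obtain ⟨hn1, he1⟩ := hh.height_neg_param hM hX₁
  obtain ⟨hn2, he2⟩ := hh.height_neg_param hM hX₂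
  rcases le_or_gt 0 τ₂ with h2 | h2
  · have h3 := hh.height_nonneg hM h2 hX0 hX₂
    have h4 := hh.height_lt_of_nonneg hM le_rfl (neg_pos.2 h1) hX0 hn1
    rw [hh.zero, height_zero_zero hM, he1] at h4
    linarith
  · have h3 := hh.height_lt_of_nonneg hM (neg_pos.2 h2).le (neg_lt_neg hτ) hX0 hn1
    rw [he1, he2] at h3
    linarith

theorem continuousAt_centralForce (hh : Admissible M h) (hM : 0 < M) {τ : ℝ}
    (hτ : τ ^ 2 < 2 * M) : ContinuousAt (fun τ => centralForce M (h τ) τ) τ := by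
  have hw : -(2 * M) < -τ ^ 2 := by linarith
  have h0 : ContinuousAt (fun τ : ℝ => -τ ^ 2) τ := by fun_prop
  have h1 : ContinuousAt (fun τ => rho M (-τ ^ 2)) τ :=
    ContinuousAt.comp (f := fun τ : ℝ => -τ ^ 2) (contDiffAt_rho hM hw).continuousAt h0
  have h2 : ContinuousAt (fun τ => scale M (-τ ^ 2)) τ :=
    ContinuousAt.comp (f := fun τ : ℝ => -τ ^ 2) (contDiffAt_scale hM hw).continuousAt h0
  have h3 := (hh.differentiableAt τ hτ).continuousAt
  unfold centralForce
  exact (((((((continuousAt_const.mul h3).mul (h1.pow 2)).mul h2).mul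
    continuousAt_id).div_const _).neg).sub continuousAt_const).add (continuousAt_const.mul h1)

/-- Otherwise every curve with τ ≥ 0 reaching X has X² - T² > w there. Let σ be the supremum of the
heights of these curves. If σ² < 2M, the curve of height σ fails to reach X because its radius
falls; nearby curves fall below w too and cannot recover, as r is monotone. If σ² ≥ 2M, nearby
curves start close to the singularity and their radius never grows. -/
theorem Admissible.exists_height_ge (hh : Admissible M h) (hM : 0 < M) {X T : ℝ} (hX : 0 ≤ X)
    (hTX : -(2 * M) < X ^ 2 - T ^ 2) :
    ∃ τ, 0 ≤ τ ∧ X ∈ leafDom M (h τ) τ ∧ T ≤ height M (h τ) τ X := by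
  by_contra! hcon
  set w := X ^ 2 - T ^ 2 with hw
  have hsep : ∀ τ, 0 ≤ τ → X ∈ leafDom M (h τ) τ → w < sep (height M (h τ) τ) X := by
    intro τ h0 h1
    have h2 := hcon τ h0 h1
    have h3 := hh.height_nonneg hM h0 hX h1
    unfold sep
    linarith [pow_lt_pow_left₀ h2 h3 two_ne_zero]
  set S : Set ℝ := {τ | 0 ≤ τ ∧ X ∈ leafDom M (h τ) τ} with hS
  have hS0 : (0 : ℝ) ∈ S := ⟨le_rfl, by rw [hh.zero, leafDom_zero hM]; exact mem_univ X⟩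
  have hSbd : ∀ τ ∈ S, τ ≤ sqrt (2 * M) := fun τ hτ =>
    Real.le_sqrt_of_sq_le (sq_lt_of_mem_leafDom hτ.2).le
  have hSb : BddAbove S := ⟨_, hSbd⟩
  set σ := sSup S with hσ
  have hσ0 : 0 ≤ σ := le_csSup hSb hS0
  have hfreq : ∀ P : ℝ → Prop, (∀ᶠ τ in 𝓝 σ, P τ) → ∃ τ ∈ S, P τ := by
    intro P hP
    obtain ⟨τ, hτ, hτS⟩ := (mem_closure_iff_frequently.1 (csSup_mem_closure ⟨0, hS0⟩ hSb)).and_eventually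
      hP |>.exists
    exact ⟨τ, hτ, hτS⟩
  rcases lt_or_ge (σ ^ 2) (2 * M) with hσM | hσM
  · have hXσ : X ∉ leafDom M (h σ) σ := by
      intro hmem
      obtain ⟨τ, hτ, hlt⟩ := (((hh.eventually_mem hM hmem).filter_mono nhdsWithin_le_nhds).and
        (self_mem_nhdsWithin : ∀ᶠ τ in 𝓝[>] σ, τ ∈ Ioi σ)).exists
      exact absurd (le_csSup hSb ⟨hσ0.trans (le_of_lt hlt), hτ⟩) (not_le.2 hlt)
    -- A nonnegative force would keep X² - T² at or above its initial value, and the curve would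
    -- reach X.
    have hforce : centralForce M (h σ) σ < 0 := by
      by_contra! hf
      refine hXσ (mem_leafDom_of_sep_bound hM hσM hX (δ := 2 * M - σ ^ 2) (by linarith)
        fun t ht htd => ?_)
      have h1 := monotoneOn_sep hM htd ht.1 hf ⟨le_rfl, ht.1⟩ ⟨ht.1, le_rfl⟩ ht.1
      rw [sep_zero hM hσM] at h1
      linarith
    obtain ⟨t, ht, htd, hts⟩ : ∃ t ∈ Ico 0 X, t ∈ leafDom M (h σ) σ ∧
        sep (height M (h σ) σ) t < w := by
      by_contra! hno
      exact hXσ (mem_leafDom_of_sep_bound hM hσM hX (δ := w + 2 * M) (by linarith)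
        fun t ht htd => by linarith [hno t ht htd])
    have h1 : ∀ᶠ τ in 𝓝 σ, sep (height M (h τ) τ) t < w := by
      have : ContinuousAt (fun τ => sep (height M (h τ) τ) t) σ :=
        continuousAt_const.sub ((hh.continuousAt_height hM htd).pow 2)
      exact this.eventually (gt_mem_nhds hts)
    have h2 : ∀ᶠ τ in 𝓝 σ, centralForce M (h τ) τ < 0 :=
      (continuousAt_centralForce hh hM hσM).eventually (gt_mem_nhds hforce)
    -- Both strict inequalities at σ persist for some nearby τ in S, and its radius can only
    -- decrease from `t` to X.
    obtain ⟨τ, hτS, h3, h4⟩ := hfreq _ (h1.and h2)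
    have h5 := antitoneOn_sep hM hτS.2 hX h4.le (Ico_subset_Icc_self ht) ⟨hX, le_rfl⟩ ht.2.le
    linarith [hsep τ hτS.1 hτS.2]
  · have hpr : -(2 * M) < profile M (3 * M / 2) := neg_lt_profile hM (by linarith)
    have h1 : ∀ᶠ τ in 𝓝 σ, -τ ^ 2 < min w (profile M (3 * M / 2)) := by
      have : ContinuousAt (fun τ : ℝ => -τ ^ 2) σ := by fun_prop
      exact this.eventually (gt_mem_nhds ((by linarith : -σ ^ 2 ≤ -(2 * M)).trans_lt (lt_min hTX hpr)))
    obtain ⟨τ, hτS, h2⟩ := hfreq _ h1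
    have hτ2 := sq_lt_of_mem_leafDom hτS.2
    have h3 := centralForce_nonpos hM hτ2 hτS.1 (hh.nonneg hτS.1 hτ2)
      (h2.le.trans (min_le_right _ _))
    have h4 := antitoneOn_sep hM hτS.2 hX h3 ⟨le_rfl, hX⟩ ⟨hX, le_rfl⟩ hX
    rw [sep_zero hM hτ2] at h4
    linarith [hsep τ hτS.1 hτS.2, min_le_left w (profile M (3 * M / 2))]

/-- The profile curves cover the Kruskal extension. -/
theorem Admissible.exists_height_eq (hh : Admissible M h) (hM : 0 < M) {X T : ℝ}
    (hTX : -(2 * M) < X ^ 2 - T ^ 2) :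
    ∃ τ, X ∈ leafDom M (h τ) τ ∧ height M (h τ) τ X = T := by
  wlog hX : 0 ≤ X generalizing X
  · obtain ⟨τ, h1, h2⟩ := this (X := -X) (by rwa [neg_sq]) (by linarith)
    have h3 : X ∈ leafDom M (h τ) τ := mem_leafDom_of_abs_le h1 (by rw [abs_neg])
    exact ⟨τ, h3, by rw [← h2, height_neg hM h3]⟩
  wlog hT : 0 ≤ T generalizing T
  · obtain ⟨τ, h1, h2⟩ := this (T := -T) (by rwa [neg_sq]) (by linarith)
    obtain ⟨h3, h4⟩ := hh.height_neg_param hM h1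
    exact ⟨-τ, h3, by rw [h4, h2, neg_neg]⟩
  obtain ⟨τ, hτ0, hXτ, hTτ⟩ := hh.exists_height_ge hM hX hTX
  have hmem : ∀ τ' ∈ Icc 0 τ, X ∈ leafDom M (h τ') τ' := fun τ' ht => hh.mem_of_le hM hXτ hX ht
  have hivt := intermediate_value_Icc hτ0 (f := fun τ => height M (h τ) τ X)
    (fun τ' ht => (hh.continuousAt_height hM (hmem τ' ht)).continuousWithinAt)
  obtain ⟨τ', hτ', he⟩ := hivt ⟨by simpa [hh.zero, height_zero_zero hM] using hT, hTτ⟩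
  exact ⟨τ', hmem τ' hτ', he⟩

end

end Kruskal

/-! ### The mean curvature of a spherically symmetric hypersurface -/

namespace Kruskal

open Set Filter Topology Real LorentzChart

theorem pderiv_comp {n : ℕ} {φ : (Fin n → ℝ) → ℝ} {φ' : (Fin n → ℝ) →L[ℝ] ℝ} {g : ℝ → ℝ}
    {g' : ℝ} {p : Fin n → ℝ} (hg : HasDerivAt g g' (φ p)) (hφ : HasFDerivAt φ φ' p) (i : Fin n) :
    pderiv i (fun q => g (φ q)) p = g' * φ' (Pi.single i 1) := by
  have h : HasFDerivAt (fun q => g (φ q)) (g' • φ') p := hg.comp_hasFDerivAt p hφ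
  rw [pderiv, h.fderiv]
  simp

theorem pderiv_comp_apply {n : ℕ} {g : ℝ → ℝ} {g' : ℝ} {p : Fin n → ℝ} {j : Fin n}
    (hg : HasDerivAt g g' (p j)) (i : Fin n) :
    pderiv i (fun q => g (q j)) p = g' * (Pi.single i 1 : Fin n → ℝ) j := by
  rw [pderiv_comp (φ := fun q => q j) hg (hasFDerivAt_apply j p) i]
  rfl

theorem pderiv_apply {n : ℕ} (p : Fin n → ℝ) (i j : Fin n) :
    pderiv i (fun q => q j) p = (Pi.single i 1 : Fin n → ℝ) j :=
  (pderiv_comp_apply (g := fun x => x) (hasDerivAt_id' (p j)) i).trans (one_mul _)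

theorem pderiv_const {n : ℕ} (p : Fin n → ℝ) (i : Fin n) (a : ℝ) :
    pderiv i (fun _ => a) p = 0 := by
  simp [pderiv]

section

variable {M : ℝ}

theorem metric_eq (M : ℝ) (q : Fin 4 → ℝ) :
    metric M q = Matrix.diagonal ![-conf M (q 1 ^ 2 - q 0 ^ 2), conf M (q 1 ^ 2 - q 0 ^ 2),
      rho M (q 1 ^ 2 - q 0 ^ 2) ^ 2, rho M (q 1 ^ 2 - q 0 ^ 2) ^ 2 * sin (q 2) ^ 2] := rfl

theorem inv_diagonal_of_ne_zero {n : ℕ} {d : Fin n → ℝ} (hd : ∀ i, d i ≠ 0) :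
    (Matrix.diagonal d)⁻¹ = Matrix.diagonal fun i => (d i)⁻¹ := by
  apply Matrix.inv_eq_right_inv
  rw [Matrix.diagonal_mul_diagonal, ← Matrix.diagonal_one]
  congr 1
  ext i
  exact mul_inv_cancel₀ (hd i)

theorem hasFDerivAt_sep (p : Fin 4 → ℝ) :
    HasFDerivAt (fun q : Fin 4 → ℝ => q 1 ^ 2 - q 0 ^ 2)
      ((2 * p 1) • (ContinuousLinearMap.proj 1 : (Fin 4 → ℝ) →L[ℝ] ℝ)
        - (2 * p 0) • (ContinuousLinearMap.proj 0 : (Fin 4 → ℝ) →L[ℝ] ℝ)) p := by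
  have h := ((hasFDerivAt_apply (𝕜 := ℝ) 1 p).pow 2).sub ((hasFDerivAt_apply (𝕜 := ℝ) 0 p).pow 2)
  refine h.congr_fderiv ?_
  ext v
  simp

/-- The partial derivatives of `X² - T²`. -/
def sepGrad (p : Fin 4 → ℝ) : Fin 4 → ℝ := ![-(2 * p 0), 2 * p 1, 0, 0]

theorem pderiv_comp_sep {g : ℝ → ℝ} {g' : ℝ} {p : Fin 4 → ℝ}
    (hg : HasDerivAt g g' (p 1 ^ 2 - p 0 ^ 2)) (i : Fin 4) :
    pderiv i (fun q => g (q 1 ^ 2 - q 0 ^ 2)) p = g' * sepGrad p i := by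
  rw [pderiv_comp hg (hasFDerivAt_sep p) i]
  fin_cases i <;> simp [sepGrad]

/-- The partial derivatives of the diagonal components of the Kruskal metric. -/
def metricDeriv (M : ℝ) (p : Fin 4 → ℝ) (i a : Fin 4) : ℝ :=
  let r := rho M (p 1 ^ 2 - p 0 ^ 2)
  let E := redshift M (p 1 ^ 2 - p 0 ^ 2)
  let A' := -(r + 2 * M) * E / r ^ 2 * conf M (p 1 ^ 2 - p 0 ^ 2)
  ![-A' * sepGrad p i, A' * sepGrad p i, 4 * M * E * sepGrad p i,
    4 * M * E * sepGrad p i * sin (p 2) ^ 2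
      + r ^ 2 * (2 * sin (p 2) * cos (p 2)) * (Pi.single i 1 : Fin 4 → ℝ) 2] a

theorem pderiv_metric (hM : 0 < M) {p : Fin 4 → ℝ} (hp : -(2 * M) < p 1 ^ 2 - p 0 ^ 2)
    (i a b : Fin 4) :
    pderiv i (fun q => metric M q a b) p = if a = b then metricDeriv M p i a else 0 := by
  split_ifs with hab
  · subst hab
    simp only [metric_eq, Matrix.diagonal_apply_eq]
    have hr := (rho_pos hM hp).ne'
    have hrd : HasDerivAt (fun w => rho M w ^ 2) (4 * M * redshift M (p 1 ^ 2 - p 0 ^ 2))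
        (p 1 ^ 2 - p 0 ^ 2) := by
      refine ((hasDerivAt_rho' hM hp).pow 2).congr_deriv ?_
      field_simp
      norm_num
      ring
    fin_cases a
    · exact pderiv_comp_sep (hasDerivAt_conf hM hp).neg i
    · exact pderiv_comp_sep (hasDerivAt_conf hM hp) i
    · exact pderiv_comp_sep hrd i
    · have h1 := hrd.comp_hasFDerivAt p (hasFDerivAt_sep p)
      have h2 := ((Real.hasDerivAt_sin (p 2)).pow 2).comp_hasFDerivAt p
        (hasFDerivAt_apply (𝕜 := ℝ) 2 p)
      have h3 := h1.mul h2
      unfold pderiv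
      have h4 := congrArg (fun L => L (Pi.single i 1)) h3.fderiv
      refine Eq.trans h4 ?_
      fin_cases i <;> simp [metricDeriv, sepGrad] <;> ring
  · have h0 : (fun q => metric M q a b) = fun _ => 0 := by
      funext q
      rw [metric_eq, Matrix.diagonal_apply_ne _ hab]
    rw [h0, pderiv_const]

theorem metric_diag_ne_zero (hM : 0 < M) {p : Fin 4 → ℝ} (hp : -(2 * M) < p 1 ^ 2 - p 0 ^ 2)
    (hθ : p 2 ∈ Ioo 0 π) (i : Fin 4) :
    ![-conf M (p 1 ^ 2 - p 0 ^ 2), conf M (p 1 ^ 2 - p 0 ^ 2),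
      rho M (p 1 ^ 2 - p 0 ^ 2) ^ 2, rho M (p 1 ^ 2 - p 0 ^ 2) ^ 2 * sin (p 2) ^ 2] i ≠ 0 := by
  have h1 := (conf_pos hM hp).ne'
  have h2 := (rho_pos hM hp).ne'
  have h3 := (sin_pos_of_mem_Ioo hθ).ne'
  fin_cases i <;> simp [h1, h2, h3]

/-- The metric is diagonal, so only the term d = a of the contraction survives. -/
theorem christoffel_eq (hM : 0 < M) {p : Fin 4 → ℝ} (hp : -(2 * M) < p 1 ^ 2 - p 0 ^ 2)
    (hθ : p 2 ∈ Ioo 0 π) (a b c : Fin 4) :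
    christoffel (metric M) p a b c = (1 / 2) * ((metric M p a a)⁻¹ *
      ((if a = c then metricDeriv M p b a else 0) + (if a = b then metricDeriv M p c a else 0)
        - (if b = c then metricDeriv M p a b else 0))) := by
  unfold christoffel
  simp only [pderiv_metric hM hp]
  rw [metric_eq, inv_diagonal_of_ne_zero (metric_diag_ne_zero hM hp hθ),
    Finset.sum_eq_single a]
  · rw [Matrix.diagonal_apply_eq, Matrix.diagonal_apply_eq]
  · intro d _ hd
    rw [Matrix.diagonal_apply_ne _ hd.symm, zero_mul]
  · simp

theorem dot_metric (M : ℝ) (p v w : Fin 4 → ℝ) :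
    dot (metric M) p v w = -conf M (p 1 ^ 2 - p 0 ^ 2) * v 0 * w 0
      + conf M (p 1 ^ 2 - p 0 ^ 2) * v 1 * w 1 + rho M (p 1 ^ 2 - p 0 ^ 2) ^ 2 * v 2 * w 2
      + rho M (p 1 ^ 2 - p 0 ^ 2) ^ 2 * sin (p 2) ^ 2 * v 3 * w 3 := by
  unfold dot
  rw [metric_eq]
  simp only [dotProduct, Fin.sum_univ_four, Matrix.mulVec_diagonal]
  simp
  ring

/-! ### Unit normal and principal curvatures of a profile curve -/

/-- The future-directed unit normal of the hypersurface generated by a curve of rapidity `η`. -/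
def graphNormal (M : ℝ) (F η : ℝ → ℝ) (u : Fin 3 → ℝ) : Fin 4 → ℝ :=
  ![cosh (η (u 0)) / scale M (sep F (u 0)), sinh (η (u 0)) / scale M (sep F (u 0)), 0, 0]

variable {H : ℝ} {F η : ℝ → ℝ}

theorem LeafAt.tangent_zero {u : Fin 3 → ℝ} (h : LeafAt M H F η (u 0)) :
    tangent (graphChart F) u 0 = ![sinh (η (u 0)) / cosh (η (u 0)), 1, 0, 0] := by
  ext a
  fin_cases a <;> simp only [tangent, graphChart, Fin.isValue, Fin.zero_eta, Fin.mk_one,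
    Fin.reduceFinMk, Matrix.cons_val]
  · rw [pderiv_comp_apply h.deriv_height]; simp
  · rw [pderiv_apply]; simp
  · rw [pderiv_apply]; simp
  · rw [pderiv_apply]; simp

theorem LeafAt.tangent_one {u : Fin 3 → ℝ} (h : LeafAt M H F η (u 0)) :
    tangent (graphChart F) u 1 = ![0, 0, 1, 0] := by
  ext a
  fin_cases a <;> simp only [tangent, graphChart, Fin.isValue, Fin.zero_eta, Fin.mk_one,
    Fin.reduceFinMk, Matrix.cons_val]
  · rw [pderiv_comp_apply h.deriv_height]; simp
  · rw [pderiv_apply]; simp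
  · rw [pderiv_apply]; simp
  · rw [pderiv_apply]; simp

theorem LeafAt.tangent_two {u : Fin 3 → ℝ} (h : LeafAt M H F η (u 0)) :
    tangent (graphChart F) u 2 = ![0, 0, 0, 1] := by
  ext a
  fin_cases a <;> simp only [tangent, graphChart, Fin.isValue, Fin.zero_eta, Fin.mk_one,
    Fin.reduceFinMk, Matrix.cons_val]
  · rw [pderiv_comp_apply h.deriv_height]; simp
  · rw [pderiv_apply]; simp
  · rw [pderiv_apply]; simp
  · rw [pderiv_apply]; simp

theorem LeafAt.inducedMetric_eq {u : Fin 3 → ℝ} (h : LeafAt M H F η (u 0)) :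
    inducedMetric (metric M) (graphChart F) u =
      Matrix.diagonal ![conf M (sep F (u 0)) / cosh (η (u 0)) ^ 2, rho M (sep F (u 0)) ^ 2,
        rho M (sep F (u 0)) ^ 2 * sin (u 1) ^ 2] := by
  have hc := (cosh_pos (η (u 0))).ne'
  have h6 := Real.cosh_sq_sub_sinh_sq (η (u 0))
  have h00 : -(conf M (u 0 ^ 2 - F (u 0) ^ 2) * (sinh (η (u 0)) / cosh (η (u 0))) *
      (sinh (η (u 0)) / cosh (η (u 0)))) + conf M (u 0 ^ 2 - F (u 0) ^ 2)
      = conf M (u 0 ^ 2 - F (u 0) ^ 2) / cosh (η (u 0)) ^ 2 := by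
    field_simp
    linear_combination conf M (u 0 ^ 2 - F (u 0) ^ 2) * h6
  ext i j
  unfold inducedMetric
  rw [Matrix.of_apply, dot_metric]
  fin_cases i <;> fin_cases j <;>
    simp [h.tangent_zero, h.tangent_one, h.tangent_two, graphChart, sep, h00]

theorem LeafAt.inducedMetric_posDef (hM : 0 < M) {u : Fin 3 → ℝ} (h : LeafAt M H F η (u 0))
    (hθ : u 1 ∈ Ioo 0 π) : (inducedMetric (metric M) (graphChart F) u).PosDef := by
  have h1 := conf_pos hM (w := sep F (u 0)) h.mem
  have h2 := rho_pos hM (w := sep F (u 0)) h.mem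
  have h3 := sin_pos_of_mem_Ioo hθ
  have h4 := cosh_pos (η (u 0))
  rw [h.inducedMetric_eq]
  refine Matrix.PosDef.diagonal fun i => ?_
  fin_cases i <;> simp <;> positivity

/-- Divided by the induced metric coefficient, this is the principal curvature 3H - 2 n(r)/r along
the curve. It is the only place where the equation for the rapidity enters the second fundamental
form. -/
theorem LeafAt.dot_covDeriv_zero (hM : 0 < M) {u : Fin 3 → ℝ} (h : LeafAt M H F η (u 0))
    (hθ : u 1 ∈ Ioo 0 π) :
    dot (metric M) (graphChart F u) (covDeriv (metric M) (graphChart F) (graphNormal M F η) u 0)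
      (tangent (graphChart F) u 0) = conf M (sep F (u 0)) / cosh (η (u 0)) ^ 2 *
        (3 * H - 8 * M * redshift M (sep F (u 0)) * nrml F η (u 0) /
          (rho M (sep F (u 0)) ^ 2 * scale M (sep F (u 0)))) := by
  have hs := (scale_pos hM (w := sep F (u 0)) h.mem).ne'
  have hd0 := h.deriv_rapidity.cosh.div (h.hasDerivAt_scale hM) hs
  have hd1 := h.deriv_rapidity.sinh.div (h.hasDerivAt_scale hM) hs
  have e0 : pderiv 0 (fun v => graphNormal M F η v 0) u = _ :=
    (pderiv_comp_apply (j := 0) hd0 0).trans (by rw [Pi.single_eq_same, mul_one])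
  have e1 : pderiv 0 (fun v => graphNormal M F η v 1) u = _ :=
    (pderiv_comp_apply (j := 0) hd1 0).trans (by rw [Pi.single_eq_same, mul_one])
  have hp : -(2 * M) < graphChart F u 1 ^ 2 - graphChart F u 0 ^ 2 := h.mem
  have hθ' : graphChart F u 2 ∈ Ioo 0 π := hθ
  have hA := (conf_pos hM (w := sep F (u 0)) h.mem).ne'
  have hr := (rho_pos hM (w := sep F (u 0)) h.mem).ne'
  have hc := (cosh_pos (η (u 0))).ne'
  have h6 := Real.cosh_sq_sub_sinh_sq (η (u 0))
  rw [dot_metric, h.tangent_zero]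
  simp only [covDeriv, e0, e1, christoffel_eq hM hp hθ', h.tangent_zero, Fin.sum_univ_four]
  simp [metric_eq, metricDeriv, sepGrad, graphNormal, graphChart]
  rw [accel_eq]
  simp only [nrml, tang, tidal]
  simp only [show u 0 ^ 2 - F (u 0) ^ 2 = sep F (u 0) from rfl]
  generalize scale M (sep F (u 0)) = s at *
  generalize rho M (sep F (u 0)) = r at *
  generalize redshift M (sep F (u 0)) = E at *
  generalize conf M (sep F (u 0)) = A at *
  generalize cosh (η (u 0)) = c at *
  generalize sinh (η (u 0)) = sh at *
  generalize F (u 0) = T at *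
  generalize u 0 = x at *
  clear e0 e1 hd0 hd1
  field_simp
  linear_combination (3 * H * s * r ^ 2 - (sh * x - T * c) * E * M * 8) * h6

/-- The principal curvature along the spheres is n(r)/r, written here times r² and with
`scale_sq_mul` used to eliminate one power of r. -/
theorem LeafAt.dot_covDeriv_one (hM : 0 < M) {u : Fin 3 → ℝ} (h : LeafAt M H F η (u 0))
    (hθ : u 1 ∈ Ioo 0 π) :
    dot (metric M) (graphChart F u) (covDeriv (metric M) (graphChart F) (graphNormal M F η) u 1)
      (tangent (graphChart F) u 1) = 4 * M * redshift M (sep F (u 0)) *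
        nrml F η (u 0) / scale M (sep F (u 0)) := by
  have hs := (scale_pos hM (w := sep F (u 0)) h.mem).ne'
  have e : pderiv 1 (fun v => graphNormal M F η v 2) u = 0 := pderiv_const u 1 0
  have hp : -(2 * M) < graphChart F u 1 ^ 2 - graphChart F u 0 ^ 2 := h.mem
  have hθ' : graphChart F u 2 ∈ Ioo 0 π := hθ
  have hr := (rho_pos hM (w := sep F (u 0)) h.mem).ne'
  have hsin := (sin_pos_of_mem_Ioo hθ).ne'
  rw [dot_metric, h.tangent_one]
  simp only [covDeriv, e, christoffel_eq hM hp hθ', h.tangent_one, Fin.sum_univ_four]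
  simp [metric_eq, metricDeriv, sepGrad, graphNormal, graphChart]
  simp only [nrml, show u 0 ^ 2 - F (u 0) ^ 2 = sep F (u 0) from rfl]
  field_simp
  ring

theorem LeafAt.dot_covDeriv_two (hM : 0 < M) {u : Fin 3 → ℝ} (h : LeafAt M H F η (u 0))
    (hθ : u 1 ∈ Ioo 0 π) :
    dot (metric M) (graphChart F u) (covDeriv (metric M) (graphChart F) (graphNormal M F η) u 2)
      (tangent (graphChart F) u 2) = sin (u 1) ^ 2 * 4 * M * redshift M (sep F (u 0)) *
        nrml F η (u 0) / scale M (sep F (u 0)) := by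
  have hs := (scale_pos hM (w := sep F (u 0)) h.mem).ne'
  have e : pderiv 2 (fun v => graphNormal M F η v 3) u = 0 := pderiv_const u 2 0
  have hp : -(2 * M) < graphChart F u 1 ^ 2 - graphChart F u 0 ^ 2 := h.mem
  have hθ' : graphChart F u 2 ∈ Ioo 0 π := hθ
  have hr := (rho_pos hM (w := sep F (u 0)) h.mem).ne'
  have hsin := (sin_pos_of_mem_Ioo hθ).ne'
  rw [dot_metric, h.tangent_two]
  simp only [covDeriv, e, christoffel_eq hM hp hθ', h.tangent_two, Fin.sum_univ_four]
  simp [metric_eq, metricDeriv, sepGrad, graphNormal, graphChart]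
  simp only [nrml, show u 0 ^ 2 - F (u 0) ^ 2 = sep F (u 0) from rfl]
  field_simp
  ring

/-- The principal curvatures 3H - 2κ, κ, κ with κ = n(r)/r add up to 3H. -/
theorem LeafAt.meanCurvature_eq (hM : 0 < M) {u : Fin 3 → ℝ} (h : LeafAt M H F η (u 0))
    (hθ : u 1 ∈ Ioo 0 π) :
    meanCurvature (metric M) (graphChart F) (graphNormal M F η) u = H := by
  have hA := (conf_pos hM (w := sep F (u 0)) h.mem).ne'
  have hr := (rho_pos hM (w := sep F (u 0)) h.mem).ne'
  have hs := (scale_pos hM (w := sep F (u 0)) h.mem).ne'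
  have hc := (cosh_pos (η (u 0))).ne'
  have hsin := (sin_pos_of_mem_Ioo hθ).ne'
  unfold meanCurvature
  rw [h.inducedMetric_eq, inv_diagonal_of_ne_zero (by
    intro i
    fin_cases i <;> simp [hA, hr, hc, hsin])]
  simp only [Fin.sum_univ_three, h.dot_covDeriv_zero hM hθ, h.dot_covDeriv_one hM hθ,
    h.dot_covDeriv_two hM hθ, Matrix.diagonal_apply]
  simp
  field_simp
  ring

theorem LeafAt.dot_graphNormal_tangent {u : Fin 3 → ℝ} (h : LeafAt M H F η (u 0)) (i : Fin 3) :
    dot (metric M) (graphChart F u) (graphNormal M F η u) (tangent (graphChart F) u i) = 0 := by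
  have hc := (cosh_pos (η (u 0))).ne'
  rw [dot_metric]
  fin_cases i <;>
    simp [h.tangent_zero, h.tangent_one, h.tangent_two, graphNormal, graphChart]
  field_simp
  ring

theorem LeafAt.dot_graphNormal_self (hM : 0 < M) {u : Fin 3 → ℝ} (h : LeafAt M H F η (u 0)) :
    dot (metric M) (graphChart F u) (graphNormal M F η u) (graphNormal M F η u) = -1 := by
  have hs := (scale_pos hM (w := sep F (u 0)) h.mem).ne'
  have h1 := scale_sq hM (w := sep F (u 0)) h.mem
  have h6 := Real.cosh_sq_sub_sinh_sq (η (u 0))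
  rw [dot_metric]
  simp [graphNormal, graphChart]
  simp only [show u 0 ^ 2 - F (u 0) ^ 2 = sep F (u 0) from rfl, ← h1]
  field_simp
  linear_combination -h6

theorem LeafAt.dot_graphNormal_time_neg (hM : 0 < M) {u : Fin 3 → ℝ}
    (h : LeafAt M H F η (u 0)) :
    dot (metric M) (graphChart F u) (graphNormal M F η u) (Pi.single 0 1) < 0 := by
  have hs := scale_pos hM (w := sep F (u 0)) h.mem
  have hA := conf_pos hM (w := sep F (u 0)) h.mem
  have hc := cosh_pos (η (u 0))
  rw [dot_metric]
  simp [graphNormal, graphChart]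
  simp only [show u 0 ^ 2 - F (u 0) ^ 2 = sep F (u 0) from rfl]
  positivity

theorem contDiffOn_comp_apply_zero {f : ℝ → ℝ} {I : Set ℝ} (hf : ContDiffOn ℝ ∞ f I) :
    ContDiffOn ℝ ∞ (fun u : Fin 3 → ℝ => f (u 0)) (graphDomain I) :=
  hf.comp (contDiff_apply ℝ ℝ 0).contDiffOn fun _ hu => hu.1

theorem contDiffOn_graphChart {I : Set ℝ} (hF : ContDiffOn ℝ ∞ F I) :
    ContDiffOn ℝ ∞ (graphChart F) (graphDomain I) := by
  rw [contDiffOn_pi]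
  intro i
  fin_cases i
  · exact contDiffOn_comp_apply_zero hF
  · exact (contDiff_apply ℝ ℝ 0).contDiffOn
  · exact (contDiff_apply ℝ ℝ 1).contDiffOn
  · exact (contDiff_apply ℝ ℝ 2).contDiffOn

theorem contDiffOn_graphNormal (hM : 0 < M) {I : Set ℝ} (hF : ContDiffOn ℝ ∞ F I)
    (hη : ContDiffOn ℝ ∞ η I) (h : ∀ X ∈ I, LeafAt M H F η X) :
    ContDiffOn ℝ ∞ (graphNormal M F η) (graphDomain I) := by
  have hs : ContDiffOn ℝ ∞ (fun X => scale M (sep F X)) I := by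
    intro X hX
    exact (contDiffAt_scale hM (w := sep F X) (h X hX).mem).comp_contDiffWithinAt X
      ((contDiffWithinAt_id.pow 2).sub ((hF X hX).pow 2))
  have hne : ∀ X ∈ I, scale M (sep F X) ≠ 0 := fun X hX =>
    (scale_pos hM (w := sep F X) (h X hX).mem).ne'
  rw [contDiffOn_pi]
  intro i
  fin_cases i
  · exact contDiffOn_comp_apply_zero (hη.cosh.div hs hne)
  · exact contDiffOn_comp_apply_zero (hη.sinh.div hs hne)
  · exact contDiffOn_const
  · exact contDiffOn_const

theorem isSpacelikeCMC_graphChart (hM : 0 < M) {I : Set ℝ} (hF : ContDiffOn ℝ ∞ F I)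
    (hη : ContDiffOn ℝ ∞ η I) (h : ∀ X ∈ I, LeafAt M H F η X) :
    IsSpacelikeCMC (metric M) H (graphDomain I) (graphChart F) where
  smooth := contDiffOn_graphChart hF
  spacelike _ hu := (h _ hu.1).inducedMetric_posDef hM hu.2
  cmc := ⟨graphNormal M F η, ⟨contDiffOn_graphNormal hM hF hη h,
      fun _ hu => (h _ hu.1).dot_graphNormal_tangent,
      fun _ hu => (h _ hu.1).dot_graphNormal_self hM,
      fun _ hu => (h _ hu.1).dot_graphNormal_time_neg hM⟩,
    fun _ hu => (h _ hu.1).meanCurvature_eq hM hu.2⟩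

end

end Kruskal

/-! ### The family of hypersurfaces -/

namespace Kruskal

open Set Filter Topology Real

section

variable {M : ℝ}

/-- `τ e^{-r/4M} r^{-3/2}`, where `r` is the radius at the point of height `τ` on the `T`-axis. -/
def axisFlux (M τ : ℝ) : ℝ :=
  τ * (exp (-rho M (-τ ^ 2) / (4 * M)) / (rho M (-τ ^ 2) * √(rho M (-τ ^ 2))))

/-- The mean curvature of the hypersurface through the point of height `τ` on the `T`-axis. -/
def axisCurvature (M τ : ℝ) : ℝ := axisFlux M τ * ((2 * M) ^ 3 / rho M (-τ ^ 2) ^ 3 - 1)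

theorem axisFlux_neg (M τ : ℝ) : axisFlux M (-τ) = -axisFlux M τ := by
  unfold axisFlux
  rw [neg_sq]
  ring

theorem axisCurvature_neg (M τ : ℝ) : axisCurvature M (-τ) = -axisCurvature M τ := by
  unfold axisCurvature
  rw [axisFlux_neg, neg_sq]
  ring

theorem rho_neg_sq_pos (hM : 0 < M) {τ : ℝ} (hτ : τ ^ 2 < 2 * M) : 0 < rho M (-τ ^ 2) :=
  rho_pos hM (by linarith)

theorem rho_neg_sq_le (hM : 0 < M) {τ τ' : ℝ} (h0 : 0 ≤ τ) (h : τ ≤ τ') (hτ' : τ' ^ 2 < 2 * M) :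
    rho M (-τ' ^ 2) ≤ rho M (-τ ^ 2) :=
  rho_le_rho hM (by linarith) (neg_le_neg (pow_le_pow_left₀ h0 h 2))

theorem sq_lt_of_nonneg_le {τ τ' m : ℝ} (h0 : 0 ≤ τ) (h : τ ≤ τ') (hτ' : τ' ^ 2 < m) :
    τ ^ 2 < m :=
  (pow_le_pow_left₀ h0 h 2).trans_lt hτ'

/-- The radius on the axis decreases as τ ≥ 0 grows, so the second factor does not decrease while τ
increases strictly. -/
theorem axisFlux_lt_of_nonneg (hM : 0 < M) {τ τ' : ℝ} (h0 : 0 ≤ τ) (h : τ < τ')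
    (hτ' : τ' ^ 2 < 2 * M) : axisFlux M τ < axisFlux M τ' := by
  have hr' := rho_neg_sq_pos hM hτ'
  have hle := rho_neg_sq_le hM h0 h.le hτ'
  have hr := hr'.trans_le hle
  refine mul_lt_mul h ?_ (by positivity) (h0.trans h.le)
  have h1 : exp (-rho M (-τ ^ 2) / (4 * M)) ≤ exp (-rho M (-τ' ^ 2) / (4 * M)) := by gcongr
  gcongr

theorem axisFlux_nonneg (hM : 0 < M) {τ : ℝ} (h0 : 0 ≤ τ) (hτ : τ ^ 2 < 2 * M) :
    0 ≤ axisFlux M τ := by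
  have hr := rho_neg_sq_pos hM hτ
  unfold axisFlux
  positivity

theorem curvatureFactor_le (hM : 0 < M) {τ τ' : ℝ} (h0 : 0 ≤ τ) (h : τ ≤ τ')
    (hτ' : τ' ^ 2 < 2 * M) :
    (2 * M) ^ 3 / rho M (-τ ^ 2) ^ 3 - 1 ≤ (2 * M) ^ 3 / rho M (-τ' ^ 2) ^ 3 - 1 := by
  have hr' := rho_neg_sq_pos hM hτ'
  have hle := rho_neg_sq_le hM h0 h hτ'
  gcongr

theorem curvatureFactor_pos (hM : 0 < M) {τ : ℝ} (h0 : 0 < τ) (hτ : τ ^ 2 < 2 * M) :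
    0 < (2 * M) ^ 3 / rho M (-τ ^ 2) ^ 3 - 1 := by
  have hr := rho_neg_sq_pos hM hτ
  have h1 : rho M (-τ ^ 2) < 2 * M := by
    rw [← rho_zero hM]
    exact rho_lt_rho hM (by linarith) (by nlinarith)
  rw [sub_pos, one_lt_div (by positivity)]
  gcongr

theorem axisCurvature_lt_of_nonneg (hM : 0 < M) {τ τ' : ℝ} (h0 : 0 ≤ τ) (h : τ < τ')
    (hτ' : τ' ^ 2 < 2 * M) : axisCurvature M τ < axisCurvature M τ' :=
  (mul_le_mul_of_nonneg_left (curvatureFactor_le hM h0 h.le hτ')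
    (axisFlux_nonneg hM h0 (sq_lt_of_nonneg_le h0 h.le hτ'))).trans_lt
    (mul_lt_mul_of_pos_right (axisFlux_lt_of_nonneg hM h0 h hτ')
      (curvatureFactor_pos hM (h0.trans_lt h) hτ'))

theorem lt_of_odd_of_lt_of_nonneg {f : ℝ → ℝ} {m : ℝ} (hodd : ∀ τ, f (-τ) = -f τ)
    (hf : ∀ τ τ', 0 ≤ τ → τ < τ' → τ' ^ 2 < m → f τ < f τ') {τ τ' : ℝ} (h : τ < τ')
    (hτ : τ ^ 2 < m) (hτ' : τ' ^ 2 < m) : f τ < f τ' := by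
  have hz : f 0 = 0 := by
    have := hodd 0
    rw [neg_zero] at this
    linarith
  rcases le_or_gt 0 τ with h0 | h0
  · exact hf τ τ' h0 h hτ'
  · have hneg : ∀ σ, 0 ≤ σ → σ < -τ → f σ < -f τ := fun σ h1 h2 => by
      rw [← hodd]
      exact hf σ (-τ) h1 h2 (by rwa [neg_sq])
    rcases le_or_gt τ' 0 with h1 | h1
    · have := hneg (-τ') (by linarith) (by linarith)
      rw [hodd] at this
      linarith
    · have h2 := hneg 0 le_rfl (by linarith)
      have h3 := hf 0 τ' le_rfl h1 hτ'
      linarith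

theorem axisFlux_lt (hM : 0 < M) {τ τ' : ℝ} (h : τ < τ') (hτ : τ ^ 2 < 2 * M)
    (hτ' : τ' ^ 2 < 2 * M) : axisFlux M τ < axisFlux M τ' :=
  lt_of_odd_of_lt_of_nonneg (axisFlux_neg M) (fun _ _ => axisFlux_lt_of_nonneg hM) h hτ hτ'

theorem axisCurvature_lt (hM : 0 < M) {τ τ' : ℝ} (h : τ < τ') (hτ : τ ^ 2 < 2 * M)
    (hτ' : τ' ^ 2 < 2 * M) : axisCurvature M τ < axisCurvature M τ' :=
  lt_of_odd_of_lt_of_nonneg (axisCurvature_neg M) (fun _ _ => axisCurvature_lt_of_nonneg hM)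
    h hτ hτ'

theorem differentiableAt_rho_neg_sq (hM : 0 < M) {τ : ℝ} (hτ : τ ^ 2 < 2 * M) :
    DifferentiableAt ℝ (fun τ => rho M (-τ ^ 2)) τ := by
  have h1 : DifferentiableAt ℝ (rho M) (-τ ^ 2) :=
    (contDiffAt_rho hM (by linarith)).differentiableAt (by simp)
  exact h1.comp (f := fun τ : ℝ => -τ ^ 2) τ (by fun_prop)

theorem differentiableAt_axisFlux (hM : 0 < M) {τ : ℝ} (hτ : τ ^ 2 < 2 * M) :
    DifferentiableAt ℝ (axisFlux M) τ := by
  have hr := rho_neg_sq_pos hM hτ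
  have h1 := differentiableAt_rho_neg_sq hM hτ
  exact differentiableAt_id.mul ((h1.neg.div_const _).exp.div (h1.mul (h1.sqrt hr.ne'))
    (mul_ne_zero hr.ne' (Real.sqrt_pos.2 hr).ne'))

theorem differentiableAt_axisCurvature (hM : 0 < M) {τ : ℝ} (hτ : τ ^ 2 < 2 * M) :
    DifferentiableAt ℝ (axisCurvature M) τ := by
  have hr := rho_neg_sq_pos hM hτ
  have h1 := differentiableAt_rho_neg_sq hM hτ
  exact (differentiableAt_axisFlux hM hτ).mul
    (((differentiableAt_const _).div (h1.pow 3) (pow_ne_zero 3 hr.ne')).sub_const 1)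

theorem admissible_axisCurvature (hM : 0 < M) : Admissible M (axisCurvature M) where
  odd := axisCurvature_neg M
  mono τ τ' h0 h hτ' := by
    rcases h.eq_or_lt with rfl | h
    · exact le_rfl
    · exact (axisCurvature_lt_of_nonneg hM h0 h hτ').le
  differentiableAt _ hτ := differentiableAt_axisCurvature hM hτ

/-- The equation defining r, read on the axis. It identifies `axisFlux` with r^{-3/2} (2M - r)^{1/2}
up to the sign of τ. -/
theorem sq_mul_exp_sq (hM : 0 < M) {τ : ℝ} (hτ : τ ^ 2 < 2 * M) :
    (τ * exp (-rho M (-τ ^ 2) / (4 * M))) ^ 2 = 2 * M - rho M (-τ ^ 2) := by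
  have h1 := mul_redshift hM (w := -τ ^ 2) (by linarith)
  have h2 : exp (-rho M (-τ ^ 2) / (4 * M)) ^ 2 = redshift M (-τ ^ 2) := by
    rw [← Real.exp_nat_mul, redshift]
    congr 1
    field_simp
    norm_num
    ring
  rw [mul_pow, h2]
  linarith

theorem axisFlux_sq (hM : 0 < M) {τ : ℝ} (hτ : τ ^ 2 < 2 * M) :
    axisFlux M τ ^ 2 = (2 * M - rho M (-τ ^ 2)) / rho M (-τ ^ 2) ^ 3 := by
  have hr := rho_neg_sq_pos hM hτ
  rw [axisFlux, ← mul_div_assoc, div_pow, sq_mul_exp_sq hM hτ, mul_pow, Real.sq_sqrt hr.le]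
  ring_nf

theorem exists_axisFlux_ge (hM : 0 < M) (y : ℝ) :
    ∃ τ, 0 ≤ τ ∧ τ ^ 2 < 2 * M ∧ y ≤ axisFlux M τ := by
  -- This radius gives y² r³ ≤ y² M² r ≤ M ≤ 2M - r, so the squared flux is at least y².
  set r := M / (1 + M ^ 2 * y ^ 2) with hr
  have hr0 : 0 < r := by positivity
  have hrM : r ≤ M := div_le_self hM.le (by nlinarith [mul_nonneg (sq_nonneg M) (sq_nonneg y)])
  have hp : profile M r ≤ 0 :=
    mul_nonpos_of_nonpos_of_nonneg (by linarith) (Real.exp_pos _).le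
  have hp2 := neg_lt_profile hM hr0
  have hsq : √(-profile M r) ^ 2 = -profile M r := Real.sq_sqrt (by linarith)
  have hτ : √(-profile M r) ^ 2 < 2 * M := by linarith
  refine ⟨√(-profile M r), Real.sqrt_nonneg _, hτ, ?_⟩
  refine le_of_sq_le_sq ?_ (axisFlux_nonneg hM (Real.sqrt_nonneg _) hτ)
  rw [axisFlux_sq hM hτ, hsq, neg_neg, rho_profile hM hr0, le_div_iff₀ (by positivity)]
  have h1 : r * (1 + M ^ 2 * y ^ 2) = M := by rw [hr]; field_simp
  have h2 : y ^ 2 * r * M ^ 2 ≤ M := by nlinarith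
  have h3 : r ^ 2 ≤ M ^ 2 := by gcongr
  nlinarith [mul_le_mul_of_nonneg_left h3 (by positivity : 0 ≤ y ^ 2 * r)]

theorem exists_axisFlux_eq (hM : 0 < M) (y : ℝ) : ∃ τ, τ ^ 2 < 2 * M ∧ axisFlux M τ = y := by
  wlog hy : 0 ≤ y generalizing y
  · obtain ⟨τ, h1, h2⟩ := this (-y) (by linarith)
    exact ⟨-τ, by rwa [neg_sq], by rw [axisFlux_neg, h2, neg_neg]⟩
  obtain ⟨τ, h0, hτ, hle⟩ := exists_axisFlux_ge hM y
  have hc : ContinuousOn (axisFlux M) (Icc 0 τ) := fun t ht =>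
    (differentiableAt_axisFlux hM
      (sq_lt_of_nonneg_le ht.1 ht.2 hτ)).continuousAt.continuousWithinAt
  obtain ⟨t, ht, he⟩ := intermediate_value_Icc h0 hc ⟨by simpa [axisFlux] using hy, hle⟩
  exact ⟨t, sq_lt_of_nonneg_le ht.1 ht.2 hτ, he⟩

/-! ### The leaves as hypersurfaces and their parameter -/

/-- The hypersurface of mean curvature `H` through the sphere of height `τ` over `X = 0`. -/
def leaf (M H τ : ℝ) : Set Event := {p | p.2.1 ∈ leafDom M H τ ∧ p.1 = height M H τ p.2.1}

theorem continuousAt_height_of_mem (hM : 0 < M) {H τ X : ℝ} (hX : X ∈ leafDom M H τ) :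
    ContinuousAt (height M H τ) X :=
  (leafAt_of_mem hM hX).deriv_height.continuousAt

/-- A limit point in the extension lies on some leaf τ'. If τ' ≠ τ, a leaf strictly between the two
separates a neighbourhood of the point from leaf τ. -/
theorem Admissible.closure_leaf_inter (hM : 0 < M) {h : ℝ → ℝ} (hh : Admissible M h) (τ : ℝ) :
    closure (leaf M (h τ) τ) ∩ extension M ⊆ leaf M (h τ) τ := by
  rintro ⟨T, X, x⟩ ⟨hcl, hext⟩
  obtain ⟨τ', hX, hT⟩ := hh.exists_height_eq hM hext
  dsimp only at hX hT
  subst hT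
  have hfst : Tendsto (fun p : Event => p.1) (𝓝 (height M (h τ') τ' X, X, x))
    (𝓝 (height M (h τ') τ' X)) := continuous_fst.tendsto _
  have hsnd : Tendsto (fun p : Event => p.2.1) (𝓝 (height M (h τ') τ' X, X, x)) (𝓝 X) :=
    (continuous_fst.comp continuous_snd).tendsto _
  rcases lt_trichotomy τ' τ with hlt | rfl | hlt
  · have hev : ∀ᶠ σ in 𝓝[>] τ', X ∈ leafDom M (h σ) σ ∧ σ ∈ Ioo τ' τ :=
      ((hh.eventually_mem hM hX).filter_mono nhdsWithin_le_nhds).and (Ioo_mem_nhdsGT hlt)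
    -- σ is taken close to τ', since only then is its curve known to exist over X; the curve of
    -- height τ itself need not reach X.
    obtain ⟨σ, hσ, hσ1, hσ2⟩ := hev.exists
    have hcont : Tendsto (fun p : Event => height M (h σ) σ p.2.1)
        (𝓝 (height M (h τ') τ' X, X, x)) (𝓝 (height M (h σ) σ X)) :=
      (continuousAt_height_of_mem hM hσ).tendsto.comp hsnd
    have h1 := hfst.eventually_lt hcont (hh.height_lt hM hσ1 hX hσ)
    have h2 := hsnd.eventually ((isOpen_leafDom M (h σ) σ).mem_nhds hσ)
    obtain ⟨p, hp, hp1, hp2⟩ := (mem_closure_iff_frequently.1 hcl).and_eventually (h1.and h2)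
      |>.exists
    rw [hp.2] at hp1
    exact absurd hp1 (hh.height_lt hM hσ2 hp2 hp.1).not_gt
  · exact ⟨hX, rfl⟩
  · have hev : ∀ᶠ σ in 𝓝[<] τ', X ∈ leafDom M (h σ) σ ∧ σ ∈ Ioo τ τ' :=
      ((hh.eventually_mem hM hX).filter_mono nhdsWithin_le_nhds).and (Ioo_mem_nhdsLT hlt)
    obtain ⟨σ, hσ, hσ1, hσ2⟩ := hev.exists
    have hcont : Tendsto (fun p : Event => height M (h σ) σ p.2.1)
        (𝓝 (height M (h τ') τ' X, X, x)) (𝓝 (height M (h σ) σ X)) :=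
      (continuousAt_height_of_mem hM hσ).tendsto.comp hsnd
    have h1 := hcont.eventually_lt hfst (hh.height_lt hM hσ2 hσ hX)
    have h2 := hsnd.eventually ((isOpen_leafDom M (h σ) σ).mem_nhds hσ)
    obtain ⟨p, hp, hp1, hp2⟩ := (mem_closure_iff_frequently.1 hcl).and_eventually (h1.and h2)
      |>.exists
    rw [hp.2] at hp1
    exact absurd hp1 (hh.height_lt hM hσ1 hp.1 hp2).not_gt

theorem Admissible.isTSSCMC_leaf (hM : 0 < M) {h : ℝ → ℝ} (hh : Admissible M h) {τ : ℝ}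
    (hτ : τ ^ 2 < 2 * M) : IsTSSCMC M (h τ) (leaf M (h τ) τ) where
  subset := by
    rintro ⟨T, X, x⟩ ⟨hX, hT⟩
    dsimp only at hX hT
    subst hT
    exact (leafAt_of_mem hM hX).mem
  closed := hh.closure_leaf_inter hM τ
  spherical _ _ _ _ _ _ hp := hp
  axisymmetric := by
    rintro T X x ⟨hX, hT⟩
    dsimp only at hX hT
    subst hT
    exact ⟨mem_leafDom_of_abs_le hX (abs_neg X).le, (height_neg hM hX).symm⟩
  spacelike_cmc := ⟨leafDom M (h τ) τ, height M (h τ) τ, isOpen_leafDom _ _ _,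
    ordConnected_leafDom _ _ _, ⟨0, zero_mem_leafDom hM _ hτ⟩, fun _ _ => Iff.rfl,
    (contDiffOn_height_rapidity hM).1,
    isSpacelikeCMC_graphChart hM (contDiffOn_height_rapidity hM).1
      (contDiffOn_height_rapidity hM).2 fun _ hX => leafAt_of_mem hM hX⟩

/-- On the axis both sign cases read c = -r³ (H + `axisFlux`), and `axisCurvature` is designed so
that r³ (H + `axisFlux`) = (2M)³ `axisFlux`. -/
theorem hasParameter_leaf (hM : 0 < M) {τ : ℝ} (hτ : τ ^ 2 < 2 * M) :
    HasParameter M (axisCurvature M τ) (-(2 * M) ^ 3 * axisFlux M τ)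
      (leaf M (axisCurvature M τ) τ) := by
  have hr := rho_neg_sq_pos hM hτ
  have hrad : radius M τ 0 = rho M (-τ ^ 2) := by
    rw [radius_eq_rho]
    congr 1
    ring
  have hs := Real.sqrt_pos.2 hr
  have h32 : rho M (-τ ^ 2) ^ (3 / 2 : ℝ) = rho M (-τ ^ 2) * √(rho M (-τ ^ 2)) := by
    rw [show (3 / 2 : ℝ) = 1 + 1 / 2 by norm_num, Real.rpow_add hr, Real.rpow_one,
      Real.sqrt_eq_rpow]
  have h12 : (2 * M - rho M (-τ ^ 2)) ^ (1 / 2 : ℝ)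
      = |τ| * exp (-rho M (-τ ^ 2) / (4 * M)) := by
    rw [← Real.sqrt_eq_rpow, ← sq_mul_exp_sq hM hτ, Real.sqrt_sq_eq_abs, abs_mul,
      abs_of_pos (Real.exp_pos _)]
  have key : -(2 * M) ^ 3 * axisFlux M τ = -axisCurvature M τ * rho M (-τ ^ 2) ^ 3
      - rho M (-τ ^ 2) * √(rho M (-τ ^ 2)) * (τ * exp (-rho M (-τ ^ 2) / (4 * M))) := by
    have h1 : √(rho M (-τ ^ 2)) ^ 2 = rho M (-τ ^ 2) := Real.sq_sqrt hr.le
    unfold axisCurvature axisFlux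
    generalize √(rho M (-τ ^ 2)) = s at *
    generalize rho M (-τ ^ 2) = r at *
    field_simp
    rw [h1]
    ring
  refine ⟨τ, fun x => ⟨zero_mem_leafDom hM _ hτ, (height_zero_eq hM _ hτ).symm⟩, ?_, ?_⟩
  · intro h0
    rw [hrad, h32, h12, abs_of_nonpos h0, key]
    ring
  · intro h0
    rw [hrad, h32, h12, abs_of_nonneg h0, key]

theorem exists_axisFlux_inverse (hM : 0 < M) : ∃ t : ℝ → ℝ, (∀ y, t y ^ 2 < 2 * M) ∧
    (∀ y, axisFlux M (t y) = y) ∧ (∀ τ, τ ^ 2 < 2 * M → t (axisFlux M τ) = τ) ∧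
    StrictMono t ∧ Continuous t := by
  choose t ht1 ht2 using exists_axisFlux_eq hM
  have hle : ∀ τ τ', τ ^ 2 < 2 * M → τ' ^ 2 < 2 * M → axisFlux M τ ≤ axisFlux M τ' → τ ≤ τ' :=
    fun τ τ' h1 h2 h3 => not_lt.1 fun h4 => (axisFlux_lt hM h4 h2 h1).not_ge h3
  have hinv : ∀ τ, τ ^ 2 < 2 * M → t (axisFlux M τ) = τ := fun τ hτ =>
    le_antisymm (hle _ _ (ht1 _) hτ (ht2 _).le) (hle _ _ hτ (ht1 _) (ht2 _).ge)
  have hmono : StrictMono t := by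
    refine strictMono_of_le_iff_le fun y y' => ⟨fun h => ?_, fun h => ?_⟩
    · exact hle _ _ (ht1 _) (ht1 _) (by rwa [ht2, ht2])
    · by_contra! h1
      rcases h.lt_or_eq with h2 | h2
      · have := axisFlux_lt hM h2 (ht1 _) (ht1 _)
        rw [ht2, ht2] at this
        exact this.not_gt h1
      · have := congrArg (axisFlux M) h2
        rw [ht2, ht2] at this
        exact h1.ne' this
  refine ⟨t, ht1, ht2, hinv, hmono, continuous_iff_continuousAt.2 fun y => ?_⟩
  -- A monotone function whose image is a neighbourhood of its value is continuous there; the image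
  -- contains the open interval of all heights.
  refine (hmono.strictMonoOn univ).continuousAt_of_image_mem_nhds univ_mem ?_
  have hopen : IsOpen {τ : ℝ | τ ^ 2 < 2 * M} := isOpen_lt (by fun_prop) continuous_const
  filter_upwards [hopen.mem_nhds (ht1 y)] with τ hτ
  exact ⟨_, mem_univ _, hinv τ hτ⟩

/-- For y ≥ 1 the factor (2M)³/r³ - 1 is at least its positive value at `t 1`, so the curvature
grows at least linearly in y. -/
theorem tendsto_axisCurvature (hM : 0 < M) {t : ℝ → ℝ} (ht1 : ∀ y, t y ^ 2 < 2 * M)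
    (ht2 : ∀ y, axisFlux M (t y) = y) (ht3 : StrictMono t) (ht0 : t 0 = 0) :
    Tendsto (fun y => axisCurvature M (t y)) atTop atTop := by
  have h1 : 0 < t 1 := by
    rw [← ht0]
    exact ht3 one_pos
  refine tendsto_atTop_mono' _ ?_
    (tendsto_id.atTop_mul_const (curvatureFactor_pos hM h1 (ht1 1)))
  filter_upwards [eventually_ge_atTop 1] with y hy
  unfold axisCurvature
  rw [ht2]
  exact mul_le_mul_of_nonneg_left (curvatureFactor_le hM h1.le (ht3.monotone hy) (ht1 y))
    (zero_le_one.trans hy)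

end

end Kruskal

/-! ### Assembly of the foliation -/

open Kruskal Filter

theorem mainTheorem1 (M : ℝ) (hM : 0 < M) :
    ∃ (H : ℝ → ℝ) (S : ℝ → Set Kruskal.Event),
      (∀ c, Kruskal.IsTSSCMC M (H c) (S c) ∧ Kruskal.HasParameter M (H c) c (S c)) ∧
      (∀ c c', c ≠ c' → Disjoint (S c) (S c')) ∧
      (∀ p ∈ Kruskal.extension M, ∃ c, p ∈ S c) ∧
      ((∀ c c', c < c' → Kruskal.LiesBelow (S c') (S c)) ∧
        Continuous H ∧ StrictAnti H ∧
        Filter.Tendsto H Filter.atTop Filter.atBot ∧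
        Filter.Tendsto H Filter.atBot Filter.atTop) ∧
      (∀ c, S (-c) = Kruskal.reflectXAxis ⁻¹' S c) := by
  obtain ⟨t, ht1, ht2, ht3, ht4, ht5⟩ := exists_axisFlux_inverse hM
  have hh := admissible_axisCurvature hM
  -- Solving c = -(2M)³ `axisFlux` for the height gives τ = `t (-(a * c))`.
  set a := ((2 * M) ^ 3)⁻¹ with ha
  have ha0 : 0 < a := by positivity
  have hneg : ∀ y, t (-y) = -t y := fun y => by
    rw [← ht3 (-t y) (by rw [neg_sq]; exact ht1 y), axisFlux_neg, ht2]
  have ht0 : t 0 = 0 := by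
    have := hneg 0
    rw [neg_zero] at this
    linarith
  have hanti : StrictAnti fun c => t (-(a * c)) := fun c c' hc =>
    ht4 (neg_lt_neg (mul_lt_mul_of_pos_left hc ha0))
  have htop := tendsto_axisCurvature hM ht1 ht2 ht4 ht0
  have hbelow : ∀ c c', c < c' →
      LiesBelow (leaf M (axisCurvature M (t (-(a * c')))) (t (-(a * c'))))
        (leaf M (axisCurvature M (t (-(a * c)))) (t (-(a * c)))) := by
    rintro c c' hc T T' X x ⟨h1, h2⟩ ⟨h3, h4⟩
    dsimp only at h1 h2 h3 h4
    rw [h2, h4]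
    exact hh.height_lt hM (hanti hc) h1 h3
  refine ⟨fun c => axisCurvature M (t (-(a * c))),
    fun c => leaf M (axisCurvature M (t (-(a * c)))) (t (-(a * c))), fun c => ⟨?_, ?_⟩, ?_, ?_,
    ⟨hbelow, ?_, ?_, ?_, ?_⟩, ?_⟩
  · exact hh.isTSSCMC_leaf hM (ht1 _)
  · have h1 := hasParameter_leaf hM (ht1 (-(a * c)))
    rwa [ht2, show -(2 * M) ^ 3 * -(a * c) = c by rw [ha]; field_simp] at h1
  · intro c c' hc
    rw [Set.disjoint_left]
    intro p h1 h2
    rcases hc.lt_or_gt with h | h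
    · exact lt_irrefl _ (hbelow c c' h p.1 p.1 p.2.1 p.2.2 h2 h1)
    · exact lt_irrefl _ (hbelow c' c h p.1 p.1 p.2.1 p.2.2 h1 h2)
  · intro p hp
    obtain ⟨τ, h1, h2⟩ := hh.exists_height_eq hM hp
    refine ⟨-(a⁻¹ * axisFlux M τ), ?_⟩
    have h3 : t (-(a * -(a⁻¹ * axisFlux M τ))) = τ := by
      rw [mul_neg, neg_neg, mul_inv_cancel_left₀ ha0.ne', ht3 τ (sq_lt_of_mem_leafDom h1)]
    simp only [h3]
    exact ⟨h1, h2.symm⟩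
  · refine continuous_iff_continuousAt.2 fun c => ?_
    exact ContinuousAt.comp (f := fun c => t (-(a * c)))
      (differentiableAt_axisCurvature hM (ht1 _)).continuousAt
      (ht5.comp (by fun_prop : Continuous fun c => -(a * c))).continuousAt
  · exact fun c c' hc => axisCurvature_lt hM (hanti hc) (ht1 _) (ht1 _)
  -- Oddness of `t` and of `axisCurvature` reduces this limit to the one for y → ∞.
  · have h1 : Tendsto (fun c => a * c) atTop atTop := tendsto_id.const_mul_atTop ha0
    refine (tendsto_neg_atTop_atBot.comp (htop.comp h1)).congr fun c => ?_
    simp [hneg, axisCurvature_neg]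
  · have h1 : Tendsto (fun c => -(a * c)) atBot atTop :=
      tendsto_neg_atBot_atTop.comp (tendsto_id.const_mul_atBot ha0)
    exact htop.comp h1
  · intro c
    have h1 : t (-(a * -c)) = -t (-(a * c)) := by rw [← hneg, mul_neg]
    ext p
    simp only [h1, leaf, reflectXAxis, Set.mem_preimage, Set.mem_ofPred_eq]
    constructor
    · rintro ⟨h2, h3⟩
      obtain ⟨h4, h5⟩ := hh.height_neg_param hM h2
      rw [neg_neg] at h4 h5
      exact ⟨h4, by rw [h5, h3]⟩
    · rintro ⟨h2, h3⟩
      obtain ⟨h4, h5⟩ := hh.height_neg_param hM h2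
      exact ⟨h4, by rw [h5, ← h3, neg_neg]⟩

end
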